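/- For $f\in\mathcal S(\mathbb R^2)$ (complex-valued Schwartz functions) let $$Ef(x)=\int_{\mathbb R} f(s,s^2)\,e^{2\pi i(sx_1+s^2x_2)}\,ds,\qquad x=(x_1,x_2)\in\mathbb R^2,$$ be the Fourier extension operator of the parabola $\mathbb P^1=\{(s,s^2):s\in\mathbb R\}$ equipped with the measure $\mu$ given by $\int f\,d\mu=\int_{\mathbb R}f(s,s^2)\,ds$. For $\omega\in\mathbb S^1$ and $p,q\in[1,\infty]$ consider the following two estimates, each required to hold, with some finite constant $C=C_{\omega,p,q}$, for all $f\in\mathcal S(\mathbb R^2)$ and all $t\in\mathbb R$. * Radon estimate: $\big(\mathcal R(|Ef|^q)(\omega,t)\big)^{1/q}\le C\|f\|_{L^p(\mu)}$, where $\mathcal Rg(\omega,t)$ is the integral of $g$ over the line $\{x\cdot\omega=t\}$ with respect to its Lebesgue measure (for $q=\infty$ the left-hand side is the essential supremum of $|Ef|$ on that line). * Strip estimate: $\|Ef\|_{L^q(\{x\in\mathbb R^2:\,|x\cdot\omega-t|\le 1/2\})}\le C\|f\|_{L^p(\mu)}$. Let $1/\infty=0$. Then the following holds. (a) Let $\omega=(0,1)$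 or $\omega=(0,-1)$. The Radon estimate holds if and only if $\frac1p+\frac1q=1$ and $p\le q$. The strip estimate holds if and only if $\frac1p+\frac1q\le1$, $\frac1p+\frac3q\ge1$, and ($p<q$ or $p=q=2$). (b) Let $\omega\in\mathbb S^1$, $\omega\ne(0,\pm1)$. The Radon estimate holds if and only if $\frac1p+\frac2q=1$ and $p\le q$. The strip estimate holds if either * $p\le q$, $\frac1p+\frac3q\ge1$, $\frac1p+\frac2q\le1$ and $(p,q)\ne(4,4)$, or * $p>q$, $\frac1p+\frac1q>\frac12$ and $\frac1p+\frac2q<1$; that is, if $(\frac1p,\frac1q)$ lies in the closed triangle with vertices $B=(\frac14,\frac14)$, $A=(1,0)$, $D=(0,\frac12)$ with $[B,D]\cup[D,E)$ removed, where $E=(\frac13,\frac13)$. The strip estimate fails for all other $(p,q)\in[1,\infty]^2$, except possibly when $(\frac1p,\frac1q)$ lies on the open segment $(B,D)$, that is, when $\frac1p+\frac1q=\frac12$ and $4<p<\infty$. -/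

import Mathlib

open MeasureTheory
open scoped ENNReal NNReal SchwartzMap FourierTransform

noncomputable section

/-- The Euclidean plane. -/
abbrev Plane : Type := EuclideanSpace ℝ (Fin 2)

/-- The parametrization `s ↦ (s, s²)` of the parabola. -/
def parabolaPoint (s : ℝ) : Plane := !₂[s, s ^ 2]

/-- The measure carried by the parabola: the pushforward of Lebesgue measure on `ℝ` from the
horizontal variable, so that `∫ f dμ = ∫ f (s, s²) ds`. -/
def parabolaMeasure : Measure Plane := (volume : Measure ℝ).map parabolaPoint

/-- The Fourier extension operator of a measure `μ` on the plane,
`E f (x) = ∫ f(ξ) exp (2 π i ξ · x) dμ(ξ)`. -/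
def fourierExtension (μ : Measure Plane) (f : 𝓢(Plane, ℂ)) (x : Plane) : ℂ :=
  ∫ ξ, f ξ * Complex.exp (2 * Real.pi * Complex.I * (inner ℝ ξ x : ℝ)) ∂μ

/-- The closed strip of width one around the line `x · ω = t`. -/
def strip (ω : Plane) (t : ℝ) : Set Plane := {x | |inner ℝ x ω - t| ≤ 1 / 2}

/-- Lebesgue measure (arc length) on the line `x · ω = t`, for a unit vector `ω`: the pushforward
of Lebesgue measure on `ℝ` under the unit speed parametrization `s ↦ t ω + s ω^⊥`. -/
def lineMeasure (ω : Plane) (t : ℝ) : Measure Plane :=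
  (volume : Measure ℝ).map fun s : ℝ => t • ω + s • (!₂[-ω 1, ω 0] : Plane)

/-- The Radon transform of a nonnegative function, with values in `[0, ∞]`. -/
def radonTransform (g : Plane → ℝ≥0∞) (ω : Plane) (t : ℝ) : ℝ≥0∞ :=
  ∫⁻ x, g x ∂(lineMeasure ω t)

/-- The quantity `(R(|F|^q)(ω, t))^(1/q)`; for `q = ∞` it is, as usual, the essential supremum of
`|F|` on the line `x · ω = t`. -/
def radonNorm (F : Plane → ℂ) (q : ℝ≥0∞) (ω : Plane) (t : ℝ) : ℝ≥0∞ :=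
  if q = ∞ then essSup (fun x => ‖F x‖ₑ) (lineMeasure ω t)
  else (radonTransform (fun x => ‖F x‖ₑ ^ q.toReal) ω t) ^ (1 / q.toReal)

/-- The strip estimate
`‖E f‖_{L^q({|x · ω - t| ≤ 1/2})} ≤ C ‖f‖_{L^p(μ)}` for all Schwartz functions `f` and all real
`t`, with a finite constant `C` that depends on neither. -/
def StripEstimate (μ : Measure Plane) (ω : Plane) (p q : ℝ≥0∞) : Prop :=
  ∃ C : ℝ≥0, ∀ (f : 𝓢(Plane, ℂ)) (t : ℝ),
    eLpNorm (fourierExtension μ f) q (volume.restrict (strip ω t)) ≤ C * eLpNorm f p μ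

/-- The Radon estimate `(R(|E f|^q)(ω, t))^(1/q) ≤ C ‖f‖_{L^p(μ)}` for all Schwartz functions `f`,
uniformly in `t`. -/
def RadonEstimate (μ : Measure Plane) (ω : Plane) (p q : ℝ≥0∞) : Prop :=
  ∃ C : ℝ≥0, ∀ (f : 𝓢(Plane, ℂ)) (t : ℝ),
    radonNorm (fourierExtension μ f) q ω t ≤ C * eLpNorm f p μ

/-- The region of exponents for the strip estimate in the non-transversal directions: in the
`(1/p, 1/q)` plane, the triangle with vertices `B = (1/4, 1/4)`, `A = (1, 0)`, `D = (0, 1/2)`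
without `[B, D]` and without `[D, E)`, where `E = (1/3, 1/3)`. -/
def NonTransversalRegion (p q : ℝ≥0∞) : Prop :=
  (p ≤ q ∧ 1 ≤ 1 / p + 3 / q ∧ 1 / p + 2 / q ≤ 1 ∧ ¬(p = 4 ∧ q = 4)) ∨
    (q < p ∧ 1 / 2 < 1 / p + 1 / q ∧ 1 / p + 2 / q < 1)

/-- `(1/p, 1/q)` lies on the open segment between `(1/4, 1/4)` and `(0, 1/2)`. -/
def OpenSegmentBD (p q : ℝ≥0∞) : Prop :=
  1 / p + 1 / q = 1 / 2 ∧ 4 < p ∧ p < ∞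

end

/-! ### Dyadic sums and layer-cake estimates used by the interpolation theorem -/

section Interpolation

/-! Write x = 1/p, y = 1/q and view f on the parabola as a function g of s. Moving a line or strip
by tω modulates g, which changes no L^p norm, so t = 0 suffices. If ω is not vertical, translating g
acts on Eg by a Galilean shear, which turns the line into the vertical axis and the strip into a
vertical strip. Only four model measures remain: `horLine`, `horStrip`, `vertLine`, `vertStrip`.
Positive results are proved for all integrable g (`HasStrongType`), negative ones refute the
estimate for smooth integrable g (`HasSmoothType`), which follows from the Schwartz estimate by
cutting off.

Sufficiency. On the horizontal axis Eg is the Fourier transform of g, and Hausdorff–Young applies.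
On the vertical axis the substitution u = s² again gives a Fourier transform, and Hausdorff–Young
becomes an inequality with the weight |s|^(1-r), r = 1/(1-y). For functions dominated by an
indicator this is a restricted type on x + 2y = 1; real interpolation along that line
(`HasRestrictedType.interpolate`) makes it strong where y ≤ x (`hasStrongType_vertLine`). Strips
inherit the line estimates by Fubini, and also the Fefferman–Zygmund estimate of the whole plane on
x + 3y = 1, y < 1/4 (`hasStrongType_extOp`), obtained by writing (Eg)² as the Fourier transform of a
planar density. Interpolation between these gives the horizontal strip, and the vertical strip for x
≥ 1/3. For x < 1/3 and off the line x + 3y = 1, g is cut into shells |s| ~ 2^j: one estimate gains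
for small j, another for large j, and the pieces sum geometrically (`hasStrongType_vertStrip`).

Necessity. For a Gaussian g the modulus of Eg is explicit (`norm_extOp_gaussianFn`), and letting its
width tend to 0 or ∞ on suitable boxes gives all linear conditions. Three facts need more. At (1/4,
1/4) on the vertical strip, logarithmically many boxes contribute equally to the norm of one
Gaussian (`not_hasSmoothType_vertStrip_quarter`). On x + 2y = 1, randomly signed dilates of a bump
show that y ≤ x (`HasSmoothType.vertStrip_le_of_eq`). On the diagonal 0 < x = y < 1/2 of the
horizontal strip, randomly signed wave packets are focused on tubes of a Besicovitch-type
arrangement whose union is small compared with the total area of the tubes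
(`not_hasSmoothType_horStrip_diag`). -/

lemma two_rpow_add (a b : ℝ) : (2 : ℝ≥0∞) ^ (a + b) = 2 ^ a * 2 ^ b :=
  ENNReal.rpow_add _ _ (by norm_num) (by norm_num)

lemma two_rpow_ne_zero (a : ℝ) : (2 : ℝ≥0∞) ^ a ≠ 0 :=
  (ENNReal.rpow_pos (by norm_num) (by norm_num)).ne'

lemma two_rpow_ne_top (a : ℝ) : (2 : ℝ≥0∞) ^ a ≠ ∞ :=
  ENNReal.rpow_ne_top_of_ne_zero (by norm_num) (by norm_num)

lemma two_rpow_neg_mul (a : ℝ) : (2 : ℝ≥0∞) ^ (-a) * 2 ^ a = 1 := by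
  rw [← two_rpow_add]; simp

lemma two_zpow_eq_rpow (n : ℤ) : (2 : ℝ≥0∞) ^ n = 2 ^ (n : ℝ) := (ENNReal.rpow_intCast _ _).symm

lemma exists_two_rpow_lt {c : ℝ≥0∞} (hc : c ≠ 0) {a : ℝ} (ha : 0 < a) (N : ℤ) :
    ∃ n : ℤ, n ≤ N ∧ (2 : ℝ≥0∞) ^ (a * n) < c := by
  have h1 : (2 : ℝ≥0∞) ^ (-a) < 1 := by
    rw [ENNReal.rpow_neg]
    exact ENNReal.inv_lt_one.2 (ENNReal.one_lt_rpow (by norm_num) ha)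
  have ht := ENNReal.tendsto_pow_atTop_nhds_zero_of_lt_one h1
  obtain ⟨k, hk, hk2⟩ := ((ht.eventually (gt_mem_nhds (pos_iff_ne_zero.2 hc))).and
    (Filter.eventually_ge_atTop N.natAbs)).exists
  refine ⟨-(k : ℤ), by omega, ?_⟩
  convert hk using 1
  rw [← ENNReal.rpow_natCast, ← ENNReal.rpow_mul]
  congr 1
  push_cast
  ring

variable {α β : Type*} [MeasurableSpace α] [MeasurableSpace β] {μ : Measure α} {ν : Measure β}

/-- A layer-cake bound in which the thresholds `τ` need not be monotone. Almost every z with F z ≠ 0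
lies outside S n for some arbitrarily negative n and inside S n for some n, so there is a crossing
index with z ∉ S n and z ∈ S (n + 1); there F z ≤ τ n, on a set of measure at most 2 · 2^(γ(n+1)).
-/
theorem lintegral_rpow_le_of_superlevel {F : β → ℝ≥0∞} (hF : Measurable F) {q γ : ℝ} (hq : 0 < q)
    (hγ : 0 < γ) (τ : ℤ → ℝ≥0∞)
    (h : ∀ n : ℤ, ν {z | τ n < F z} ≤ 2 * 2 ^ (γ * n)) :
    ∫⁻ z, F z ^ q ∂ν ≤ 2 * 2 ^ γ * ∑' n : ℤ, τ n ^ q * 2 ^ (γ * n) := by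
  set D := ∑' n : ℤ, τ n ^ q * (2 : ℝ≥0∞) ^ (γ * n) with hD
  rcases eq_or_ne D ∞ with hDtop | hDtop
  · rw [hDtop, ENNReal.mul_top]
    · exact le_top
    · exact mul_ne_zero (by norm_num) (two_rpow_ne_zero _)
  set S : ℤ → Set β := fun n => {z | τ n < F z} with hS
  have hSm : ∀ n, MeasurableSet (S n) := fun n => measurableSet_lt measurable_const hF
  have hnull : ∀ N : ℤ, ν (⋂ n : Set.Iic N, S n) = 0 := by
    intro N
    by_contra hne
    have h2 : ν (⋂ n : Set.Iic N, S n) / 2 ≠ 0 := ENNReal.div_ne_zero.2 ⟨hne, by norm_num⟩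
    obtain ⟨n, hn, hlt⟩ := exists_two_rpow_lt h2 hγ N
    have h3 : ν (⋂ n : Set.Iic N, S n) ≤ 2 * 2 ^ (γ * n) :=
      (measure_mono (Set.iInter_subset (fun n : Set.Iic N => S n) ⟨n, hn⟩)).trans (h n)
    have h4 : 2 * (2 : ℝ≥0∞) ^ (γ * n) < 2 * (ν (⋂ n : Set.Iic N, S n) / 2) :=
      ENNReal.mul_lt_mul_right (by norm_num) (by norm_num) hlt
    rw [ENNReal.mul_div_cancel (by norm_num) (by norm_num)] at h4
    exact absurd h3 (not_le.2 h4)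
  have hae : ∀ᵐ z ∂ν, ∀ N : ℤ, ∃ n ≤ N, z ∉ S n := by
    rw [ae_all_iff]
    intro N
    have := measure_eq_zero_iff_ae_notMem.1 (hnull N)
    filter_upwards [this] with z hz
    simpa using hz
  have hpt : ∀ᵐ z ∂ν, F z ^ q ≤ ∑' n : ℤ, (S (n + 1)).indicator (fun _ => τ n ^ q) z := by
    filter_upwards [hae] with z hz
    rcases eq_or_ne (F z) 0 with h0 | h0
    · simp [h0, hq]
    -- Otherwise F z ≤ τ n for every n, so F z ^ q ≤ 2^(-γn) D for every n, and n → ∞ forces F z =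
    -- 0.
    have hex : ∃ n0 : ℤ, z ∈ S n0 := by
      by_contra hcon
      push Not at hcon
      have hle : ∀ n : ℤ, F z ^ q ≤ 2 ^ (-(γ * n)) * D := by
        intro n
        have h1 : F z ≤ τ n := not_lt.1 (hcon n)
        have h2 : τ n ^ q * (2 : ℝ≥0∞) ^ (γ * n) ≤ D :=
          ENNReal.le_tsum (f := fun n : ℤ => τ n ^ q * (2 : ℝ≥0∞) ^ (γ * n)) n
        calc F z ^ q ≤ τ n ^ q := ENNReal.rpow_le_rpow h1 hq.le
          _ = 2 ^ (-(γ * n)) * (τ n ^ q * (2 : ℝ≥0∞) ^ (γ * n)) := by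
              rw [mul_comm (τ n ^ q), ← mul_assoc, two_rpow_neg_mul, one_mul]
          _ ≤ _ := by gcongr
      have hF0 : F z ^ q ≠ 0 := by
        simp [ENNReal.rpow_eq_zero_iff, h0, hq.le]
      have hne : F z ^ q / (D + 1) ≠ 0 := by
        simp [ENNReal.div_eq_zero_iff, hF0, hDtop]
      obtain ⟨n, -, hn⟩ := exists_two_rpow_lt hne hγ 0
      have h5 := hle (-n)
      have h6 : (2 : ℝ≥0∞) ^ (-(γ * ((-n : ℤ) : ℝ))) * D < F z ^ q := by
        have : -(γ * ((-n : ℤ) : ℝ)) = γ * n := by push_cast; ring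
        rw [this]
        calc (2 : ℝ≥0∞) ^ (γ * n) * D ≤ (2 : ℝ≥0∞) ^ (γ * n) * (D + 1) := by gcongr; simp
          _ < F z ^ q / (D + 1) * (D + 1) :=
            ENNReal.mul_lt_mul_left (by simp) (by simp [hDtop]) hn
          _ = F z ^ q := ENNReal.div_mul_cancel (by simp) (by simp [hDtop])
      exact absurd h5 (not_le.2 h6)
    obtain ⟨n0, hn0⟩ := hex
    obtain ⟨n1, hn1, hn1'⟩ := hz n0
    have : ∃ n : ℤ, z ∉ S n ∧ z ∈ S (n + 1) := by
      by_contra hcon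
      push Not at hcon
      have : ∀ n : ℤ, n1 ≤ n → z ∉ S n := fun n hn =>
        Int.leInduction hn1' (fun k _ hk => hcon k hk) n hn
      exact this n0 hn1 hn0
    obtain ⟨n, hn, hn'⟩ := this
    calc F z ^ q ≤ τ n ^ q := ENNReal.rpow_le_rpow (not_lt.1 hn) hq.le
      _ = (S (n + 1)).indicator (fun _ => τ n ^ q) z := by rw [Set.indicator_of_mem hn']
      _ ≤ _ := ENNReal.le_tsum (f := fun n : ℤ => (S (n + 1)).indicator (fun _ => τ n ^ q) z) n
  calc ∫⁻ z, F z ^ q ∂ν ≤ ∫⁻ z, ∑' n : ℤ, (S (n + 1)).indicator (fun _ => τ n ^ q) z ∂ν :=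
        lintegral_mono_ae hpt
    _ = ∑' n : ℤ, τ n ^ q * ν (S (n + 1)) := by
        rw [lintegral_tsum (fun n => (measurable_const.indicator (hSm _)).aemeasurable)]
        simp_rw [lintegral_indicator_const (hSm _)]
    _ ≤ ∑' n : ℤ, 2 * 2 ^ γ * (τ n ^ q * 2 ^ (γ * n)) := by
        refine ENNReal.tsum_le_tsum fun n => ?_
        calc τ n ^ q * ν (S (n + 1)) ≤ τ n ^ q * (2 * 2 ^ (γ * (n + 1 : ℤ))) := by
              gcongr; exact h _
          _ = _ := by
              have : γ * ((n + 1 : ℤ) : ℝ) = γ + γ * n := by push_cast; ring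
              rw [this, two_rpow_add]; ring
    _ = _ := by rw [ENNReal.tsum_mul_left]

/-- The case of negative γ is the previous one with the index reversed. -/
theorem lintegral_rpow_le_of_superlevel' {F : β → ℝ≥0∞} (hF : Measurable F) {q γ : ℝ} (hq : 0 < q)
    (hγ : γ ≠ 0) (τ : ℤ → ℝ≥0∞)
    (h : ∀ n : ℤ, ν {z | τ n < F z} ≤ 2 * 2 ^ (γ * n)) :
    ∫⁻ z, F z ^ q ∂ν ≤ 2 * 2 ^ |γ| * ∑' n : ℤ, τ n ^ q * 2 ^ (γ * n) := by
  rcases lt_or_gt_of_ne hγ with h0 | h0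
  · have := lintegral_rpow_le_of_superlevel hF hq (neg_pos.2 h0) (fun n => τ (-n))
      (fun n => by simpa using h (-n))
    rw [abs_of_neg h0]
    refine this.trans (le_of_eq ?_)
    congr 1
    rw [← (Equiv.neg ℤ).tsum_eq (fun n : ℤ => τ n ^ q * (2 : ℝ≥0∞) ^ (γ * n))]
    simp
  · rw [abs_of_pos h0]
    exact lintegral_rpow_le_of_superlevel hF hq h0 τ h

lemma tsum_two_rpow_neg_abs_ne_top {a : ℝ} (ha : 0 < a) :
    ∑' n : ℤ, (2 : ℝ≥0∞) ^ (-(a * |(n : ℝ)|)) ≠ ∞ := by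
  have hr : (2 : ℝ≥0∞) ^ (-a) < 1 := by
    rw [ENNReal.rpow_neg]
    exact ENNReal.inv_lt_one.2 (ENNReal.one_lt_rpow (by norm_num) ha)
  have hg : ∑' n : ℕ, ((2 : ℝ≥0∞) ^ (-a)) ^ n ≠ ∞ := by
    rw [ENNReal.tsum_geometric]
    simp [tsub_eq_zero_iff_le, hr]
  have hn : ∀ n : ℕ, (2 : ℝ≥0∞) ^ (-(a * (n : ℝ))) = ((2 : ℝ≥0∞) ^ (-a)) ^ n := by
    intro n
    rw [← ENNReal.rpow_natCast, ← ENNReal.rpow_mul]; ring_nf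
  rw [tsum_of_nat_of_neg_add_one ENNReal.summable ENNReal.summable]
  refine ENNReal.add_ne_top.2 ⟨?_, ?_⟩
  · simpa [hn] using hg
  · refine ne_top_of_le_ne_top hg (ENNReal.tsum_le_tsum fun n => ?_)
    rw [← hn]
    refine ENNReal.rpow_le_rpow_of_exponent_le (by norm_num) ?_
    have : |((-((n : ℤ) + 1) : ℤ) : ℝ)| = n + 1 := by
      push_cast
      rw [abs_neg, abs_of_nonneg (by positivity)]
    rw [this]
    nlinarith

/-- A discrete form of Young's inequality for a geometric kernel. -/
theorem tsum_rpow_geometric_convolution_le {a q : ℝ} (ha : 0 < a) (hq : 1 ≤ q) :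
    ∃ Z : ℝ≥0, ∀ (M : Finset ℤ) (c : ℤ → ℝ≥0∞),
      ∑' n : ℤ, (∑ m ∈ M, 2 ^ (-(a * |(n : ℝ) - m|)) * c m) ^ q ≤ Z * ∑ m ∈ M, c m ^ q := by
  set η : ℤ → ℝ≥0∞ := fun n => 2 ^ (-(a * |(n : ℝ)|)) with hη
  have hfin : ∑' n : ℤ, η n ≠ ∞ := tsum_two_rpow_neg_abs_ne_top ha
  set Z0 := ∑' n : ℤ, η n
  have hq0 : 0 < q := by linarith
  have hshift : ∀ m : ℤ, ∑' n : ℤ, η (n - m) = Z0 := fun m =>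
    (Equiv.subRight m).tsum_eq η
  have hZ : Z0 ^ q ≠ ∞ := ENNReal.rpow_ne_top_of_nonneg hq0.le hfin
  refine ⟨(Z0 ^ q).toNNReal, fun M c => ?_⟩
  rw [ENNReal.coe_toNNReal hZ]
  have hη' : ∀ n m : ℤ, (2 : ℝ≥0∞) ^ (-(a * |(n : ℝ) - m|)) = η (n - m) := by
    intro n m; simp [hη]
  simp_rw [hη']
  have hsum : ∀ n : ℤ, ∑ m ∈ M, η (n - m) ≤ Z0 := by
    intro n
    refine (ENNReal.sum_le_tsum M).trans (le_of_eq ?_)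
    exact (Equiv.subLeft n).tsum_eq η
  have hpt : ∀ n : ℤ, (∑ m ∈ M, η (n - m) * c m) ^ q ≤ Z0 ^ (q - 1) * ∑ m ∈ M, η (n - m) * c m ^ q := by
    intro n
    have := ENNReal.inner_le_weight_mul_Lp_of_nonneg M hq (fun m => η (n - m)) c
    calc (∑ m ∈ M, η (n - m) * c m) ^ q
        ≤ ((∑ m ∈ M, η (n - m)) ^ (1 - q⁻¹) * (∑ m ∈ M, η (n - m) * c m ^ q) ^ q⁻¹) ^ q :=
          ENNReal.rpow_le_rpow this hq0.le
      _ = (∑ m ∈ M, η (n - m)) ^ (q - 1) * ∑ m ∈ M, η (n - m) * c m ^ q := by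
          rw [ENNReal.mul_rpow_of_nonneg _ _ hq0.le, ← ENNReal.rpow_mul, ← ENNReal.rpow_mul,
            inv_mul_cancel₀ hq0.ne', ENNReal.rpow_one]
          congr 2
          field_simp
      _ ≤ _ := by
          have : 0 ≤ q - 1 := by linarith
          gcongr
          exact hsum n
  calc ∑' n : ℤ, (∑ m ∈ M, η (n - m) * c m) ^ q
      ≤ ∑' n : ℤ, Z0 ^ (q - 1) * ∑ m ∈ M, η (n - m) * c m ^ q := ENNReal.tsum_le_tsum hpt
    _ = Z0 ^ (q - 1) * ∑ m ∈ M, ∑' n : ℤ, η (n - m) * c m ^ q := by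
        rw [ENNReal.tsum_mul_left, Summable.tsum_finsetSum (fun _ _ => ENNReal.summable)]
    _ = Z0 ^ (q - 1) * ∑ m ∈ M, Z0 * c m ^ q := by
        congr 1
        refine Finset.sum_congr rfl fun m _ => ?_
        rw [ENNReal.tsum_mul_right, hshift]
    _ = Z0 ^ q * ∑ m ∈ M, c m ^ q := by
        rw [← Finset.mul_sum, ← mul_assoc]
        congr 1
        nth_rw 2 [← ENNReal.rpow_one Z0]
        rw [← ENNReal.rpow_add_of_nonneg _ _ (by linarith) (by norm_num)]
        congr 1; ring

lemma sum_two_zpow_le {K : Finset ℤ} {k0 : ℤ} (h : ∀ k ∈ K, k ≤ k0) :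
    ∑ k ∈ K, (2 : ℝ≥0∞) ^ (k : ℝ) ≤ 2 * 2 ^ (k0 : ℝ) := by
  have hinj : Set.InjOn (fun k : ℤ => (k0 - k).toNat) K := by
    intro a ha b hb hab
    have := h a ha; have := h b hb
    simp only at hab
    omega
  calc ∑ k ∈ K, (2 : ℝ≥0∞) ^ (k : ℝ) = ∑ k ∈ K, 2 ^ (k0 : ℝ) * (2 : ℝ≥0∞)⁻¹ ^ ((k0 - k).toNat) := by
        refine Finset.sum_congr rfl fun k hk => ?_
        have hk' := h k hk
        have h1 : ((k0 - k).toNat : ℝ) = k0 - k := by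
          have : ((k0 - k).toNat : ℤ) = k0 - k := Int.toNat_of_nonneg (by omega)
          exact_mod_cast this
        rw [← ENNReal.rpow_natCast, ENNReal.inv_rpow, ← ENNReal.rpow_neg, ← two_rpow_add, h1]
        congr 1; ring
    _ = 2 ^ (k0 : ℝ) * ∑ i ∈ K.image (fun k : ℤ => (k0 - k).toNat), (2 : ℝ≥0∞)⁻¹ ^ i := by
        rw [Finset.sum_image hinj, Finset.mul_sum]
    _ ≤ 2 ^ (k0 : ℝ) * 2 := by
        gcongr
        refine (ENNReal.sum_le_tsum _).trans ?_
        rw [ENNReal.tsum_geometric, ENNReal.one_sub_inv_two, inv_inv]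
    _ = _ := mul_comm _ _

/-- A sum of distinct powers of two is at most twice its largest term, so a power can be moved
inside at a cost independent of the number of terms. -/
lemma rpow_sum_two_zpow_le (K : Finset ℤ) {p : ℝ} (hp : 0 < p) :
    (∑ k ∈ K, (2 : ℝ≥0∞) ^ (k : ℝ)) ^ p ≤ 2 ^ p * ∑ k ∈ K, (2 : ℝ≥0∞) ^ ((k : ℝ) * p) := by
  rcases K.eq_empty_or_nonempty with rfl | hK
  · simp [hp]
  have h1 := sum_two_zpow_le (K := K) (k0 := K.max' hK) (fun k hk => K.le_max' k hk)
  calc (∑ k ∈ K, (2 : ℝ≥0∞) ^ (k : ℝ)) ^ p ≤ (2 * 2 ^ ((K.max' hK : ℤ) : ℝ)) ^ p :=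
        ENNReal.rpow_le_rpow h1 hp.le
    _ = 2 ^ p * 2 ^ (((K.max' hK : ℤ) : ℝ) * p) := by
        rw [ENNReal.mul_rpow_of_nonneg _ _ hp.le, ← ENNReal.rpow_mul]
    _ ≤ _ := by
        gcongr
        exact Finset.single_le_sum (f := fun k : ℤ => (2 : ℝ≥0∞) ^ ((k : ℝ) * p))
          (fun _ _ => zero_le) (K.max'_mem hK)

lemma sum_rpow_le_rpow_sum {ι : Type*} (M : Finset ι) (c : ι → ℝ≥0∞) {r : ℝ} (hr : 1 ≤ r) :
    ∑ m ∈ M, c m ^ r ≤ (∑ m ∈ M, c m) ^ r := by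
  classical
  induction M using Finset.induction_on with
  | empty => simp [show (0:ℝ) < r by linarith]
  | insert a s ha ih =>
    rw [Finset.sum_insert ha, Finset.sum_insert ha]
    exact (add_le_add_right ih _).trans (ENNReal.add_rpow_le_rpow_add _ _ hr)

end Interpolation

/-! ### Exponents 1/y, bounded kernels, restricted and strong type -/

noncomputable section

lemma two_zpow_eq_ofReal (n : ℤ) : (2 : ℝ≥0∞) ^ n = ENNReal.ofReal ((2 : ℝ) ^ n) := by
  rw [two_zpow_eq_rpow, ← Real.rpow_intCast, ← ENNReal.ofReal_rpow_of_pos (by norm_num)]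
  simp

/-- The Lebesgue exponent `1 / y`, with `1 / 0 = ∞`. -/
def recipExp (y : ℝ) : ℝ≥0∞ := (ENNReal.ofReal y)⁻¹

lemma recipExp_zero : recipExp 0 = ∞ := by simp [recipExp]

lemma recipExp_ne_zero (y : ℝ) : recipExp y ≠ 0 := by simp [recipExp]

lemma recipExp_ne_top {y : ℝ} (hy : 0 < y) : recipExp y ≠ ∞ := by simp [recipExp, hy]

lemma recipExp_toReal {y : ℝ} (hy : 0 < y) : (recipExp y).toReal = y⁻¹ := by
  rw [recipExp, ENNReal.toReal_inv, ENNReal.toReal_ofReal hy.le]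

lemma one_le_recipExp {y : ℝ} (hy : y ≤ 1) : 1 ≤ recipExp y := by
  rw [recipExp, ENNReal.one_le_inv]
  simpa using hy

lemma recipExp_one : recipExp 1 = 1 := by simp [recipExp]

lemma recipExp_half : recipExp (1 / 2) = 2 := by
  rw [recipExp, one_div, ENNReal.ofReal_inv_of_pos (by norm_num), inv_inv]; simp

section Interpolation

variable {α β : Type*} [MeasurableSpace α] [MeasurableSpace β] {μ : Measure α} {ν : Measure β}

lemma eLpNorm_recipExp {E : Type*} [ENorm E] {y : ℝ} (hy : 0 < y) (f : β → E) :
    eLpNorm f (recipExp y) ν = (∫⁻ z, ‖f z‖ₑ ^ y⁻¹ ∂ν) ^ y := by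
  rw [eLpNorm_eq_lintegral_rpow_enorm_toReal (recipExp_ne_zero y) (recipExp_ne_top hy),
    recipExp_toReal hy]
  simp

lemma eLpNorm_recipExp_zero {E : Type*} [ENorm E] (f : β → E) :
    eLpNorm f (recipExp 0) ν = essSup (fun z => ‖f z‖ₑ) ν := by
  rw [recipExp_zero, eLpNorm_exponent_top]; rfl

/-- Chebyshev's inequality, with the level chosen so that the bound is exactly `w`. For y = 0 it
says that the level M is exceeded only on a null set, so that q = ∞ can serve as an endpoint of the
interpolation. -/
lemma measure_superlevel_le {f : β → ℂ} (hf : AEStronglyMeasurable f ν) {y : ℝ} (hy : 0 ≤ y)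
    {M w : ℝ≥0∞} (hw : w ≠ 0) (hw' : w ≠ ∞) (h : eLpNorm f (recipExp y) ν ≤ M) :
    ν {z | M * w ^ (-y) < ‖f z‖ₑ} ≤ w := by
  rcases hy.eq_or_lt with rfl | hy
  · have h0 : ν {z | M * w ^ (-(0 : ℝ)) < ‖f z‖ₑ} = 0 := by
      rw [eLpNorm_recipExp_zero] at h
      have := ae_le_essSup (f := fun z => ‖f z‖ₑ) (μ := ν)
      refine measure_mono_null ?_ (ae_iff.1 this)
      intro z hz
      simp only [neg_zero, ENNReal.rpow_zero, mul_one, Set.mem_ofPred_eq] at hz ⊢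
      exact not_le.2 (h.trans_lt hz)
    rw [h0]; exact zero_le
  rcases eq_or_ne M 0 with rfl | hM
  · have h1 : f =ᵐ[ν] 0 := (eLpNorm_eq_zero_iff hf (recipExp_ne_zero y)).1 (nonpos_iff_eq_zero.1 h)
    have h0 : ν {z | 0 * w ^ (-y) < ‖f z‖ₑ} = 0 := by
      refine measure_mono_null ?_ (ae_iff.1 h1)
      intro z hz
      simpa using hz
    rw [h0]; exact zero_le
  rcases eq_or_ne M ∞ with rfl | hM'
  · rw [ENNReal.top_mul (by simp [ENNReal.rpow_eq_zero_iff, hw, hw'])]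
    simp
  have h1 := (mul_meas_ge_le_pow_eLpNorm' ν (recipExp_ne_zero y) (recipExp_ne_top hy) hf
    (M * w ^ (-y))).trans (ENNReal.rpow_le_rpow h ENNReal.toReal_nonneg)
  rw [recipExp_toReal hy, ENNReal.mul_rpow_of_nonneg _ _ (by positivity), ← ENNReal.rpow_mul,
    show -y * y⁻¹ = -1 by field_simp, ENNReal.rpow_neg_one, mul_assoc] at h1
  have hMy : M ^ y⁻¹ ≠ 0 := by simp [ENNReal.rpow_eq_zero_iff, hM, hM']
  have hMy' : M ^ y⁻¹ ≠ ∞ := ENNReal.rpow_ne_top_of_nonneg (by positivity) hM'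
  have h2 : w⁻¹ * ν {z | M * w ^ (-y) ≤ ‖f z‖ₑ} ≤ 1 := by
    rw [← mul_one (M ^ y⁻¹)] at h1
    rw [mul_assoc, one_mul] at h1
    exact (ENNReal.mul_le_mul_iff_right hMy hMy').1 h1
  have h3 : ν {z | M * w ^ (-y) ≤ ‖f z‖ₑ} ≤ w := by
    calc _ = w * (w⁻¹ * ν {z | M * w ^ (-y) ≤ ‖f z‖ₑ}) := by
          rw [← mul_assoc, ENNReal.mul_inv_cancel hw hw', one_mul]
      _ ≤ w * 1 := by gcongr
      _ = w := mul_one _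
  refine le_trans (measure_mono ?_) h3
  intro z hz
  simp only [Set.mem_ofPred_eq] at hz ⊢
  exact hz.le

/-- The integral operator with kernel `K`. -/
def kernelOp (K : β → α → ℂ) (μ : Measure α) (g : α → ℂ) (z : β) : ℂ := ∫ s, K z s * g s ∂μ

/-- A jointly measurable kernel of modulus at most one. -/
structure BoundedKernel (K : β → α → ℂ) : Prop where
  measurable : Measurable (Function.uncurry K)
  norm_le : ∀ z s, ‖K z s‖ ≤ 1

variable {K : β → α → ℂ}

lemma BoundedKernel.integrable (hK : BoundedKernel K) {g : α → ℂ} (hg : Integrable g μ) (z : β) :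
    Integrable (fun s => K z s * g s) μ := by
  refine hg.bdd_mul (c := 1) ?_ (Filter.Eventually.of_forall fun s => hK.norm_le z s)
  exact (hK.measurable.comp measurable_prodMk_left).aestronglyMeasurable

lemma kernelOp_congr {g h : α → ℂ} (hgh : g =ᵐ[μ] h) : kernelOp K μ g = kernelOp K μ h := by
  funext z
  refine integral_congr_ae ?_
  filter_upwards [hgh] with s hs
  rw [hs]

lemma BoundedKernel.measurable_kernelOp [SFinite μ] (hK : BoundedKernel K) {g : α → ℂ}
    (hg : AEStronglyMeasurable g μ) : Measurable (kernelOp K μ g) := by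
  rw [kernelOp_congr hg.ae_eq_mk]
  refine StronglyMeasurable.measurable ?_
  refine StronglyMeasurable.integral_prod_right (f := fun z s => K z s * hg.mk g s) ?_
  exact (hK.measurable.mul (hg.measurable_mk.comp measurable_snd)).stronglyMeasurable

lemma kernelOp_const_mul (c : ℂ) (g : α → ℂ) :
    kernelOp K μ (fun s => c * g s) = fun z => c * kernelOp K μ g z := by
  funext z
  simp only [kernelOp, ← integral_const_mul]
  congr 1; funext s; ring

lemma BoundedKernel.kernelOp_sum (hK : BoundedKernel K) {ι : Type*} (t : Finset ι)
    {g : ι → α → ℂ} (hg : ∀ i ∈ t, Integrable (g i) μ) :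
    kernelOp K μ (fun s => ∑ i ∈ t, g i s) = ∑ i ∈ t, kernelOp K μ (g i) := by
  funext z
  simp only [kernelOp, Finset.mul_sum, Finset.sum_apply]
  exact integral_finsetSum _ fun i hi => hK.integrable (hg i hi) z

lemma BoundedKernel.tendsto_kernelOp (hK : BoundedKernel K) {g : α → ℂ} {G : ℕ → α → ℂ}
    (hg : Integrable g μ) (hG : ∀ n, AEStronglyMeasurable (G n) μ)
    (hle : ∀ n s, ‖G n s‖ ≤ ‖g s‖)
    (hlim : ∀ s, Filter.Tendsto (fun n => G n s) Filter.atTop (nhds (g s))) (z : β) :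
    Filter.Tendsto (fun n => kernelOp K μ (G n) z) Filter.atTop (nhds (kernelOp K μ g z)) := by
  refine tendsto_integral_of_dominated_convergence (fun s => ‖g s‖) (fun n => ?_) hg.norm
    (fun n => Filter.Eventually.of_forall fun s => ?_)
    (Filter.Eventually.of_forall fun s => (hlim s).const_mul _)
  · exact (hK.measurable.comp measurable_prodMk_left).aestronglyMeasurable.mul (hG n)
  · rw [norm_mul]
    exact (mul_le_of_le_one_left (norm_nonneg _) (hK.norm_le z s)).trans (hle n s)

/-- Fatou's lemma for bounded kernel operators. -/
lemma BoundedKernel.eLpNorm_kernelOp_le_of_tendsto [SFinite μ] (hK : BoundedKernel K) {g : α → ℂ}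
    {G : ℕ → α → ℂ} (hg : Integrable g μ) (hG : ∀ n, AEStronglyMeasurable (G n) μ)
    (hle : ∀ n s, ‖G n s‖ ≤ ‖g s‖)
    (hlim : ∀ s, Filter.Tendsto (fun n => G n s) Filter.atTop (nhds (g s))) {q B : ℝ≥0∞}
    (hB : ∀ n, eLpNorm (kernelOp K μ (G n)) q ν ≤ B) : eLpNorm (kernelOp K μ g) q ν ≤ B := by
  refine (Lp.eLpNorm_lim_le_liminf_eLpNorm
    (fun n => (hK.measurable_kernelOp (hG n)).aestronglyMeasurable) _
    (Filter.Eventually.of_forall fun z => hK.tendsto_kernelOp hg hG hle hlim z)).trans ?_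
  exact Filter.liminf_le_of_le (by isBoundedDefault) fun b hb => by
    obtain ⟨n, hn⟩ := hb.exists
    exact hn.trans (hB n)

/-- Restricted type `(1/x, 1/y)`: the operator is bounded on functions dominated by an indicator
function. -/
def HasRestrictedType (K : β → α → ℂ) (μ : Measure α) (ν : Measure β) (x y : ℝ) : Prop :=
  ∃ C : ℝ≥0, ∀ A : Set α, MeasurableSet A → μ A ≠ ∞ → ∀ g : α → ℂ, Measurable g →
    (∀ s, ‖g s‖ ≤ A.indicator 1 s) → eLpNorm (kernelOp K μ g) (recipExp y) ν ≤ C * μ A ^ x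

/-- Strong type `(1/x, 1/y)`, tested on integrable functions. -/
def HasStrongType (K : β → α → ℂ) (μ : Measure α) (ν : Measure β) (x y : ℝ) : Prop :=
  ∃ C : ℝ≥0, ∀ g : α → ℂ, Integrable g μ →
    eLpNorm (kernelOp K μ g) (recipExp y) ν ≤ C * eLpNorm g (recipExp x) μ

lemma eLpNorm_le_rpow_of_le_indicator {A : Set α} {g : α → ℂ}
    (hgA : ∀ s, ‖g s‖ ≤ A.indicator 1 s) {x : ℝ} (hx : 0 ≤ x) :
    eLpNorm g (recipExp x) μ ≤ μ A ^ x := by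
  have h1 : eLpNorm g (recipExp x) μ ≤ eLpNorm (A.indicator (fun _ => (1 : ℝ))) (recipExp x) μ :=
    eLpNorm_mono_real hgA
  refine h1.trans ((eLpNorm_indicator_const_le (1 : ℝ) (recipExp x)).trans ?_)
  rcases hx.eq_or_lt with rfl | hx
  · simp [recipExp_zero]
  · simp [recipExp_toReal hx]

lemma integrable_of_le_indicator {A : Set α} (hA : MeasurableSet A) (hA' : μ A ≠ ∞) {g : α → ℂ}
    (hg : Measurable g) (hgA : ∀ s, ‖g s‖ ≤ A.indicator 1 s) : Integrable g μ := by
  have h1 : Integrable (A.indicator (fun _ => (1 : ℝ))) μ :=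
    (integrable_indicator_iff hA).2 (integrableOn_const hA')
  refine h1.mono' hg.aestronglyMeasurable (Filter.Eventually.of_forall fun s => ?_)
  exact hgA s

lemma HasStrongType.restricted {x y : ℝ} (hx : 0 ≤ x) (h : HasStrongType K μ ν x y) :
    HasRestrictedType K μ ν x y := by
  obtain ⟨C, hC⟩ := h
  refine ⟨C, fun A hA hA' g hg hgA => (hC g (integrable_of_le_indicator hA hA' hg hgA)).trans ?_⟩
  gcongr
  exact eLpNorm_le_rpow_of_le_indicator hgA hx

lemma BoundedKernel.hasStrongType_one_zero (hK : BoundedKernel K) :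
    HasStrongType K μ ν 1 0 := by
  refine ⟨1, fun g hg => ?_⟩
  rw [recipExp_zero, recipExp_one, eLpNorm_exponent_top, eLpNorm_one_eq_lintegral_enorm,
    ENNReal.coe_one, one_mul]
  refine eLpNormEssSup_le_of_ae_enorm_bound (Filter.Eventually.of_forall fun z => ?_)
  refine (enorm_integral_le_lintegral_enorm _).trans (lintegral_mono fun s => ?_)
  rw [enorm_mul]
  have : ‖K z s‖ₑ ≤ 1 := by
    rw [← ofReal_norm]
    exact ENNReal.ofReal_le_one.2 (hK.norm_le z s)
  exact mul_le_of_le_one_left zero_le this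

end Interpolation

end

/-! ### Real interpolation between restricted types -/

section Interpolation

variable {α β : Type*} [MeasurableSpace α] [MeasurableSpace β] {μ : Measure α} {ν : Measure β}
variable {K : β → α → ℂ}

lemma HasRestrictedType.bound_of_le_const {x y : ℝ} {C : ℝ≥0}
    (h : ∀ A : Set α, MeasurableSet A → μ A ≠ ∞ → ∀ g : α → ℂ, Measurable g →
      (∀ s, ‖g s‖ ≤ A.indicator 1 s) → eLpNorm (kernelOp K μ g) (recipExp y) ν ≤ C * μ A ^ x)
    {A : Set α} (hA : MeasurableSet A) (hA' : μ A ≠ ∞) {g : α → ℂ} (hg : Measurable g)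
    {c : ℝ} (hc : 0 < c) (hgA : ∀ s, ‖g s‖ ≤ A.indicator (fun _ => c) s) :
    eLpNorm (kernelOp K μ g) (recipExp y) ν ≤ C * (ENNReal.ofReal c * μ A ^ x) := by
  have h1 := h A hA hA' (fun s => (c : ℂ)⁻¹ * g s) (hg.const_mul _) (fun s => by
    rw [norm_mul, norm_inv, Complex.norm_of_nonneg hc.le]
    have := hgA s
    by_cases hs : s ∈ A
    · simp only [Set.indicator_of_mem hs, Pi.one_apply] at this ⊢
      rw [inv_mul_le_one₀ hc]; exact this
    · simp only [Set.indicator_of_notMem hs] at this ⊢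
      have h0 : ‖g s‖ = 0 := le_antisymm this (norm_nonneg _)
      simp [h0])
  have h2 : kernelOp K μ g = (c : ℂ) • kernelOp K μ (fun s => (c : ℂ)⁻¹ * g s) := by
    rw [kernelOp_const_mul]
    funext z
    have : (c : ℂ) ≠ 0 := by exact_mod_cast hc.ne'
    simp [this]
  rw [h2, eLpNorm_const_smul]
  have h3 : ‖(c : ℂ)‖ₑ = ENNReal.ofReal c := by
    rw [← ofReal_norm, Complex.norm_of_nonneg hc.le]
  rw [h3]
  calc _ ≤ ENNReal.ofReal c * (C * μ A ^ x) := by gcongr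
    _ = _ := by ring

/-- The dyadic level sets of the modulus of a function. -/
def dyadicLevel (g : α → ℂ) (k : ℤ) : Set α := {s | ‖g s‖ₑ ∈ Set.Ico ((2 : ℝ≥0∞) ^ k) (2 ^ (k + 1))}

lemma measurableSet_dyadicLevel {g : α → ℂ} (hg : Measurable g) (k : ℤ) :
    MeasurableSet (dyadicLevel g k) := hg.enorm measurableSet_Ico

lemma eq_of_mem_dyadicLevel {g : α → ℂ} {s : α} {k l : ℤ} (hk : s ∈ dyadicLevel g k)
    (hl : s ∈ dyadicLevel g l) : k = l := by
  have h2 : (1 : ℝ≥0∞) < 2 := by norm_num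
  have key : ∀ {k l : ℤ}, s ∈ dyadicLevel g k → s ∈ dyadicLevel g l → k ≤ l := by
    intro k l hk hl
    by_contra hlt
    push Not at hlt
    have h3 : (2 : ℝ≥0∞) ^ (l + 1) ≤ 2 ^ k := ENNReal.zpow_le_of_le h2.le (by omega)
    exact absurd (hk.1.trans_lt hl.2) (not_lt.2 h3)
  exact le_antisymm (key hk hl) (key hl hk)

lemma exists_mem_dyadicLevel {g : α → ℂ} {s : α} (h : g s ≠ 0) : ∃ k, s ∈ dyadicLevel g k :=
  ENNReal.exists_mem_Ico_zpow (by simpa using h) enorm_ne_top (by norm_num) (by norm_num)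

lemma measure_dyadicLevel_ne_top {g : α → ℂ} (hg : Integrable g μ) (k : ℤ) :
    μ (dyadicLevel g k) ≠ ∞ := by
  have h2 : (2 : ℝ≥0∞) ^ k ≠ 0 := by rw [two_zpow_eq_rpow]; exact two_rpow_ne_zero _
  have h3 : μ {s | (2 : ℝ≥0∞) ^ k ≤ ‖g s‖ₑ} ≤ _ :=
    meas_ge_le_lintegral_div hg.1.enorm h2 (by rw [two_zpow_eq_rpow]; exact two_rpow_ne_top _)
  refine ne_top_of_le_ne_top ?_ ((measure_mono (fun s hs => hs.1)).trans h3)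
  exact ENNReal.div_ne_top hg.2.ne h2

/-- The constant of the interpolation theorem on functions with finitely many dyadic levels. -/
theorem interpolation_of_finite_levels [SFinite μ] (hK : BoundedKernel K) {x₀ x₁ y₀ y₁ x y γ : ℝ}
    (hx₀ : 0 ≤ x₀) (hx₀x : x₀ < x) (hxx₁ : x < x₁) (hx₁ : x₁ ≤ 1) (hy₀ : 0 ≤ y₀) (hy₁ : 0 ≤ y₁)
    (hy₀' : y₀ ≤ 1) (hy₁' : y₁ ≤ 1) (hγ : γ ≠ 0) (h₀ : x₀ - x = γ * (y₀ - y))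
    (h₁ : x₁ - x = γ * (y₁ - y)) (hy : 0 < y) (hyx : y ≤ x)
    (H₀ : HasRestrictedType K μ ν x₀ y₀) (H₁ : HasRestrictedType K μ ν x₁ y₁) :
    ∃ C : ℝ≥0, ∀ (g : α → ℂ) (J : Finset ℤ), Measurable g → Integrable g μ →
      (∀ s, g s ≠ 0 → ∃ k ∈ J, s ∈ dyadicLevel g k) →
      eLpNorm (kernelOp K μ g) (recipExp y) ν ≤ C * eLpNorm g (recipExp x) μ := by
  obtain ⟨C₀, HC₀⟩ := H₀
  obtain ⟨C₁, HC₁⟩ := H₁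
  have hx : 0 < x := hy.trans_le hyx
  -- The rate of geometric decay: the distance from x to the nearer endpoint.
  set a := min (x₁ - x) (x - x₀) with ha
  have ha0 : 0 < a := lt_min (by linarith) (by linarith)
  have hq1 : 1 ≤ y⁻¹ := (one_le_inv₀ hy).2 (by linarith)
  obtain ⟨Z, hZ⟩ := tsum_rpow_geometric_convolution_le ha0 hq1
  set C : ℝ≥0∞ := C₀ + C₁ with hC
  have hCtop : C ≠ ∞ := by simp [hC]
  have hfin : ((2 : ℝ≥0∞) * 2 ^ |γ| * ((8 * C) ^ y⁻¹ * Z)) ^ y * 2 ≠ ∞ := by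
    refine ENNReal.mul_ne_top (ENNReal.rpow_ne_top_of_nonneg hy.le ?_) (by norm_num)
    refine ENNReal.mul_ne_top (ENNReal.mul_ne_top (by norm_num) (two_rpow_ne_top _)) ?_
    refine ENNReal.mul_ne_top (ENNReal.rpow_ne_top_of_nonneg (by positivity) ?_) (by simp)
    exact ENNReal.mul_ne_top (by norm_num) hCtop
  refine ⟨(((2 : ℝ≥0∞) * 2 ^ |γ| * ((8 * C) ^ y⁻¹ * Z)) ^ y * 2).toNNReal,
    fun g J hg hgi hJ => ?_⟩
  rw [ENNReal.coe_toNNReal hfin]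
  classical
  set V : ℤ → ℝ≥0∞ := fun k => μ (dyadicLevel g k) with hV
  have hVtop : ∀ k, V k ≠ ∞ := fun k => measure_dyadicLevel_ne_top hgi k
  -- Null levels are dropped so that every remaining level set has a dyadic size 2^(m k).
  set L := J.filter fun k => V k ≠ 0 with hL
  have hm : ∀ k, ∃ m : ℤ, V k ≠ 0 → V k ∈ Set.Ico ((2 : ℝ≥0∞) ^ m) (2 ^ (m + 1)) := by
    intro k
    by_cases hk : V k = 0
    · exact ⟨0, fun h => absurd hk h⟩
    · obtain ⟨m, hm⟩ := ENNReal.exists_mem_Ico_zpow hk (hVtop k) (y := 2) (by norm_num) (by norm_num)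
      exact ⟨m, fun _ => hm⟩
  choose m hm using hm
  set gk : ℤ → α → ℂ := fun k => (dyadicLevel g k).indicator g with hgk
  have hgkm : ∀ k, Measurable (gk k) := fun k => hg.indicator (measurableSet_dyadicLevel hg k)
  have hgki : ∀ k, Integrable (gk k) μ := fun k => hgi.indicator (measurableSet_dyadicLevel hg k)
  have hdecomp : g =ᵐ[μ] fun s => ∑ k ∈ L, gk k s := by
    have hnull : ∀ᵐ s ∂μ, ∀ k, V k = 0 → s ∉ dyadicLevel g k := by
      rw [ae_all_iff]
      intro k
      by_cases hk : V k = 0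
      · filter_upwards [measure_eq_zero_iff_ae_notMem.1 hk] with s hs _ using hs
      · exact Filter.Eventually.of_forall fun s h => absurd h hk
    filter_upwards [hnull] with s hs
    by_cases hgs : g s = 0
    · rw [hgs, eq_comm]
      refine Finset.sum_eq_zero fun k _ => ?_
      simp only [hgk]
      by_cases hsk : s ∈ dyadicLevel g k
      · rw [Set.indicator_of_mem hsk, hgs]
      · rw [Set.indicator_of_notMem hsk]
    · obtain ⟨k, hkJ, hk⟩ := hJ s hgs
      have hVk : V k ≠ 0 := fun h => hs k h hk
      rw [Finset.sum_eq_single_of_mem k (Finset.mem_filter.2 ⟨hkJ, hVk⟩)]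
      · simp only [hgk]; rw [Set.indicator_of_mem hk]
      · intro l _ hlk
        simp only [hgk]
        rw [Set.indicator_of_notMem]
        exact fun hl => hlk (eq_of_mem_dyadicLevel hl hk)
  have hT : kernelOp K μ g = ∑ k ∈ L, kernelOp K μ (gk k) := by
    rw [kernelOp_congr hdecomp, hK.kernelOp_sum L fun k _ => hgki k]
  set M := L.image m with hM
  -- `c j` collects the levels whose sets have measure about 2^j, each weighted by its L^p size 2^k
  -- · 2^(jx). `d` is its convolution with the geometric kernel 2^(-a|·|).
  set c : ℤ → ℝ≥0∞ := fun j => 2 ^ ((j : ℝ) * x) * ∑ k ∈ L with m k = j, 2 ^ (k : ℝ) with hc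
  set d : ℤ → ℝ≥0∞ := fun n => ∑ j ∈ M, 2 ^ (-(a * |(n : ℝ) - j|)) * c j with hd
  have hd' : ∀ n : ℤ, d n = ∑ k ∈ L, 2 ^ (-(a * |(n : ℝ) - m k|)) * (2 ^ ((m k : ℝ) * x) * 2 ^ (k : ℝ)) := by
    intro n
    rw [← Finset.sum_fiberwise_of_maps_to (t := M) (fun k hk => Finset.mem_image_of_mem m hk)]
    simp only [hd, hc]
    refine Finset.sum_congr rfl fun j _ => ?_
    rw [Finset.mul_sum, Finset.mul_sum]
    refine Finset.sum_congr rfl fun k hk => ?_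
    rw [(Finset.mem_filter.1 hk).2]
  have hterm : ∀ k ∈ L, ∀ (xi yi : ℝ) (Ci : ℝ≥0), 0 ≤ xi → xi ≤ 1 →
      (∀ A : Set α, MeasurableSet A → μ A ≠ ∞ → ∀ g : α → ℂ, Measurable g →
        (∀ s, ‖g s‖ ≤ A.indicator 1 s) → eLpNorm (kernelOp K μ g) (recipExp yi) ν ≤ Ci * μ A ^ xi) →
      eLpNorm (kernelOp K μ (gk k)) (recipExp yi) ν ≤
        4 * Ci * (2 ^ (k : ℝ) * 2 ^ ((m k : ℝ) * xi)) := by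
    intro k hk xi yi Ci hxi hxi' HCi
    have hVk := (Finset.mem_filter.1 hk).2
    have h1 := HasRestrictedType.bound_of_le_const HCi (measurableSet_dyadicLevel hg k) (hVtop k)
      (hgkm k) (c := (2 : ℝ) ^ (k + 1)) (by positivity) (fun s => by
        simp only [hgk]
        by_cases hs : s ∈ dyadicLevel g k
        · rw [Set.indicator_of_mem hs, Set.indicator_of_mem hs]
          have h3 := hs.2.le
          rw [two_zpow_eq_ofReal, ← ofReal_norm] at h3
          exact (ENNReal.ofReal_le_ofReal_iff (by positivity)).1 h3
        · rw [Set.indicator_of_notMem hs, Set.indicator_of_notMem hs]; simp)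
    refine h1.trans ?_
    have h4 : ENNReal.ofReal ((2 : ℝ) ^ (k + 1)) = 2 * (2 : ℝ≥0∞) ^ (k : ℝ) := by
      rw [← two_zpow_eq_ofReal, two_zpow_eq_rpow]; push_cast
      rw [two_rpow_add, ENNReal.rpow_one, mul_comm]
    have h5 : μ (dyadicLevel g k) ^ xi ≤ 2 * (2 : ℝ≥0∞) ^ ((m k : ℝ) * xi) := by
      calc μ (dyadicLevel g k) ^ xi ≤ ((2 : ℝ≥0∞) ^ (m k + 1)) ^ xi :=
            ENNReal.rpow_le_rpow (hm k hVk).2.le hxi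
        _ = 2 ^ xi * 2 ^ ((m k : ℝ) * xi) := by
            rw [two_zpow_eq_rpow, ← ENNReal.rpow_mul, ← two_rpow_add]; push_cast; ring_nf
        _ ≤ _ := by
            gcongr
            calc (2 : ℝ≥0∞) ^ xi ≤ 2 ^ (1 : ℝ) :=
                  ENNReal.rpow_le_rpow_of_exponent_le (by norm_num) hxi'
              _ = 2 := ENNReal.rpow_one _
    rw [h4]
    calc _ ≤ Ci * (2 * 2 ^ (k : ℝ) * (2 * (2 : ℝ≥0∞) ^ ((m k : ℝ) * xi))) := by gcongr
      _ = _ := by ring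
  have hpart : ∀ (n : ℤ) (L' : Finset ℤ), L' ⊆ L → ∀ (xi yi : ℝ) (Ci : ℝ≥0), 0 ≤ xi → xi ≤ 1 →
      yi ≤ 1 → (Ci : ℝ≥0∞) ≤ C →
      (∀ A : Set α, MeasurableSet A → μ A ≠ ∞ → ∀ g : α → ℂ, Measurable g →
        (∀ s, ‖g s‖ ≤ A.indicator 1 s) → eLpNorm (kernelOp K μ g) (recipExp yi) ν ≤ Ci * μ A ^ xi) →
      (∀ k ∈ L', (m k : ℝ) * (xi - x) ≤ n * (xi - x) - a * |(n : ℝ) - m k|) →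
      eLpNorm (∑ k ∈ L', kernelOp K μ (gk k)) (recipExp yi) ν ≤
        4 * C * (2 ^ (n * (xi - x)) * d n) := by
    intro n L' hL' xi yi Ci hxi hxi' hyi hCi HCi hle
    calc eLpNorm (∑ k ∈ L', kernelOp K μ (gk k)) (recipExp yi) ν
        ≤ ∑ k ∈ L', eLpNorm (kernelOp K μ (gk k)) (recipExp yi) ν :=
          eLpNorm_sum_le (fun k _ => (hK.measurable_kernelOp (hgki k).1).aestronglyMeasurable)
            (one_le_recipExp hyi)
      _ ≤ ∑ k ∈ L', 4 * C * (2 ^ (n * (xi - x)) *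
            (2 ^ (-(a * |(n : ℝ) - m k|)) * (2 ^ ((m k : ℝ) * x) * 2 ^ (k : ℝ)))) := by
          refine Finset.sum_le_sum fun k hk => (hterm k (hL' hk) xi yi Ci hxi hxi' HCi).trans ?_
          have h6 : (2 : ℝ≥0∞) ^ ((m k : ℝ) * xi) ≤
              2 ^ (n * (xi - x)) * (2 ^ (-(a * |(n : ℝ) - m k|)) * 2 ^ ((m k : ℝ) * x)) := by
            rw [← two_rpow_add, ← two_rpow_add]
            refine ENNReal.rpow_le_rpow_of_exponent_le (by norm_num) ?_
            have := hle k hk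
            linarith
          calc 4 * (Ci : ℝ≥0∞) * (2 ^ (k : ℝ) * 2 ^ ((m k : ℝ) * xi)) ≤
              4 * C * (2 ^ (k : ℝ) * (2 ^ (n * (xi - x)) *
                (2 ^ (-(a * |(n : ℝ) - m k|)) * 2 ^ ((m k : ℝ) * x)))) := by gcongr
            _ = _ := by ring
      _ = 4 * C * (2 ^ (n * (xi - x)) * ∑ k ∈ L', (2 ^ (-(a * |(n : ℝ) - m k|)) *
            (2 ^ ((m k : ℝ) * x) * 2 ^ (k : ℝ)))) := by
          rw [← Finset.mul_sum, ← Finset.mul_sum]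
      _ ≤ _ := by
          rw [hd']
          gcongr
  -- Pieces on sets of measure at most about 2^n are estimated at the endpoint x₁, the others at x₀.
  -- Chebyshev with exceptional measure 2^(γn) gives the same threshold for both, because xᵢ - x = γ
  -- (yᵢ - y).
  have hsuper : ∀ n : ℤ, ν {z | 8 * C * (2 ^ (-(γ * n * y)) * d n) < ‖kernelOp K μ g z‖ₑ} ≤
      2 * 2 ^ (γ * n) := by
    intro n
    have hp1 := hpart n (L.filter fun k => m k ≤ n) (Finset.filter_subset _ _) x₁ y₁ C₁
      (by linarith) hx₁ hy₁' (by simp [hC]) HC₁ (fun k hk => by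
        have hk' : ((m k : ℤ) : ℝ) ≤ n := by exact_mod_cast (Finset.mem_filter.1 hk).2
        rw [abs_of_nonneg (by linarith)]
        have : a ≤ x₁ - x := min_le_left _ _
        nlinarith)
    have hp0 := hpart n (L.filter fun k => ¬ m k ≤ n) (Finset.filter_subset _ _) x₀ y₀ C₀
      hx₀ (by linarith) hy₀' (by simp [hC]) HC₀ (fun k hk => by
        have hk' : (n : ℝ) ≤ (m k : ℤ) := by
          have := (Finset.mem_filter.1 hk).2
          push Not at this
          exact_mod_cast this.le
        rw [abs_of_nonpos (by linarith)]
        have : a ≤ x - x₀ := min_le_right _ _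
        nlinarith)
    have hw0 := two_rpow_ne_zero (γ * n)
    have hw1 := two_rpow_ne_top (γ * n)
    have hmeas : ∀ L' : Finset ℤ, AEStronglyMeasurable (∑ k ∈ L', kernelOp K μ (gk k)) ν :=
      fun L' => Finset.aestronglyMeasurable_sum _
        fun k _ => (hK.measurable_kernelOp (hgki k).1).aestronglyMeasurable
    have hs1 := measure_superlevel_le (hmeas _) hy₁ hw0 hw1 hp1
    have hs0 := measure_superlevel_le (hmeas _) hy₀ hw0 hw1 hp0
    have hexp : ∀ xi yi : ℝ, xi - x = γ * (yi - y) →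
        4 * C * (2 ^ (n * (xi - x)) * d n) * (2 ^ (γ * n)) ^ (-yi) =
          4 * C * (2 ^ (-(γ * n * y)) * d n) := by
      intro xi yi hi
      rw [← ENNReal.rpow_mul]
      calc _ = 4 * C * ((2 ^ (n * (xi - x)) * 2 ^ (γ * n * -yi)) * d n) := by ring
        _ = _ := by
          rw [← two_rpow_add, hi]
          congr 4; ring
    rw [hexp x₁ y₁ h₁] at hs1
    rw [hexp x₀ y₀ h₀] at hs0
    have hsplit : kernelOp K μ g = (∑ k ∈ L with m k ≤ n, kernelOp K μ (gk k)) +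
        ∑ k ∈ L with ¬ m k ≤ n, kernelOp K μ (gk k) := by
      rw [hT, Finset.sum_filter_add_sum_filter_not]
    rw [two_mul]
    refine le_trans ?_ (add_le_add hs1 hs0)
    refine le_trans (measure_mono ?_) (measure_union_le _ _)
    intro z hz
    by_contra hcon
    simp only [Set.mem_union, Set.mem_ofPred_eq, not_or, not_lt] at hcon hz
    refine absurd hz (not_lt.2 ?_)
    rw [hsplit, Pi.add_apply]
    refine (enorm_add_le _ _).trans ((add_le_add hcon.1 hcon.2).trans (le_of_eq ?_))
    ring
  have hmain := lintegral_rpow_le_of_superlevel' (hK.measurable_kernelOp hgi.1).enorm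
    (by positivity : 0 < y⁻¹) hγ _ hsuper
  have hsum : ∑' n : ℤ, (8 * C * (2 ^ (-(γ * n * y)) * d n)) ^ y⁻¹ * 2 ^ (γ * n) ≤
      (8 * C) ^ y⁻¹ * Z * ∑ j ∈ M, c j ^ y⁻¹ := by
    have h7 : ∀ n : ℤ, (8 * C * (2 ^ (-(γ * n * y)) * d n)) ^ y⁻¹ * 2 ^ (γ * n) =
        (8 * C) ^ y⁻¹ * d n ^ y⁻¹ := by
      intro n
      have hy' : 0 ≤ y⁻¹ := by positivity
      rw [ENNReal.mul_rpow_of_nonneg (8 * C) _ hy', ENNReal.mul_rpow_of_nonneg _ (d n) hy',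
        ← ENNReal.rpow_mul, show -(γ * n * y) * y⁻¹ = -(γ * n) by field_simp]
      calc _ = (8 * C) ^ y⁻¹ * d n ^ y⁻¹ * ((2 : ℝ≥0∞) ^ (-(γ * n)) * 2 ^ (γ * n)) := by ring
        _ = _ := by rw [two_rpow_neg_mul, mul_one]
    simp_rw [h7]
    rw [ENNReal.tsum_mul_left, mul_assoc]
    gcongr
    exact hZ M c
  -- This inclusion of ℓ^p in ℓ^q is the place where p ≤ q, that is y ≤ x, is needed.
  have hcq : ∑ j ∈ M, c j ^ y⁻¹ ≤ (∑ j ∈ M, c j ^ x⁻¹) ^ (x / y) := by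
    have h8 := sum_rpow_le_rpow_sum M (fun j => c j ^ x⁻¹) ((one_le_div hy).2 hyx)
    refine le_trans (le_of_eq ?_) h8
    refine Finset.sum_congr rfl fun j _ => ?_
    rw [← ENNReal.rpow_mul]
    congr 1; field_simp
  have hcp : ∑ j ∈ M, c j ^ x⁻¹ ≤ 2 ^ x⁻¹ * ∫⁻ s, ‖g s‖ₑ ^ x⁻¹ ∂μ := by
    have hx' : 0 < x⁻¹ := by positivity
    calc ∑ j ∈ M, c j ^ x⁻¹
        ≤ ∑ j ∈ M, 2 ^ x⁻¹ * ∑ k ∈ L with m k = j, 2 ^ (j : ℝ) * 2 ^ ((k : ℝ) * x⁻¹) := by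
          refine Finset.sum_le_sum fun j _ => ?_
          simp only [hc]
          rw [ENNReal.mul_rpow_of_nonneg _ _ hx'.le, ← ENNReal.rpow_mul,
            show (j : ℝ) * x * x⁻¹ = j by field_simp, ← Finset.mul_sum]
          calc _ ≤ (2 : ℝ≥0∞) ^ (j : ℝ) * (2 ^ x⁻¹ * ∑ k ∈ L with m k = j, 2 ^ ((k : ℝ) * x⁻¹)) := by
                gcongr
                exact rpow_sum_two_zpow_le _ hx'
            _ = _ := by ring
      _ = 2 ^ x⁻¹ * ∑ k ∈ L, 2 ^ (m k : ℝ) * 2 ^ ((k : ℝ) * x⁻¹) := by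
          rw [← Finset.mul_sum]
          congr 1
          rw [← Finset.sum_fiberwise_of_maps_to (t := M) (fun k hk => Finset.mem_image_of_mem m hk)]
          refine Finset.sum_congr rfl fun j _ => Finset.sum_congr rfl fun k hk => ?_
          rw [(Finset.mem_filter.1 hk).2]
      _ ≤ 2 ^ x⁻¹ * ∑ k ∈ L, ∫⁻ s in dyadicLevel g k, ‖g s‖ₑ ^ x⁻¹ ∂μ := by
          gcongr with k hk
          have hVk := (hm k (Finset.mem_filter.1 hk).2).1
          rw [two_zpow_eq_rpow] at hVk
          calc (2 : ℝ≥0∞) ^ (m k : ℝ) * 2 ^ ((k : ℝ) * x⁻¹)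
              ≤ 2 ^ ((k : ℝ) * x⁻¹) * μ (dyadicLevel g k) := by rw [mul_comm]; gcongr
            _ = ∫⁻ s in dyadicLevel g k, 2 ^ ((k : ℝ) * x⁻¹) ∂μ := (setLIntegral_const _ _).symm
            _ ≤ _ := by
              refine setLIntegral_mono (hg.enorm.pow_const _) fun s hs => ?_
              rw [ENNReal.rpow_mul]
              refine ENNReal.rpow_le_rpow ?_ hx'.le
              rw [← two_zpow_eq_rpow]; exact hs.1
      _ = 2 ^ x⁻¹ * ∫⁻ s in ⋃ k ∈ L, dyadicLevel g k, ‖g s‖ₑ ^ x⁻¹ ∂μ := by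
          rw [lintegral_biUnion_finset]
          · intro k _ l _ hkl
            exact Set.disjoint_left.2 fun s hk hl => hkl (eq_of_mem_dyadicLevel hk hl)
          · exact fun k _ => measurableSet_dyadicLevel hg k
      _ ≤ _ := by
          gcongr
          exact Measure.restrict_le_self
  rw [eLpNorm_recipExp hy, eLpNorm_recipExp hx]
  calc (∫⁻ z, ‖kernelOp K μ g z‖ₑ ^ y⁻¹ ∂ν) ^ y
      ≤ (2 * 2 ^ |γ| * ((8 * C) ^ y⁻¹ * Z * (2 ^ x⁻¹ * ∫⁻ s, ‖g s‖ₑ ^ x⁻¹ ∂μ) ^ (x / y))) ^ y := by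
        gcongr
        refine hmain.trans ?_
        gcongr
        refine hsum.trans ?_
        gcongr
        exact hcq.trans (ENNReal.rpow_le_rpow hcp (by positivity))
    _ = _ := by
        generalize ∫⁻ s, ‖g s‖ₑ ^ x⁻¹ ∂μ = I
        rw [← mul_assoc (2 * 2 ^ |γ|), ENNReal.mul_rpow_of_nonneg _ ((2 ^ x⁻¹ * I) ^ (x / y)) hy.le,
          ← ENNReal.rpow_mul _ (x / y) y, div_mul_cancel₀ _ hy.ne',
          ENNReal.mul_rpow_of_nonneg _ I hx.le, ← ENNReal.rpow_mul 2,
          inv_mul_cancel₀ hx.ne', ENNReal.rpow_one, ← mul_assoc]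

/-- Real interpolation between restricted types. -/
theorem HasRestrictedType.interpolate [SFinite μ] (hK : BoundedKernel K) {x₀ x₁ y₀ y₁ θ : ℝ}
    (hx₀ : 0 ≤ x₀) (hx : x₀ < x₁) (hx₁ : x₁ ≤ 1) (hy₀ : 0 ≤ y₀) (hy₁ : 0 ≤ y₁)
    (hy₀' : y₀ ≤ 1) (hy₁' : y₁ ≤ 1) (hy : y₀ ≠ y₁) (hθ : 0 < θ) (hθ' : θ < 1)
    (hyx : (1 - θ) * y₀ + θ * y₁ ≤ (1 - θ) * x₀ + θ * x₁)
    (H₀ : HasRestrictedType K μ ν x₀ y₀) (H₁ : HasRestrictedType K μ ν x₁ y₁) :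
    HasStrongType K μ ν ((1 - θ) * x₀ + θ * x₁) ((1 - θ) * y₀ + θ * y₁) := by
  set x := (1 - θ) * x₀ + θ * x₁ with hxdef
  set y := (1 - θ) * y₀ + θ * y₁ with hydef
  have hypos : 0 < y := by
    rcases hy₀.eq_or_lt with h | h
    · have : 0 < y₁ := lt_of_le_of_ne hy₁ (by rw [h]; exact hy)
      rw [hydef, ← h]; nlinarith [mul_pos hθ this]
    · have := mul_pos (sub_pos.2 hθ') h
      have := mul_nonneg hθ.le hy₁
      linarith
  have hne : y₁ - y₀ ≠ 0 := sub_ne_zero.2 hy.symm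
  obtain ⟨C, hC⟩ := interpolation_of_finite_levels hK (x := x) (y := y)
    (γ := (x₁ - x₀) / (y₁ - y₀)) hx₀ (by rw [hxdef]; nlinarith) (by rw [hxdef]; nlinarith) hx₁ hy₀
    hy₁ hy₀' hy₁' (div_ne_zero (sub_pos.2 hx).ne' hne)
    (by rw [hxdef, hydef]; field_simp; ring) (by rw [hxdef, hydef]; field_simp; ring)
    hypos hyx H₀ H₁
  refine ⟨C, fun g hgi => ?_⟩
  rw [kernelOp_congr hgi.1.ae_eq_mk, eLpNorm_congr_ae hgi.1.ae_eq_mk]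
  have hgm : Measurable (hgi.1.mk g) := hgi.1.measurable_mk
  have hgi' : Integrable (hgi.1.mk g) μ := hgi.congr hgi.1.ae_eq_mk
  set h := hgi.1.mk g
  -- Restriction to finitely many dyadic levels; Fatou's lemma removes it because the constant does
  -- not depend on the number of levels.
  set U : ℕ → Set α := fun n => ⋃ k ∈ Finset.Ico (-(n : ℤ)) n, dyadicLevel h k with hU
  have hUm : ∀ n, MeasurableSet (U n) := fun n =>
    Finset.measurableSet_biUnion _ fun k _ => measurableSet_dyadicLevel hgm k
  refine hK.eLpNorm_kernelOp_le_of_tendsto (G := fun n => (U n).indicator h) hgi'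
    (fun n => (hgm.indicator (hUm n)).aestronglyMeasurable)
    (fun n s => norm_indicator_le_norm_self _ _) (fun s => ?_) (fun n => ?_)
  · by_cases hs : h s = 0
    · have : ∀ n, (U n).indicator h s = h s := fun n => by
        by_cases hsn : s ∈ U n
        · rw [Set.indicator_of_mem hsn]
        · rw [Set.indicator_of_notMem hsn, hs]
      simp only [this]
      exact tendsto_const_nhds
    · obtain ⟨k, hk⟩ := exists_mem_dyadicLevel hs
      refine tendsto_const_nhds.congr' ?_
      filter_upwards [Filter.eventually_gt_atTop k.natAbs] with n hn
      rw [Set.indicator_of_mem]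
      simp only [hU, Set.mem_iUnion]
      exact ⟨k, Finset.mem_Ico.2 ⟨by omega, by omega⟩, hk⟩
  · refine (hC _ (Finset.Ico (-(n : ℤ)) n) (hgm.indicator (hUm n)) (hgi'.indicator (hUm n))
      fun s hs => ?_).trans ?_
    · have hsU : s ∈ U n := by
        by_contra hcon
        exact hs (Set.indicator_of_notMem hcon _)
      have hsU' := hsU
      simp only [hU, Set.mem_iUnion] at hsU
      obtain ⟨k, hkn, hk⟩ := hsU
      refine ⟨k, hkn, ?_⟩
      simp only [dyadicLevel, Set.mem_ofPred_eq] at hk ⊢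
      rw [Set.indicator_of_mem hsU']
      exact hk
    · gcongr
      exact eLpNorm_indicator_le _

end Interpolation

/-! ### Plancherel and Hausdorff–Young -/

noncomputable section

section FourierKernel

variable {E : Type*} [NormedAddCommGroup E] [InnerProductSpace ℝ E] [FiniteDimensional ℝ E]
  [MeasurableSpace E] [BorelSpace E]

open scoped ContDiff in
/-- The Fourier integral of a function in `L¹ ∩ L²` agrees with its `L²` Fourier transform. -/
lemma fourier_ae_eq_toLp {f : E → ℂ} (hf : Integrable f) (hf2 : MemLp f 2) :
    (𝓕 f : E → ℂ) =ᵐ[volume] (𝓕 (hf2.toLp f) : Lp ℂ 2 (volume : Measure E)) := by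
  have hcont : Continuous (𝓕 f : E → ℂ) := VectorFourier.fourierIntegral_continuous
    Real.continuous_fourierChar (by exact continuous_inner) hf
  refine ae_eq_of_integral_contDiff_smul_eq hcont.locallyIntegrable
    ((Lp.memLp _).locallyIntegrable (by norm_num)) fun g hg hgc => ?_
  have hg₁ : HasCompactSupport (Complex.ofRealCLM ∘ g) := hgc.comp_left rfl
  have hg₂ : ContDiff ℝ ∞ (Complex.ofRealCLM ∘ g) := by fun_prop
  -- Both transforms are tested against the same Schwartz function: the L² one through its tempered
  -- distribution, the integral one through Fubini. In either case the Fourier transform moves to φ.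
  set φ := hg₁.toSchwartzMap hg₂ with hφ
  have hφi : Integrable (φ : E → ℂ) := φ.integrable
  have h1 : ∫ x, g x • (𝓕 (hf2.toLp f) : Lp ℂ 2 (volume : Measure E)) x =
      ∫ x, (𝓕 φ) x • f x := by
    have h := congrArg (fun T => T φ) (Lp.fourier_toTemperedDistribution_eq (hf2.toLp f))
    simp only [TemperedDistribution.fourier_apply, Lp.toTemperedDistribution_apply] at h
    rw [integral_congr_ae (g := fun x => (𝓕 φ) x • f x)] at h
    · rw [h]
      refine integral_congr_ae (Filter.Eventually.of_forall fun x => ?_)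
      simp [hφ]
    · filter_upwards [hf2.coeFn_toLp] with x hx
      rw [hx]
  have h2 : ∫ x, g x • (𝓕 f : E → ℂ) x = ∫ x, (𝓕 φ) x • f x := by
    have h := VectorFourier.integral_fourierIntegral_smul_eq_flip (L := innerₗ E)
      (μ := (volume : Measure E)) (ν := (volume : Measure E)) (f := (φ : E → ℂ)) (g := f)
      Real.continuous_fourierChar (by exact continuous_inner) hφi hf
    have h3 : (innerₗ E).flip = innerₗ E := by
      ext v w; simp
    rw [h3] at h
    rw [SchwartzMap.fourier_coe]
    refine Eq.trans ?_ h.symm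
    refine integral_congr_ae (Filter.Eventually.of_forall fun x => ?_)
    simp [hφ]
    left; rfl
  rw [h1, h2]

lemma eLpNorm_fourier_two {f : E → ℂ} (hf : Integrable f) (hf2 : MemLp f 2) :
    eLpNorm (𝓕 f : E → ℂ) 2 volume = eLpNorm f 2 volume := by
  rw [eLpNorm_congr_ae (fourier_ae_eq_toLp hf hf2)]
  have h := Lp.norm_fourier_eq (hf2.toLp f)
  rw [Lp.norm_def, Lp.norm_toLp] at h
  exact (ENNReal.toReal_eq_toReal_iff' (Lp.eLpNorm_ne_top _) hf2.2.ne).1 h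

/-- The kernel of the inverse Fourier transform. -/
def fourierKernel (x w : E) : ℂ := Complex.exp (2 * Real.pi * Complex.I * (inner ℝ w x : ℝ))

lemma norm_exp_two_pi_I_mul (t : ℝ) : ‖Complex.exp (2 * Real.pi * Complex.I * t)‖ = 1 := by
  rw [show (2 * Real.pi * Complex.I * t : ℂ) = ((2 * Real.pi * t : ℝ) : ℂ) * Complex.I by
    push_cast; ring]
  exact Complex.norm_exp_ofReal_mul_I _

lemma boundedKernel_fourierKernel : BoundedKernel (fourierKernel (E := E)) where
  measurable := by
    have : Continuous (Function.uncurry (fourierKernel (E := E))) := by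
      unfold fourierKernel Function.uncurry
      fun_prop
    exact this.measurable
  norm_le z s := (norm_exp_two_pi_I_mul _).le

lemma kernelOp_fourierKernel (f : E → ℂ) (x : E) :
    kernelOp fourierKernel volume f x = (𝓕 f : E → ℂ) (-x) := by
  rw [Real.fourier_eq', kernelOp]
  refine integral_congr_ae (Filter.Eventually.of_forall fun w => ?_)
  simp only [fourierKernel, smul_eq_mul, inner_neg_right]
  congr 2
  push_cast
  ring

lemma hasStrongType_fourierKernel_half :
    HasStrongType (fourierKernel (E := E)) volume volume (1 / 2) (1 / 2) := by
  refine ⟨1, fun f hf => ?_⟩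
  rw [recipExp_half, ENNReal.coe_one, one_mul]
  by_cases hf2 : MemLp f 2
  · have h1 : kernelOp fourierKernel volume f = (𝓕 f : E → ℂ) ∘ Neg.neg := by
      funext x; exact kernelOp_fourierKernel f x
    rw [h1]
    have hcont : Continuous (𝓕 f : E → ℂ) := VectorFourier.fourierIntegral_continuous
      Real.continuous_fourierChar (by exact continuous_inner) hf
    rw [eLpNorm_comp_measurePreserving hcont.aestronglyMeasurable
      (Measure.measurePreserving_neg (volume : Measure E)), eLpNorm_fourier_two hf hf2]
  · have : eLpNorm f 2 volume = ∞ := by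
      by_contra h
      exact hf2 ⟨hf.1, lt_top_iff_ne_top.2 h⟩
    rw [this]; exact le_top

end FourierKernel

/-- The Hausdorff–Young inequality for bounded kernels which are bounded on `L²`. -/
lemma BoundedKernel.hausdorffYoung {α β : Type*} [MeasurableSpace α] [MeasurableSpace β]
    {μ : Measure α} {ν : Measure β} [SFinite μ] {K : β → α → ℂ} (hK : BoundedKernel K)
    (h : HasStrongType K μ ν (1 / 2) (1 / 2)) {x : ℝ} (hx : 1 / 2 ≤ x) (hx' : x ≤ 1) :
    HasStrongType K μ ν x (1 - x) := by
  rcases hx.eq_or_lt with rfl | hx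
  · norm_num at h ⊢; exact h
  rcases hx'.eq_or_lt with rfl | hx'
  · simpa using hK.hasStrongType_one_zero
  have := HasRestrictedType.interpolate hK (x₀ := 1 / 2) (x₁ := 1) (y₀ := 1 / 2) (y₁ := 0)
    (θ := 2 * x - 1) (by norm_num) (by norm_num) (by norm_num) (by norm_num) (by norm_num)
    (by norm_num) (by norm_num) (by norm_num) (by linarith) (by linarith) (by linarith)
    (h.restricted (by norm_num)) (hK.hasStrongType_one_zero.restricted (by norm_num))
  convert this using 1 <;> ring

end

/-! ### The extension operator of the parabola, its symmetries, and the passage from the plane to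
coordinates -/

noncomputable section

/-- The kernel of the extension operator of the parabola. -/
def parabolaKernel (z : ℝ × ℝ) (s : ℝ) : ℂ :=
  Complex.exp (2 * Real.pi * Complex.I * ((s * z.1 + s ^ 2 * z.2 : ℝ) : ℂ))

/-- The extension operator of the parabola, acting on functions of the horizontal variable. -/
def extOp (g : ℝ → ℂ) : ℝ × ℝ → ℂ := kernelOp parabolaKernel volume g

lemma norm_parabolaKernel (z : ℝ × ℝ) (s : ℝ) : ‖parabolaKernel z s‖ = 1 :=
  norm_exp_two_pi_I_mul _

lemma boundedKernel_parabolaKernel : BoundedKernel parabolaKernel where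
  measurable := by
    have : Continuous (Function.uncurry parabolaKernel) := by
      unfold parabolaKernel Function.uncurry
      fun_prop
    exact this.measurable
  norm_le z s := (norm_parabolaKernel z s).le

lemma contDiff_parabolaKernel (z : ℝ × ℝ) : ContDiff ℝ (⊤ : ℕ∞) (parabolaKernel z) := by
  unfold parabolaKernel
  refine ContDiff.cexp (contDiff_const.mul ?_)
  have h : ContDiff ℝ (⊤ : ℕ∞) fun s : ℝ => s * z.1 + s ^ 2 * z.2 := by fun_prop
  exact Complex.ofRealCLM.contDiff.comp h

lemma measurable_extOp {g : ℝ → ℂ} (hg : AEStronglyMeasurable g) : Measurable (extOp g) :=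
  boundedKernel_parabolaKernel.measurable_kernelOp hg

/-- Strong type of the extension operator, tested on smooth integrable functions. -/
def HasSmoothType (ν : Measure (ℝ × ℝ)) (x y : ℝ) : Prop :=
  ∃ C : ℝ≥0, ∀ g : ℝ → ℂ, ContDiff ℝ (⊤ : ℕ∞) g → Integrable g →
    eLpNorm (extOp g) (recipExp y) ν ≤ C * eLpNorm g (recipExp x)

lemma parabolaKernel_add (z w : ℝ × ℝ) (s : ℝ) :
    parabolaKernel (z + w) s = parabolaKernel z s * parabolaKernel w s := by
  rw [parabolaKernel, parabolaKernel, parabolaKernel, ← Complex.exp_add]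
  congr 1
  simp only [Prod.fst_add, Prod.snd_add]
  push_cast
  ring

/-- Translations on the physical side are modulations of g, which preserve all L^p norms. This is
the source of uniformity in t. -/
lemma extOp_modulate (g : ℝ → ℂ) (z w : ℝ × ℝ) :
    extOp (fun s => parabolaKernel w s * g s) z = extOp g (z + w) := by
  simp only [extOp, kernelOp, parabolaKernel_add, mul_assoc]

lemma eLpNorm_modulate (g : ℝ → ℂ) (w : ℝ × ℝ) (p : ℝ≥0∞) :
    eLpNorm (fun s => parabolaKernel w s * g s) p volume = eLpNorm g p volume := by
  refine eLpNorm_congr_norm_ae (Filter.Eventually.of_forall fun s => ?_)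
  rw [norm_mul, norm_parabolaKernel, one_mul]

lemma integrable_modulate {g : ℝ → ℂ} (hg : Integrable g) (w : ℝ × ℝ) :
    Integrable (fun s => parabolaKernel w s * g s) :=
  boundedKernel_parabolaKernel.integrable hg w

/-- Galilean invariance: (s + c)z₁ + (s + c)²z₂ = s(z₁ + 2cz₂) + s²z₂ plus a term independent of s,
which contributes only a unimodular factor. -/
lemma norm_extOp_shift (g : ℝ → ℂ) (c : ℝ) (z : ℝ × ℝ) :
    ‖extOp (fun s => g (s + c)) (z.1 + 2 * c * z.2, z.2)‖ = ‖extOp g z‖ := by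
  have h : extOp g z = parabolaKernel z c *
      extOp (fun s => g (s + c)) (z.1 + 2 * c * z.2, z.2) := by
    simp only [extOp, kernelOp]
    rw [← integral_add_right_eq_self _ c, ← integral_const_mul]
    congr 1
    funext s
    rw [← mul_assoc]
    congr 1
    simp only [parabolaKernel]
    rw [← Complex.exp_add]
    congr 1
    push_cast
    ring
  rw [h, norm_mul, norm_parabolaKernel, one_mul]

section Bridge

/-- The coordinates of a point of the plane. -/
def planeCoords (x : Plane) : ℝ × ℝ := (x 0, x 1)

lemma measurePreserving_planeCoords : MeasurePreserving planeCoords volume volume :=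
  (volume_preserving_finTwoArrow ℝ).comp (PiLp.volume_preserving_ofLp (Fin 2))

lemma continuous_parabolaPoint : Continuous parabolaPoint := by
  unfold parabolaPoint
  refine (PiLp.continuous_toLp 2 _).comp (continuous_pi fun i => ?_)
  fin_cases i
  · exact continuous_id
  · exact continuous_pow 2

lemma fourierExtension_parabola (f : 𝓢(Plane, ℂ)) (x : Plane) :
    fourierExtension parabolaMeasure f x = extOp (fun s => f (parabolaPoint s)) (planeCoords x) := by
  rw [fourierExtension, parabolaMeasure, integral_map continuous_parabolaPoint.aemeasurable]
  · simp only [extOp, kernelOp]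
    refine integral_congr_ae (Filter.Eventually.of_forall fun s => ?_)
    simp only [parabolaKernel, parabolaPoint, planeCoords, PiLp.inner_apply, Fin.sum_univ_two]
    rw [mul_comm]
    congr 3
    simp
    ring
  · refine Continuous.aestronglyMeasurable ?_
    have := f.continuous
    fun_prop

lemma eLpNorm_parabolaMeasure (f : 𝓢(Plane, ℂ)) (p : ℝ≥0∞) :
    eLpNorm f p parabolaMeasure = eLpNorm (fun s => f (parabolaPoint s)) p volume :=
  eLpNorm_map_measure f.continuous.aestronglyMeasurable continuous_parabolaPoint.aemeasurable

lemma integrable_comp_parabolaPoint (f : 𝓢(Plane, ℂ)) :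
    Integrable (fun s => f (parabolaPoint s)) := by
  obtain ⟨C, hC⟩ := f.decay 2 0
  obtain ⟨D, hD⟩ := f.decay 0 0
  refine (integrable_inv_one_add_sq.const_mul (C + D)).mono'
    (f.continuous.comp continuous_parabolaPoint).aestronglyMeasurable
    (Filter.Eventually.of_forall fun s => ?_)
  have h1 := hC.2 (parabolaPoint s)
  have h2 := hD.2 (parabolaPoint s)
  rw [norm_iteratedFDeriv_zero] at h1 h2
  have h3 : s ^ 2 ≤ ‖parabolaPoint s‖ ^ 2 := by
    rw [EuclideanSpace.norm_sq_eq, Fin.sum_univ_two]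
    simp [parabolaPoint]
    positivity
  rw [← div_eq_mul_inv, le_div_iff₀ (by positivity)]
  have h4 := norm_nonneg (f (parabolaPoint s))
  nlinarith

/-- The strip `|z · ω| ≤ 1/2` in coordinates. -/
def coordStrip (ω : Plane) : Set (ℝ × ℝ) := {z | |z.1 * ω 0 + z.2 * ω 1| ≤ 1 / 2}

lemma measurableSet_coordStrip (ω : Plane) : MeasurableSet (coordStrip ω) := by
  refine measurableSet_le ?_ measurable_const
  fun_prop

/-- Arc length on the line `z · ω = 0` in coordinates. -/
def coordLine (ω : Plane) : Measure (ℝ × ℝ) :=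
  (volume : Measure ℝ).map fun s : ℝ => (-(s * ω 1), s * ω 0)

lemma sq_add_sq_of_norm_eq_one {ω : Plane} (hω : ‖ω‖ = 1) : ω 0 * ω 0 + ω 1 * ω 1 = 1 := by
  have := EuclideanSpace.norm_sq_eq ω
  rw [hω, Fin.sum_univ_two] at this
  simp at this
  nlinarith

lemma eLpNorm_extOp_strip {g : ℝ → ℂ} (hg : Integrable g) {ω : Plane} (hω : ‖ω‖ = 1) (t : ℝ)
    (q : ℝ≥0∞) :
    eLpNorm (fun x => extOp g (planeCoords x)) q (volume.restrict (strip ω t)) =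
      eLpNorm (extOp fun s => parabolaKernel (t * ω 0, t * ω 1) s * g s) q
        (volume.restrict (coordStrip ω)) := by
  have hmp : MeasurePreserving (fun x => planeCoords x - (t * ω 0, t * ω 1)) volume volume :=
    (measurePreserving_sub_right volume _).comp measurePreserving_planeCoords
  have hpre : strip ω t = (fun x => planeCoords x - (t * ω 0, t * ω 1)) ⁻¹' coordStrip ω := by
    ext x
    have h1 := sq_add_sq_of_norm_eq_one hω
    simp only [strip, coordStrip, planeCoords, Set.mem_ofPred_eq, Set.mem_preimage, PiLp.inner_apply,
      Fin.sum_univ_two, Prod.fst_sub, Prod.snd_sub]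
    have : (x 0 - t * ω 0) * ω 0 + (x 1 - t * ω 1) * ω 1 =
        inner ℝ (x 0) (ω 0) + inner ℝ (x 1) (ω 1) - t := by
      simp
      linear_combination (-t) * h1
    rw [this]
  have hmp' := hmp.restrict_preimage (measurableSet_coordStrip ω)
  rw [hpre, ← eLpNorm_comp_measurePreserving
    (measurable_extOp (integrable_modulate hg _).1).aestronglyMeasurable hmp']
  congr 1
  funext x
  simp only [Function.comp, extOp_modulate]
  simp

lemma eLpNorm_extOp_line {g : ℝ → ℂ} (hg : Integrable g) (ω : Plane) (t : ℝ) (q : ℝ≥0∞) :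
    eLpNorm (fun x => extOp g (planeCoords x)) q (lineMeasure ω t) =
      eLpNorm (extOp fun s => parabolaKernel (t * ω 0, t * ω 1) s * g s) q (coordLine ω) := by
  have hm1 : Measurable fun s : ℝ => t • ω + s • (!₂[-ω 1, ω 0] : Plane) := by fun_prop
  change eLpNorm (extOp g ∘ planeCoords) q _ = _
  rw [lineMeasure, coordLine, eLpNorm_map_measure
    ((measurable_extOp hg.1).comp measurePreserving_planeCoords.measurable).aestronglyMeasurable
    hm1.aemeasurable, eLpNorm_map_measure
    (measurable_extOp (integrable_modulate hg _).1).aestronglyMeasurable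
    (by fun_prop)]
  congr 1
  funext s
  simp only [Function.comp, extOp_modulate, planeCoords]
  congr 1
  ext <;> simp <;> ring

lemma radonNorm_eq_eLpNorm (F : Plane → ℂ) {q : ℝ≥0∞} (hq : 1 ≤ q) (ω : Plane) (t : ℝ) :
    radonNorm F q ω t = eLpNorm F q (lineMeasure ω t) := by
  have hq0 : q ≠ 0 := (zero_lt_one.trans_le hq).ne'
  unfold radonNorm
  split_ifs with h
  · rw [h, eLpNorm_exponent_top]; rfl
  · rw [eLpNorm_eq_lintegral_rpow_enorm_toReal hq0 h]; rfl

lemma HasStrongType.stripEstimate {ω : Plane} (hω : ‖ω‖ = 1) {x y : ℝ}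
    (h : HasStrongType parabolaKernel volume (volume.restrict (coordStrip ω)) x y) :
    StripEstimate parabolaMeasure ω (recipExp x) (recipExp y) := by
  obtain ⟨C, hC⟩ := h
  refine ⟨C, fun f t => ?_⟩
  have hf := integrable_comp_parabolaPoint f
  rw [funext (fourierExtension_parabola f), eLpNorm_parabolaMeasure, eLpNorm_extOp_strip hf hω]
  refine (hC _ (integrable_modulate hf _)).trans ?_
  rw [eLpNorm_modulate]

lemma HasStrongType.radonEstimate {ω : Plane} {x y : ℝ} (hy : y ≤ 1)
    (h : HasStrongType parabolaKernel volume (coordLine ω) x y) :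
    RadonEstimate parabolaMeasure ω (recipExp x) (recipExp y) := by
  obtain ⟨C, hC⟩ := h
  refine ⟨C, fun f t => ?_⟩
  have hf := integrable_comp_parabolaPoint f
  rw [radonNorm_eq_eLpNorm _ (one_le_recipExp hy), funext (fourierExtension_parabola f),
    eLpNorm_parabolaMeasure, eLpNorm_extOp_line hf]
  refine (hC _ (integrable_modulate hf _)).trans ?_
  rw [eLpNorm_modulate]

/-- Estimates for the restrictions of Schwartz functions to the parabola extend to smooth
integrable functions. -/
lemma hasSmoothType_of_schwartz {ν : Measure (ℝ × ℝ)} {x y : ℝ} {C : ℝ≥0}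
    (h : ∀ f : 𝓢(Plane, ℂ), eLpNorm (extOp fun s => f (parabolaPoint s)) (recipExp y) ν ≤
      C * eLpNorm (fun s => f (parabolaPoint s)) (recipExp x)) : HasSmoothType ν x y := by
  refine ⟨C, fun g hg hgi => ?_⟩
  -- The function x ↦ g (x 0) extends g smoothly to the plane but need not be Schwartz. Bumps equal
  -- to 1 on growing balls make it compactly supported, and Fatou's lemma recovers g.
  let B : ℕ → ContDiffBump (0 : Plane) := fun n => ⟨n + 1, n + 2, by positivity, by linarith⟩
  have hcs : ∀ n, HasCompactSupport fun x : Plane => ((B n x : ℝ) : ℂ) * g (x 0) := fun n =>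
    HasCompactSupport.mul_right ((B n).hasCompactSupport.comp_left (g := fun r : ℝ => (r : ℂ)) rfl)
  have hcd : ∀ n, ContDiff ℝ (⊤ : ℕ∞) fun x : Plane => ((B n x : ℝ) : ℂ) * g (x 0) := fun n => by
    refine (Complex.ofRealCLM.contDiff.comp (B n).contDiff).mul (hg.comp ?_)
    exact (EuclideanSpace.proj (0 : Fin 2) : Plane →L[ℝ] ℝ).contDiff
  let G : ℕ → ℝ → ℂ := fun n s => ((B n (parabolaPoint s) : ℝ) : ℂ) * g s
  have hGle : ∀ n s, ‖G n s‖ ≤ ‖g s‖ := fun n s => by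
    simp only [G]
    rw [norm_mul, Complex.norm_of_nonneg (B n).nonneg]
    exact mul_le_of_le_one_left (norm_nonneg _) (B n).le_one
  have hGc : ∀ n, Continuous (G n) := fun n => by
    refine (Complex.continuous_ofReal.comp ((B n).continuous.comp continuous_parabolaPoint)).mul ?_
    exact hg.continuous
  have hGeq : ∀ n, G n = fun s => (hcs n).toSchwartzMap (hcd n) (parabolaPoint s) := fun n => by
    funext s
    simp [G, parabolaPoint]
  refine boundedKernel_parabolaKernel.eLpNorm_kernelOp_le_of_tendsto hgi
    (fun n => (hGc n).aestronglyMeasurable) hGle (fun s => ?_) (fun n => ?_)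
  · refine tendsto_const_nhds.congr' ?_
    filter_upwards [Filter.eventually_ge_atTop ⌈‖parabolaPoint s‖⌉₊] with n hn
    have hmem : parabolaPoint s ∈ Metric.closedBall (0 : Plane) (B n).rIn := by
      rw [mem_closedBall_zero_iff]
      have : (⌈‖parabolaPoint s‖⌉₊ : ℝ) ≤ n := by exact_mod_cast hn
      change _ ≤ (n : ℝ) + 1
      linarith [Nat.le_ceil ‖parabolaPoint s‖]
    simp [G, (B n).one_of_mem_closedBall hmem]
  · have := h ((hcs n).toSchwartzMap (hcd n))
    rw [← hGeq n] at this
    refine this.trans ?_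
    gcongr
    exact eLpNorm_mono (hGle n)

lemma hasSmoothType_of_stripEstimate {ω : Plane} (hω : ‖ω‖ = 1) {x y : ℝ}
    (h : StripEstimate parabolaMeasure ω (recipExp x) (recipExp y)) :
    HasSmoothType (volume.restrict (coordStrip ω)) x y := by
  obtain ⟨C, hC⟩ := h
  refine hasSmoothType_of_schwartz (C := C) fun f => ?_
  have hf := integrable_comp_parabolaPoint f
  have := hC f 0
  rw [funext (fourierExtension_parabola f), eLpNorm_parabolaMeasure, eLpNorm_extOp_strip hf hω]
    at this
  simpa [parabolaKernel] using this

lemma hasSmoothType_of_radonEstimate {ω : Plane} {x y : ℝ} (hy : y ≤ 1)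
    (h : RadonEstimate parabolaMeasure ω (recipExp x) (recipExp y)) :
    HasSmoothType (coordLine ω) x y := by
  obtain ⟨C, hC⟩ := h
  refine hasSmoothType_of_schwartz (C := C) fun f => ?_
  have hf := integrable_comp_parabolaPoint f
  have := hC f 0
  rw [radonNorm_eq_eLpNorm _ (one_le_recipExp hy), funext (fourierExtension_parabola f),
    eLpNorm_parabolaMeasure, eLpNorm_extOp_line hf] at this
  simpa [parabolaKernel] using this

end Bridge

end

/-! ### Reduction to the four model measures; from lines to strips -/

noncomputable section

/-- Lebesgue measure on the vertical strip `|z₁| ≤ R`. -/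
def vertStrip (R : ℝ) : Measure (ℝ × ℝ) := volume.restrict {z | |z.1| ≤ R}

/-- Lebesgue measure on the horizontal strip `|z₂| ≤ 1/2`. -/
def horStrip : Measure (ℝ × ℝ) := volume.restrict {z | |z.2| ≤ 1 / 2}

/-- Lebesgue measure on the vertical axis. -/
def vertLine : Measure (ℝ × ℝ) := (volume : Measure ℝ).map fun b => (0, b)

/-- Lebesgue measure on the horizontal axis. -/
def horLine : Measure (ℝ × ℝ) := (volume : Measure ℝ).map fun a => (a, 0)

lemma eLpNorm_comp_add_right {g : ℝ → ℂ} (hg : AEStronglyMeasurable g) (c : ℝ) (p : ℝ≥0∞) :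
    eLpNorm (fun s => g (s + c)) p volume = eLpNorm g p volume :=
  eLpNorm_comp_measurePreserving hg (measurePreserving_add_right volume c)

lemma measurePreserving_shear (c : ℝ) :
    MeasurePreserving (fun z : ℝ × ℝ => (z.1 + c * z.2, z.2)) volume volume := by
  have h1 : MeasurePreserving (fun z : ℝ × ℝ => (z.1, z.2 + c * z.1)) (volume.prod volume)
      (volume.prod volume) :=
    (MeasurePreserving.id (volume : Measure ℝ)).skew_product (g := fun a b => b + c * a)
      (by fun_prop) (Filter.Eventually.of_forall fun a => (measurePreserving_add_right volume (c * a)).map_eq)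
  exact (Measure.measurePreserving_swap.comp h1).comp Measure.measurePreserving_swap

/-- Since z₁ω₀ + z₂ω₁ = (z₁ + 2cz₂)ω₀ with c = ω₁/(2ω₀), the shear belonging to the translation by c
straightens the strip; its half-width becomes 1/(2|ω₀|). -/
lemma eLpNorm_extOp_coordStrip {ω : Plane} (hω : ω 0 ≠ 0) {g : ℝ → ℂ} (hg : Integrable g)
    (q : ℝ≥0∞) :
    eLpNorm (extOp g) q (volume.restrict (coordStrip ω)) =
      eLpNorm (extOp fun s => g (s + ω 1 / (2 * ω 0))) q (vertStrip (1 / (2 * |ω 0|))) := by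
  set c := ω 1 / (2 * ω 0) with hc
  have hpre : coordStrip ω = (fun z : ℝ × ℝ => (z.1 + 2 * c * z.2, z.2)) ⁻¹'
      {z | |z.1| ≤ 1 / (2 * |ω 0|)} := by
    ext z
    simp only [coordStrip, Set.mem_ofPred_eq, Set.mem_preimage]
    have h1 : z.1 * ω 0 + z.2 * ω 1 = (z.1 + 2 * c * z.2) * ω 0 := by
      rw [hc]; field_simp
    rw [h1, abs_mul, ← le_div_iff₀ (abs_pos.2 hω)]
    rw [div_div]
  have hmp := (measurePreserving_shear (2 * c)).restrict_preimage
    (s := {z : ℝ × ℝ | |z.1| ≤ 1 / (2 * |ω 0|)})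
    (measurableSet_le (by fun_prop) measurable_const)
  rw [hpre, vertStrip, ← eLpNorm_comp_measurePreserving
    (measurable_extOp (hg.comp_add_right c).1).aestronglyMeasurable hmp]
  exact eLpNorm_congr_norm_ae (Filter.Eventually.of_forall fun z => (norm_extOp_shift g c z).symm)

/-- The same shear sends (-sω₁, sω₀) to (0, sω₀); the factor is the ratio between arc length on the
original line and on the axis. -/
lemma eLpNorm_extOp_coordLine {ω : Plane} (hω : ω 0 ≠ 0) {g : ℝ → ℂ} (hg : Integrable g)
    (q : ℝ≥0∞) :
    eLpNorm (extOp g) q (coordLine ω) = ENNReal.ofReal |(ω 0)⁻¹| ^ (1 / q).toReal *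
      eLpNorm (extOp fun s => g (s + ω 1 / (2 * ω 0))) q vertLine := by
  set c := ω 1 / (2 * ω 0) with hc
  have h1 : (ENNReal.ofReal |(ω 0)⁻¹|) • vertLine =
      (volume : Measure ℝ).map fun s : ℝ => ((0 : ℝ), s * ω 0) := by
    rw [vertLine, ← Measure.map_smul, ← Real.map_volume_mul_right hω,
      Measure.map_map (by fun_prop) (by fun_prop)]
    rfl
  have h2 : ENNReal.ofReal |(ω 0)⁻¹| ≠ 0 := by simpa using hω
  rw [← smul_eq_mul, ← eLpNorm_smul_measure_of_ne_zero h2, h1, coordLine, eLpNorm_map_measure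
    (measurable_extOp hg.1).aestronglyMeasurable (by fun_prop), eLpNorm_map_measure
    (measurable_extOp (hg.comp_add_right c).1).aestronglyMeasurable (by fun_prop)]
  refine eLpNorm_congr_norm_ae (Filter.Eventually.of_forall fun s => ?_)
  simp only [Function.comp]
  rw [← norm_extOp_shift g c]
  congr 3
  rw [hc]; field_simp; ring

lemma HasStrongType.coordStrip {ω : Plane} (hω : ω 0 ≠ 0) {x y : ℝ}
    (h : HasStrongType parabolaKernel volume (vertStrip (1 / (2 * |ω 0|))) x y) :
    HasStrongType parabolaKernel volume (volume.restrict (coordStrip ω)) x y := by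
  obtain ⟨C, hC⟩ := h
  refine ⟨C, fun g hg => ?_⟩
  change eLpNorm (extOp g) _ _ ≤ _
  rw [eLpNorm_extOp_coordStrip hω hg]
  refine (hC _ (hg.comp_add_right _)).trans ?_
  rw [eLpNorm_comp_add_right hg.1]

lemma HasSmoothType.vertStrip {ω : Plane} (hω : ω 0 ≠ 0) {x y : ℝ}
    (h : HasSmoothType (volume.restrict (_root_.coordStrip ω)) x y) :
    HasSmoothType (vertStrip (1 / (2 * |ω 0|))) x y := by
  obtain ⟨C, hC⟩ := h
  refine ⟨C, fun g hg hgi => ?_⟩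
  have := hC (fun s => g (s + -(ω 1 / (2 * ω 0)))) (by fun_prop) (hgi.comp_add_right _)
  rw [eLpNorm_extOp_coordStrip hω (hgi.comp_add_right _), eLpNorm_comp_add_right hgi.1] at this
  simpa using this

lemma HasStrongType.coordLine {ω : Plane} (hω : ω 0 ≠ 0) {x y : ℝ}
    (h : HasStrongType parabolaKernel volume vertLine x y) :
    HasStrongType parabolaKernel volume (coordLine ω) x y := by
  obtain ⟨C, hC⟩ := h
  have hfin : ENNReal.ofReal |(ω 0)⁻¹| ^ (1 / recipExp y).toReal ≠ ∞ :=
    ENNReal.rpow_ne_top_of_nonneg ENNReal.toReal_nonneg (by simp)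
  refine ⟨(ENNReal.ofReal |(ω 0)⁻¹| ^ (1 / recipExp y).toReal).toNNReal * C, fun g hg => ?_⟩
  change eLpNorm (extOp g) _ _ ≤ _
  rw [eLpNorm_extOp_coordLine hω hg, ENNReal.coe_mul, ENNReal.coe_toNNReal hfin, mul_assoc]
  gcongr
  refine (hC _ (hg.comp_add_right _)).trans ?_
  rw [eLpNorm_comp_add_right hg.1]

lemma HasSmoothType.vertLine {ω : Plane} (hω : ω 0 ≠ 0) {x y : ℝ}
    (h : HasSmoothType (_root_.coordLine ω) x y) : HasSmoothType vertLine x y := by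
  obtain ⟨C, hC⟩ := h
  set D := ENNReal.ofReal |(ω 0)⁻¹| ^ (1 / recipExp y).toReal with hD
  have hfin : D ≠ ∞ := ENNReal.rpow_ne_top_of_nonneg ENNReal.toReal_nonneg (by simp)
  have h0 : D ≠ 0 := by
    rw [hD, Ne, ENNReal.rpow_eq_zero_iff]
    simp [hω]
  refine ⟨D.toNNReal⁻¹ * C, fun g hg hgi => ?_⟩
  have := hC (fun s => g (s + -(ω 1 / (2 * ω 0)))) (by fun_prop) (hgi.comp_add_right _)
  rw [eLpNorm_extOp_coordLine hω (hgi.comp_add_right _), eLpNorm_comp_add_right hgi.1, ← hD] at this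
  simp only [add_assoc, add_neg_cancel, add_zero] at this
  rw [ENNReal.coe_mul, ENNReal.coe_inv (by simp [ENNReal.toNNReal_eq_zero_iff, h0, hfin]),
    ENNReal.coe_toNNReal hfin, mul_assoc]
  calc eLpNorm (extOp g) (recipExp y) _root_.vertLine
      = D⁻¹ * (D * eLpNorm (extOp g) (recipExp y) _root_.vertLine) := by
        rw [← mul_assoc, ENNReal.inv_mul_cancel h0 hfin, one_mul]
    _ ≤ _ := by gcongr

lemma coordStrip_of_vertical {ω : Plane} (hω : ω = !₂[0, 1] ∨ ω = !₂[0, -1]) :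
    volume.restrict (coordStrip ω) = horStrip := by
  rcases hω with rfl | rfl <;> simp [coordStrip, horStrip]

lemma coordLine_of_vertical {ω : Plane} (hω : ω = !₂[0, 1] ∨ ω = !₂[0, -1]) :
    coordLine ω = horLine := by
  rcases hω with rfl | rfl
  · have h1 : (volume : Measure ℝ).map (fun s => -s) = volume := Measure.map_neg_eq_self _
    rw [horLine, ← h1, Measure.map_map (by fun_prop) (by fun_prop)]
    simp [coordLine, Function.comp_def]
  · simp [coordLine, horLine]

lemma eLpNorm_prod_le {α β : Type*} [MeasurableSpace α] [MeasurableSpace β] {μ : Measure α}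
    {ν : Measure β} [SFinite μ] [SFinite ν] {F : α × β → ℂ} (hF : Measurable F) {y : ℝ} (hy : 0 ≤ y)
    {B : ℝ≥0∞} (h : ∀ a, eLpNorm (fun b => F (a, b)) (recipExp y) ν ≤ B) :
    eLpNorm F (recipExp y) (μ.prod ν) ≤ μ Set.univ ^ y * B := by
  rcases hy.eq_or_lt with rfl | hy
  · simp only [eLpNorm_recipExp_zero, ENNReal.rpow_zero, one_mul] at h ⊢
    refine essSup_le_of_ae_le _ ?_
    have hm : MeasurableSet {z : α × β | ‖F z‖ₑ ≤ B} := measurableSet_le hF.enorm measurable_const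
    refine (Measure.ae_prod_iff_ae_ae hm).2 ?_
    refine Filter.Eventually.of_forall fun a => ?_
    filter_upwards [ae_le_essSup (f := fun b => ‖F (a, b)‖ₑ) (μ := ν)] with b hb
    exact hb.trans (h a)
  · simp only [eLpNorm_recipExp hy] at h ⊢
    rw [lintegral_prod _ (hF.enorm.pow_const _).aemeasurable]
    have h1 : ∀ a, ∫⁻ b, ‖F (a, b)‖ₑ ^ y⁻¹ ∂ν ≤ B ^ y⁻¹ := fun a => by
      rw [ENNReal.le_rpow_inv_iff hy]; exact h a
    calc _ ≤ (∫⁻ _, B ^ y⁻¹ ∂μ) ^ y := by gcongr with a; exact h1 a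
      _ = _ := by
        rw [lintegral_const, ENNReal.mul_rpow_of_nonneg _ _ hy.le, ENNReal.rpow_inv_rpow hy.ne',
          mul_comm]

lemma vertStrip_eq (R : ℝ) : vertStrip R = (volume.restrict (Set.Icc (-R) R)).prod volume := by
  have : {z : ℝ × ℝ | |z.1| ≤ R} = Set.Icc (-R) R ×ˢ Set.univ := by
    ext z; simp [abs_le]
  rw [vertStrip, this, Measure.volume_eq_prod, ← Measure.prod_restrict, Measure.restrict_univ]

lemma horStrip_eq :
    horStrip = (volume : Measure ℝ).prod (volume.restrict (Set.Icc (-(1 / 2)) (1 / 2))) := by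
  have : {z : ℝ × ℝ | |z.2| ≤ 1 / 2} = Set.univ ×ˢ Set.Icc (-(1 / 2) : ℝ) (1 / 2) := by
    ext z; simp [abs_le]
  rw [horStrip, this, Measure.volume_eq_prod, ← Measure.prod_restrict, Measure.restrict_univ]

/-- The strip is a bounded family of translates of the axis, and each translate amounts to a
modulation of g. A bound uniform in the translate therefore integrates over the finite
cross-section. -/
lemma eLpNorm_extOp_vertStrip_le {y : ℝ} (hy : 0 ≤ y) (R : ℝ) {g : ℝ → ℂ} (hg : Integrable g)
    {B : ℝ≥0∞}
    (h : ∀ a, eLpNorm (extOp fun s => parabolaKernel (a, 0) s * g s) (recipExp y) vertLine ≤ B) :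
    eLpNorm (extOp g) (recipExp y) (vertStrip R) ≤ ENNReal.ofReal (2 * R) ^ y * B := by
  rw [vertStrip_eq]
  refine (eLpNorm_prod_le (measurable_extOp hg.1) hy (B := B) fun a => ?_).trans (le_of_eq ?_)
  · have := h a
    rw [vertLine, eLpNorm_map_measure
      (measurable_extOp (integrable_modulate hg _).1).aestronglyMeasurable (by fun_prop)] at this
    refine le_trans (le_of_eq ?_) this
    congr 1
    funext b
    simp [extOp_modulate]
  · rw [Measure.restrict_apply_univ, Real.volume_Icc, sub_neg_eq_add, two_mul]

lemma eLpNorm_extOp_horStrip_le {y : ℝ} (hy : 0 ≤ y) {g : ℝ → ℂ} (hg : Integrable g)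
    {B : ℝ≥0∞}
    (h : ∀ b, eLpNorm (extOp fun s => parabolaKernel (0, b) s * g s) (recipExp y) horLine ≤ B) :
    eLpNorm (extOp g) (recipExp y) horStrip ≤ B := by
  have hsw := Measure.measurePreserving_swap (μ := volume.restrict (Set.Icc (-(1 / 2) : ℝ) (1 / 2)))
    (ν := (volume : Measure ℝ))
  rw [horStrip_eq, ← eLpNorm_comp_measurePreserving (measurable_extOp hg.1).aestronglyMeasurable hsw]
  refine (eLpNorm_prod_le ((measurable_extOp hg.1).comp measurable_swap) hy (B := B)
    fun b => ?_).trans (le_of_eq ?_)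
  · have := h b
    rw [horLine, eLpNorm_map_measure
      (measurable_extOp (integrable_modulate hg _).1).aestronglyMeasurable (by fun_prop)] at this
    refine le_trans (le_of_eq ?_) this
    congr 1
    funext b
    simp [extOp_modulate]
  · norm_num

lemma HasStrongType.vertStrip_of_vertLine {x y : ℝ} (hy : 0 ≤ y) (R : ℝ)
    (h : HasStrongType parabolaKernel volume vertLine x y) :
    HasStrongType parabolaKernel volume (vertStrip R) x y := by
  obtain ⟨C, hC⟩ := h
  have hfin : ENNReal.ofReal (2 * R) ^ y ≠ ∞ :=
    ENNReal.rpow_ne_top_of_nonneg hy ENNReal.ofReal_ne_top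
  refine ⟨(ENNReal.ofReal (2 * R) ^ y).toNNReal * C, fun g hg => ?_⟩
  rw [ENNReal.coe_mul, ENNReal.coe_toNNReal hfin, mul_assoc]
  refine eLpNorm_extOp_vertStrip_le hy R hg fun a => ?_
  exact (hC _ (integrable_modulate hg _)).trans (by rw [eLpNorm_modulate])

/-- Used in the necessity direction: obstructions for the strip become obstructions for the line. -/
lemma HasSmoothType.vertStrip_of_vertLine {x y : ℝ} (hy : 0 ≤ y) (R : ℝ)
    (h : HasSmoothType _root_.vertLine x y) : HasSmoothType (_root_.vertStrip R) x y := by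
  obtain ⟨C, hC⟩ := h
  have hfin : ENNReal.ofReal (2 * R) ^ y ≠ ∞ :=
    ENNReal.rpow_ne_top_of_nonneg hy ENNReal.ofReal_ne_top
  refine ⟨(ENNReal.ofReal (2 * R) ^ y).toNNReal * C, fun g hg hgi => ?_⟩
  rw [ENNReal.coe_mul, ENNReal.coe_toNNReal hfin, mul_assoc]
  refine eLpNorm_extOp_vertStrip_le hy R hgi fun a => ?_
  exact (hC _ ((contDiff_parabolaKernel _).mul hg) (integrable_modulate hgi _)).trans
    (by rw [eLpNorm_modulate])

lemma HasStrongType.horStrip_of_horLine {x y : ℝ} (hy : 0 ≤ y)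
    (h : HasStrongType parabolaKernel volume horLine x y) :
    HasStrongType parabolaKernel volume horStrip x y := by
  obtain ⟨C, hC⟩ := h
  refine ⟨C, fun g hg => eLpNorm_extOp_horStrip_le hy hg fun a => ?_⟩
  exact (hC _ (integrable_modulate hg _)).trans (by rw [eLpNorm_modulate])

lemma HasSmoothType.horStrip_of_horLine {x y : ℝ} (hy : 0 ≤ y) (h : HasSmoothType horLine x y) :
    HasSmoothType horStrip x y := by
  obtain ⟨C, hC⟩ := h
  refine ⟨C, fun g hg hgi => eLpNorm_extOp_horStrip_le hy hgi fun a => ?_⟩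
  exact (hC _ ((contDiff_parabolaKernel _).mul hg) (integrable_modulate hgi _)).trans
    (by rw [eLpNorm_modulate])

end

/-! ### The rearrangement estimate for |s - t|^(-β), and Plancherel on ℝ × ℝ -/

noncomputable section

lemma lintegral_Icc_rpow_neg {β : ℝ} (hβ : β < 1) {a : ℝ} (ha : 0 < a) :
    ∫⁻ s in Set.Icc (-a) a, ‖s‖ₑ ^ (-β) ≤ ENNReal.ofReal (2 / (1 - β)) * ENNReal.ofReal a ^ (1 - β) := by
  have hpos : ∫⁻ s in Set.Ioc 0 a, ‖s‖ₑ ^ (-β) ≤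
      ENNReal.ofReal (1 / (1 - β)) * ENNReal.ofReal a ^ (1 - β) := by
    have hIoc : IntervalIntegrable (fun s : ℝ => s ^ (-β)) volume 0 a :=
      intervalIntegral.intervalIntegrable_rpow' (by linarith)
    rw [intervalIntegrable_iff_integrableOn_Ioc_of_le ha.le] at hIoc
    calc ∫⁻ s in Set.Ioc 0 a, ‖s‖ₑ ^ (-β) = ∫⁻ s in Set.Ioc 0 a, ENNReal.ofReal (s ^ (-β)) := by
          refine setLIntegral_congr_fun measurableSet_Ioc fun s hs => ?_
          rw [← ENNReal.ofReal_rpow_of_pos hs.1, Real.enorm_eq_ofReal hs.1.le]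
      _ = ENNReal.ofReal (∫ s in Set.Ioc 0 a, s ^ (-β)) := by
          rw [ofReal_integral_eq_lintegral_ofReal hIoc]
          exact (ae_restrict_iff' measurableSet_Ioc).2
            (Filter.Eventually.of_forall fun s hs => Real.rpow_nonneg hs.1.le _)
      _ = ENNReal.ofReal (1 / (1 - β) * a ^ (1 - β)) := by
          rw [← intervalIntegral.integral_of_le ha.le, integral_rpow (Or.inl (by linarith))]
          rw [Real.zero_rpow (by linarith)]
          congr 1
          rw [show -β + 1 = 1 - β by ring]; ring
      _ ≤ _ := by
          rw [ENNReal.ofReal_mul (by rw [one_div_nonneg]; linarith), ENNReal.ofReal_rpow_of_pos ha]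
  have hneg : ∫⁻ s in Set.Ico (-a) 0, ‖s‖ₑ ^ (-β) ≤
      ENNReal.ofReal (1 / (1 - β)) * ENNReal.ofReal a ^ (1 - β) := by
    refine le_trans (le_of_eq ?_) hpos
    have hmp := (Measure.measurePreserving_neg (volume : Measure ℝ)).restrict_preimage
      (s := Set.Ioc 0 a) measurableSet_Ioc
    have hpre : Neg.neg ⁻¹' Set.Ioc 0 a = Set.Ico (-a) 0 := by
      ext s
      simp only [Set.mem_preimage, Set.mem_Ioc, Set.mem_Ico]
      constructor <;> rintro ⟨h1, h2⟩ <;> constructor <;> linarith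
    rw [hpre] at hmp
    rw [← hmp.lintegral_comp (by fun_prop)]
    simp
  have hsub : Set.Icc (-a) a ⊆ (Set.Ioc 0 a ∪ Set.Ico (-a) 0) ∪ {0} := by
    intro s hs
    rcases lt_trichotomy s 0 with h | h | h
    · exact Or.inl (Or.inr ⟨hs.1, h⟩)
    · exact Or.inr h
    · exact Or.inl (Or.inl ⟨h, hs.2⟩)
  calc ∫⁻ s in Set.Icc (-a) a, ‖s‖ₑ ^ (-β)
      ≤ ∫⁻ s in (Set.Ioc 0 a ∪ Set.Ico (-a) 0) ∪ {0}, ‖s‖ₑ ^ (-β) := lintegral_mono_set hsub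
    _ ≤ ((∫⁻ s in Set.Ioc 0 a, ‖s‖ₑ ^ (-β)) + ∫⁻ s in Set.Ico (-a) 0, ‖s‖ₑ ^ (-β)) +
        ∫⁻ s in ({0} : Set ℝ), ‖s‖ₑ ^ (-β) :=
      (lintegral_union_le _ _ _).trans (add_le_add_left (lintegral_union_le _ _ _) _)
    _ ≤ (ENNReal.ofReal (1 / (1 - β)) * ENNReal.ofReal a ^ (1 - β) +
        ENNReal.ofReal (1 / (1 - β)) * ENNReal.ofReal a ^ (1 - β)) + 0 := by
        gcongr
        rw [setLIntegral_measure_zero _ _ (by simp)]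
    _ = _ := by
        rw [add_zero, ← add_mul, ← ENNReal.ofReal_add (by rw [one_div_nonneg]; linarith)
          (by rw [one_div_nonneg]; linarith)]
        congr 2; ring

/-- Among sets of given measure, the integral of `|s - t|^{-β}` is controlled by that measure. -/
lemma lintegral_rpow_neg_dist_le {β : ℝ} (hβ0 : 0 ≤ β) (hβ : β < 1) :
    ∃ C : ℝ≥0, ∀ A : Set ℝ, MeasurableSet A → volume A ≠ ∞ → ∀ t : ℝ,
      ∫⁻ s in A, ‖s - t‖ₑ ^ (-β) ≤ C * volume A ^ (1 - β) := by
  refine ⟨(2 / (1 - β)).toNNReal + 1, fun A hA hA' t => ?_⟩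
  rcases eq_or_ne (volume A) 0 with h0 | h0
  · rw [setLIntegral_measure_zero _ _ h0]; exact zero_le
  -- With a = |A|, both the integral of the weight over the interval of radius a about t and
  -- a^(-β)|A|, which bounds the far part of A, are of size |A|^(1-β).
  set a := (volume A).toReal with ha
  have hapos : 0 < a := ENNReal.toReal_pos h0 hA'
  have haA : ENNReal.ofReal a = volume A := ENNReal.ofReal_toReal hA'
  have hnear : ∫⁻ s in Set.Icc (t - a) (t + a), ‖s - t‖ₑ ^ (-β) ≤
      ENNReal.ofReal (2 / (1 - β)) * ENNReal.ofReal a ^ (1 - β) := by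
    refine le_trans (le_of_eq ?_) (lintegral_Icc_rpow_neg hβ hapos)
    have hmp := (measurePreserving_sub_right (volume : Measure ℝ) t).restrict_preimage
      (s := Set.Icc (-a) a) measurableSet_Icc
    have hpre : (fun s : ℝ => s - t) ⁻¹' Set.Icc (-a) a = Set.Icc (t - a) (t + a) := by
      ext s
      simp only [Set.mem_preimage, Set.mem_Icc]
      constructor <;> rintro ⟨h1, h2⟩ <;> constructor <;> linarith
    rw [hpre] at hmp
    rw [← hmp.lintegral_comp (by fun_prop)]
  have hfar : ∫⁻ s in A \ Set.Icc (t - a) (t + a), ‖s - t‖ₑ ^ (-β) ≤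
      ENNReal.ofReal a ^ (-β) * volume A := by
    calc _ ≤ ∫⁻ s in A \ Set.Icc (t - a) (t + a), ENNReal.ofReal a ^ (-β) := by
          refine setLIntegral_mono measurable_const fun s hs => ?_
          have h1 : a ≤ |s - t| := by
            by_contra hlt
            push Not at hlt
            rw [abs_lt] at hlt
            exact hs.2 ⟨by linarith, by linarith⟩
          rw [ENNReal.rpow_neg, ENNReal.rpow_neg, ENNReal.inv_le_inv]
          refine ENNReal.rpow_le_rpow ?_ hβ0
          rw [Real.enorm_eq_ofReal_abs]
          exact ENNReal.ofReal_le_ofReal h1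
      _ ≤ _ := by
          rw [setLIntegral_const]
          gcongr
          exact Set.sdiff_subset
  have hsub : A ⊆ Set.Icc (t - a) (t + a) ∪ A \ Set.Icc (t - a) (t + a) := by
    intro s hs
    by_cases h : s ∈ Set.Icc (t - a) (t + a)
    · exact Or.inl h
    · exact Or.inr ⟨hs, h⟩
  calc ∫⁻ s in A, ‖s - t‖ₑ ^ (-β)
      ≤ _ := (lintegral_mono_set hsub).trans (lintegral_union_le _ _ _)
    _ ≤ ENNReal.ofReal (2 / (1 - β)) * ENNReal.ofReal a ^ (1 - β) +
        ENNReal.ofReal a ^ (-β) * volume A := add_le_add hnear hfar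
    _ = _ := by
        have h1 : ENNReal.ofReal a ^ (-β) * volume A = volume A ^ (1 - β) := by
          rw [haA]
          nth_rw 2 [← ENNReal.rpow_one (volume A)]
          rw [← ENNReal.rpow_add _ _ h0 hA']
          congr 1; ring
        rw [h1, haA, ENNReal.coe_add, add_mul, ENNReal.coe_one, one_mul]
        rfl

/-- The kernel of the inverse Fourier transform on `ℝ × ℝ`. -/
def pairKernel (z w : ℝ × ℝ) : ℂ :=
  Complex.exp (2 * Real.pi * Complex.I * ((w.1 * z.1 + w.2 * z.2 : ℝ) : ℂ))

lemma boundedKernel_pairKernel : BoundedKernel pairKernel where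
  measurable := by
    have : Continuous (Function.uncurry pairKernel) := by
      unfold pairKernel Function.uncurry
      fun_prop
    exact this.measurable
  norm_le z s := (norm_exp_two_pi_I_mul _).le

lemma hasStrongType_pairKernel_half : HasStrongType pairKernel volume volume (1 / 2) (1 / 2) := by
  obtain ⟨C, hC⟩ := hasStrongType_fourierKernel_half (E := Plane)
  refine ⟨C, fun f hf => ?_⟩
  have hmp := measurePreserving_planeCoords
  have h1 : kernelOp pairKernel volume f ∘ planeCoords =
      kernelOp fourierKernel volume (f ∘ planeCoords) := by
    funext x
    simp only [Function.comp, kernelOp]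
    rw [← hmp.map_eq, integral_map hmp.aemeasurable (by
      rw [hmp.map_eq]; exact (boundedKernel_pairKernel.integrable hf _).1)]
    refine integral_congr_ae (Filter.Eventually.of_forall fun w => ?_)
    simp only [pairKernel, fourierKernel, planeCoords, PiLp.inner_apply, Fin.sum_univ_two]
    congr 3
    simp
    ring
  rw [← eLpNorm_comp_measurePreserving
      (boundedKernel_pairKernel.measurable_kernelOp hf.1).aestronglyMeasurable hmp, h1,
    ← eLpNorm_comp_measurePreserving hf.1 hmp]
  exact hC _ (hmp.integrable_comp_of_integrable hf)

end

/-! ### The Fefferman–Zygmund theorem, by squaring the extension operator -/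

noncomputable section

/-- The sum of two points of the parabola. -/
def parabolaSum (z : ℝ × ℝ) : ℝ × ℝ := (z.1 + z.2, z.1 ^ 2 + z.2 ^ 2)

/-- The derivative of `parabolaSum`. -/
def fderivParabolaSum (z : ℝ × ℝ) : ℝ × ℝ →L[ℝ] ℝ × ℝ :=
  (Matrix.toLin (.finTwoProd ℝ) (.finTwoProd ℝ)
    !![1, 1; 2 * z.1, 2 * z.2]).toContinuousLinearMap

lemma hasFDerivAt_parabolaSum (z : ℝ × ℝ) :
    HasFDerivAt parabolaSum (fderivParabolaSum z) z := by
  unfold fderivParabolaSum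
  rw [Matrix.toLin_finTwoProd_toContinuousLinearMap]
  have h1 : HasFDerivAt (fun z : ℝ × ℝ => z.1) (ContinuousLinearMap.fst ℝ ℝ ℝ) z := hasFDerivAt_fst
  have h2 : HasFDerivAt (fun z : ℝ × ℝ => z.2) (ContinuousLinearMap.snd ℝ ℝ ℝ) z := hasFDerivAt_snd
  convert! HasFDerivAt.prodMk (𝕜 := ℝ) (h1.add h2) ((h1.pow 2).add (h2.pow 2)) using 2 <;> simp

lemma det_fderivParabolaSum (z : ℝ × ℝ) : (fderivParabolaSum z).det = 2 * (z.2 - z.1) := by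
  unfold fderivParabolaSum
  simp only [LinearMap.det_toContinuousLinearMap, LinearMap.det_toLin, Matrix.det_fin_two_of]
  ring

/-- The open half plane above the diagonal. -/
def aboveDiagonal : Set (ℝ × ℝ) := {z | z.1 < z.2}

lemma measurableSet_aboveDiagonal : MeasurableSet aboveDiagonal :=
  measurableSet_lt measurable_fst measurable_snd

/-- The inverse of `parabolaSum` above the diagonal. -/
def parabolaSplit (w : ℝ × ℝ) : ℝ × ℝ :=
  ((w.1 - √(2 * w.2 - w.1 ^ 2)) / 2, (w.1 + √(2 * w.2 - w.1 ^ 2)) / 2)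

lemma sqrt_parabolaSum {z : ℝ × ℝ} (hz : z ∈ aboveDiagonal) :
    √(2 * (parabolaSum z).2 - (parabolaSum z).1 ^ 2) = z.2 - z.1 := by
  have hz' : z.1 < z.2 := hz
  rw [show 2 * (parabolaSum z).2 - (parabolaSum z).1 ^ 2 = (z.2 - z.1) ^ 2 by
    simp only [parabolaSum]; ring]
  exact Real.sqrt_sq (by linarith)

lemma parabolaSplit_parabolaSum {z : ℝ × ℝ} (hz : z ∈ aboveDiagonal) :
    parabolaSplit (parabolaSum z) = z := by
  rw [parabolaSplit, sqrt_parabolaSum hz]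
  ext <;> simp only [parabolaSum] <;> ring

lemma injOn_parabolaSum : Set.InjOn parabolaSum aboveDiagonal := fun z hz w hw h => by
  rw [← parabolaSplit_parabolaSum hz, h, parabolaSplit_parabolaSum hw]

lemma mem_image_parabolaSum {w : ℝ × ℝ} (hw : 0 < 2 * w.2 - w.1 ^ 2) :
    w ∈ parabolaSum '' aboveDiagonal := by
  refine ⟨parabolaSplit w, ?_, ?_⟩
  · have := Real.sqrt_pos.2 hw
    change (w.1 - √(2 * w.2 - w.1 ^ 2)) / 2 < (w.1 + √(2 * w.2 - w.1 ^ 2)) / 2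
    linarith
  · have := Real.sq_sqrt hw.le
    ext
    · simp only [parabolaSum, parabolaSplit]; ring
    · simp only [parabolaSum, parabolaSplit]
      linear_combination (1 / 2) * this

/-- The density of the self-convolution of `g` on the parabola (one half of it, because only pairs
above the diagonal are counted). -/
def parabolaConvolution (g : ℝ → ℂ) (w : ℝ × ℝ) : ℂ :=
  g (parabolaSplit w).1 * g (parabolaSplit w).2 / ((2 * √(2 * w.2 - w.1 ^ 2) : ℝ) : ℂ)

lemma measurable_parabolaConvolution {g : ℝ → ℂ} (hg : Measurable g) :
    Measurable (parabolaConvolution g) := by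
  unfold parabolaConvolution parabolaSplit
  refine ((hg.comp ?_).mul (hg.comp ?_)).div (Complex.measurable_ofReal.comp ?_) <;> fun_prop

lemma parabolaConvolution_eq_zero (g : ℝ → ℂ) {w : ℝ × ℝ}
    (hw : w ∉ parabolaSum '' aboveDiagonal) : parabolaConvolution g w = 0 := by
  have h : 2 * w.2 - w.1 ^ 2 ≤ 0 := by
    by_contra hcon
    exact hw (mem_image_parabolaSum (not_le.1 hcon))
  simp [parabolaConvolution, Real.sqrt_eq_zero_of_nonpos h]

lemma parabolaConvolution_parabolaSum (g : ℝ → ℂ) {z : ℝ × ℝ} (hz : z ∈ aboveDiagonal) :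
    parabolaConvolution g (parabolaSum z) = g z.1 * g z.2 / ((2 * (z.2 - z.1) : ℝ) : ℂ) := by
  rw [parabolaConvolution, parabolaSplit_parabolaSum hz, sqrt_parabolaSum hz]

lemma measurableSet_image_parabolaSum : MeasurableSet (parabolaSum '' aboveDiagonal) := by
  have : parabolaSum '' aboveDiagonal = {w | 0 < 2 * w.2 - w.1 ^ 2} := by
    ext w
    refine ⟨?_, fun h => mem_image_parabolaSum h⟩
    rintro ⟨z, hz, rfl⟩
    have hz' : z.1 < z.2 := hz
    change 0 < 2 * (z.1 ^ 2 + z.2 ^ 2) - (z.1 + z.2) ^ 2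
    nlinarith [sq_pos_of_pos (sub_pos.2 hz')]
  rw [this]
  exact measurableSet_lt measurable_const (by fun_prop)

/-- At w = (s + t, s² + t²) the density is g(s)g(t)/(2(t - s)), and the change of variables has
Jacobian 2(t - s). The r-th power thus leaves (2(t - s))^(1-r), which is at most (t - s)^(1-r)
because r ≥ 1. -/
lemma lintegral_parabolaConvolution_le {A : Set ℝ} (hA : MeasurableSet A) {g : ℝ → ℂ}
    (hgA : ∀ s, ‖g s‖ ≤ A.indicator 1 s) {r : ℝ} (hr : 1 ≤ r) :
    ∫⁻ w, ‖parabolaConvolution g w‖ₑ ^ r ≤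
      ∫⁻ s in A, ∫⁻ t in A, ‖t - s‖ₑ ^ (-(r - 1)) := by
  have hgA' : ∀ s, ‖g s‖ₑ ≤ A.indicator 1 s := fun s => by
    rw [← ofReal_norm]
    refine (ENNReal.ofReal_le_ofReal (hgA s)).trans (le_of_eq ?_)
    by_cases hs : s ∈ A <;> simp [hs]
  calc ∫⁻ w, ‖parabolaConvolution g w‖ₑ ^ r
      = ∫⁻ w in parabolaSum '' aboveDiagonal, ‖parabolaConvolution g w‖ₑ ^ r := by
        rw [← lintegral_indicator measurableSet_image_parabolaSum]
        congr 1
        funext w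
        by_cases hw : w ∈ parabolaSum '' aboveDiagonal
        · rw [Set.indicator_of_mem hw]
        · rw [Set.indicator_of_notMem hw, parabolaConvolution_eq_zero g hw]
          simp [show (0 : ℝ) < r by linarith]
    _ = ∫⁻ z in aboveDiagonal, ENNReal.ofReal |(fderivParabolaSum z).det| *
          ‖parabolaConvolution g (parabolaSum z)‖ₑ ^ r :=
        lintegral_image_eq_lintegral_abs_det_fderiv_mul volume measurableSet_aboveDiagonal
          (fun z _ => (hasFDerivAt_parabolaSum z).hasFDerivWithinAt) injOn_parabolaSum _
    _ ≤ ∫⁻ z in aboveDiagonal, A.indicator 1 z.1 * (A.indicator 1 z.2 * ‖z.2 - z.1‖ₑ ^ (-(r - 1))) := by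
        refine setLIntegral_mono ?_ fun z hz => ?_
        · refine ((measurable_one.indicator hA).comp measurable_fst).mul
            (((measurable_one.indicator hA).comp measurable_snd).mul ?_)
          fun_prop
        · have hz' : 0 < z.2 - z.1 := sub_pos.2 hz
          have h2z : (0 : ℝ) < 2 * (z.2 - z.1) := by linarith
          have hne : ((2 * (z.2 - z.1) : ℝ) : ℂ) ≠ 0 := by exact_mod_cast h2z.ne'
          rw [det_fderivParabolaSum, abs_of_pos h2z, parabolaConvolution_parabolaSum g hz]
          rw [div_eq_mul_inv, enorm_mul, enorm_mul, enorm_inv hne, ← div_eq_mul_inv]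
          have he : ‖((2 * (z.2 - z.1) : ℝ) : ℂ)‖ₑ = ENNReal.ofReal (2 * (z.2 - z.1)) := by
            rw [← ofReal_norm, Complex.norm_of_nonneg h2z.le]
          rw [he, Real.enorm_eq_ofReal hz'.le]
          set d := ENNReal.ofReal (2 * (z.2 - z.1)) with hd
          have hd0 : d ≠ 0 := by simp only [hd, ne_eq, ENNReal.ofReal_eq_zero, not_le]; exact h2z
          have hdt : d ≠ ∞ := ENNReal.ofReal_ne_top
          have h1 : ‖g z.1‖ₑ * ‖g z.2‖ₑ ≤ A.indicator 1 z.1 * A.indicator 1 z.2 :=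
            mul_le_mul' (hgA' _) (hgA' _)
          have h3 : (‖g z.1‖ₑ * ‖g z.2‖ₑ) ^ r ≤ A.indicator 1 z.1 * A.indicator 1 z.2 := by
            refine (ENNReal.rpow_le_rpow h1 (by linarith)).trans (le_of_eq ?_)
            by_cases hs : z.1 ∈ A <;> by_cases ht : z.2 ∈ A <;>
              simp [hs, ht, show (0 : ℝ) < r by linarith]
          rw [ENNReal.div_rpow_of_nonneg _ _ (by linarith)]
          have h4 : d * ((‖g z.1‖ₑ * ‖g z.2‖ₑ) ^ r / d ^ r) =
              (‖g z.1‖ₑ * ‖g z.2‖ₑ) ^ r * d ^ (-(r - 1)) := by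
            rw [div_eq_mul_inv, ← ENNReal.rpow_neg]
            calc _ = (‖g z.1‖ₑ * ‖g z.2‖ₑ) ^ r * (d ^ (1 : ℝ) * d ^ (-r)) := by
                  rw [ENNReal.rpow_one]; ring
              _ = _ := by
                  rw [← ENNReal.rpow_add _ _ hd0 hdt]; congr 2; ring
          rw [h4, ← mul_assoc]
          refine mul_le_mul' h3 ?_
          rw [ENNReal.rpow_neg, ENNReal.rpow_neg, ENNReal.inv_le_inv]
          refine ENNReal.rpow_le_rpow ?_ (by linarith)
          rw [hd]
          exact ENNReal.ofReal_le_ofReal (by linarith)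
    _ ≤ ∫⁻ z : ℝ × ℝ, A.indicator 1 z.1 * (A.indicator 1 z.2 * ‖z.2 - z.1‖ₑ ^ (-(r - 1))) :=
        setLIntegral_le_lintegral _ _
    _ = ∫⁻ s, ∫⁻ t, A.indicator 1 s * (A.indicator 1 t * ‖t - s‖ₑ ^ (-(r - 1))) := by
        rw [Measure.volume_eq_prod, lintegral_prod]
        refine Measurable.aemeasurable ?_
        refine ((measurable_one.indicator hA).comp measurable_fst).mul
            (((measurable_one.indicator hA).comp measurable_snd).mul ?_)
        fun_prop
    _ = _ := by
        rw [← lintegral_indicator hA]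
        congr 1
        funext s
        by_cases hs : s ∈ A
        · rw [Set.indicator_of_mem hs, Set.indicator_of_mem hs, ← lintegral_indicator hA]
          congr 1
          funext t
          by_cases ht : t ∈ A <;> simp [ht]
        · simp [hs]

lemma integral_aboveDiagonal_of_symm {Φ : ℝ × ℝ → ℂ} (hΦ : Integrable Φ)
    (hsymm : ∀ z, Φ z.swap = Φ z) : ∫ z, Φ z = 2 * ∫ z in aboveDiagonal, Φ z := by
  have hm := measurableSet_aboveDiagonal
  have h1 : ∫ z in aboveDiagonalᶜ, Φ z = ∫ z in aboveDiagonal, Φ z := by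
    have hdiag : volume {z : ℝ × ℝ | z.1 = z.2} = 0 := by
      have hmd : MeasurableSet {z : ℝ × ℝ | z.1 = z.2} :=
        measurableSet_eq_fun measurable_fst measurable_snd
      rw [Measure.volume_eq_prod, Measure.measure_prod_null hmd]
      refine Filter.Eventually.of_forall fun s => ?_
      have : Prod.mk s ⁻¹' {z : ℝ × ℝ | z.1 = z.2} = {s} := by
        ext t; simp [eq_comm]
      simp only [this]; simp
    have h1 : volume (aboveDiagonalᶜ \ Prod.swap ⁻¹' aboveDiagonal) = 0 := by
      refine measure_mono_null ?_ hdiag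
      rintro ⟨s, t⟩ ⟨h1, h2⟩
      simp only [aboveDiagonal, Set.mem_compl_iff, Set.mem_ofPred_eq, Set.mem_preimage,
        Prod.swap_prod_mk, not_lt] at h1 h2 ⊢
      linarith
    have h2 : volume (Prod.swap ⁻¹' aboveDiagonal \ aboveDiagonalᶜ) = 0 := by
      convert measure_empty (μ := (volume : Measure (ℝ × ℝ)))
      rw [Set.eq_empty_iff_forall_notMem]
      rintro ⟨s, t⟩ ⟨h1, h2⟩
      simp only [aboveDiagonal, Set.mem_compl_iff, Set.mem_ofPred_eq, Set.mem_preimage,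
        Prod.swap_prod_mk, not_lt] at h1 h2
      linarith
    have hae := ae_eq_set.2 ⟨h1, h2⟩
    rw [setIntegral_congr_set hae]
    have hsw : MeasurePreserving (Prod.swap : ℝ × ℝ → ℝ × ℝ) volume volume :=
      Measure.measurePreserving_swap
    have := hsw.setIntegral_preimage_emb MeasurableEquiv.prodComm.measurableEmbedding Φ aboveDiagonal
    rw [← this]
    simp only [hsymm]
  rw [← integral_add_compl hm hΦ, h1]
  ring

/-- (Eg)² is a double integral whose phase depends only on the sum of two points of the parabola.
Restricting to one side of the diagonal costs a factor 2 and makes the sum an injective coordinate,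
so the square is a planar Fourier transform. -/
lemma extOp_sq {g : ℝ → ℂ} (hgi : Integrable g) (x : ℝ × ℝ) :
    extOp g x ^ 2 = 2 * kernelOp pairKernel volume (parabolaConvolution g) x := by
  set Φ : ℝ × ℝ → ℂ := fun z =>
    (parabolaKernel x z.1 * g z.1) * (parabolaKernel x z.2 * g z.2) with hΦ
  have hΦi : Integrable Φ :=
    Integrable.mul_prod (integrable_modulate hgi x) (integrable_modulate hgi x)
  have h1 : extOp g x ^ 2 = ∫ z, Φ z := by
    rw [sq, Measure.volume_eq_prod]
    exact (integral_prod_mul _ _).symm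
  rw [h1, integral_aboveDiagonal_of_symm hΦi (fun z => by simp only [hΦ, Prod.fst_swap, Prod.snd_swap]; ring)]
  congr 1
  have h2 : kernelOp pairKernel volume (parabolaConvolution g) x =
      ∫ w in parabolaSum '' aboveDiagonal, pairKernel x w * parabolaConvolution g w := by
    rw [kernelOp, ← integral_indicator measurableSet_image_parabolaSum]
    congr 1
    funext w
    by_cases hw : w ∈ parabolaSum '' aboveDiagonal
    · rw [Set.indicator_of_mem hw]
    · rw [Set.indicator_of_notMem hw, parabolaConvolution_eq_zero g hw, mul_zero]
  rw [h2, integral_image_eq_integral_abs_det_fderiv_smul volume measurableSet_aboveDiagonal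
    (fun z _ => (hasFDerivAt_parabolaSum z).hasFDerivWithinAt) injOn_parabolaSum]
  refine setIntegral_congr_fun measurableSet_aboveDiagonal fun z hz => ?_
  have hz' : 0 < z.2 - z.1 := sub_pos.2 hz
  have h2z : (0 : ℝ) < 2 * (z.2 - z.1) := by linarith
  have hne : ((2 * (z.2 - z.1) : ℝ) : ℂ) ≠ 0 := by exact_mod_cast h2z.ne'
  simp only [hΦ]
  rw [det_fderivParabolaSum, abs_of_pos h2z, parabolaConvolution_parabolaSum g hz,
    Complex.real_smul]
  have h3 : pairKernel x (parabolaSum z) = parabolaKernel x z.1 * parabolaKernel x z.2 := by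
    simp only [pairKernel, parabolaKernel, parabolaSum]
    rw [← Complex.exp_add]
    congr 1
    push_cast
    ring
  rw [h3]
  field_simp

/-- Restricted type of the extension operator on the line `x + 3y = 1`. -/
lemma hasRestrictedType_extOp {y : ℝ} (hy0 : 0 < y) (hy : y < 1 / 4) :
    HasRestrictedType parabolaKernel volume volume (1 - 3 * y) y := by
  -- ‖Eg‖_q² is the L^(q/2) norm of (Eg)², and 2/q = 2y = 1 - ρ, so Hausdorff–Young asks for the
  -- density in L^(1/ρ). The condition y < 1/4 means 1/ρ < 2, which makes the weight |t - s|^(-(1/ρ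
  -- - 1)) locally integrable. The final power of |A| is (3ρ - 1)/2 = 1 - 3y.
  set ρ := 1 - 2 * y with hρ
  have hρ0 : 0 < ρ := by linarith
  obtain ⟨C₁, hC₁⟩ := boundedKernel_pairKernel.hausdorffYoung hasStrongType_pairKernel_half
    (x := ρ) (by linarith) (by linarith)
  have hr1 : ρ⁻¹ < 2 := by
    rw [inv_lt_comm₀ hρ0 (by norm_num)]; linarith
  have hr0 : 1 ≤ ρ⁻¹ := (one_le_inv₀ hρ0).2 (by linarith)
  obtain ⟨C₂, hC₂⟩ := lintegral_rpow_neg_dist_le (β := ρ⁻¹ - 1) (by linarith) (by linarith)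
  have hfin : ((2 : ℝ≥0∞) * (C₁ * (C₂ : ℝ≥0∞) ^ ρ)) ^ (1 / 2 : ℝ) ≠ ∞ := by
    refine ENNReal.rpow_ne_top_of_nonneg (by norm_num) (ENNReal.mul_ne_top (by norm_num) ?_)
    exact ENNReal.mul_ne_top (by simp) (ENNReal.rpow_ne_top_of_nonneg hρ0.le (by simp))
  refine ⟨(((2 : ℝ≥0∞) * (C₁ * (C₂ : ℝ≥0∞) ^ ρ)) ^ (1 / 2 : ℝ)).toNNReal,
    fun A hA hA' g hg hgA => ?_⟩
  rw [ENNReal.coe_toNNReal hfin]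
  have hgi : Integrable g := integrable_of_le_indicator hA hA' hg hgA
  set G := parabolaConvolution g with hG
  have hGm : Measurable G := measurable_parabolaConvolution hg
  have hGi : Integrable G := by
    refine ⟨hGm.aestronglyMeasurable, ?_⟩
    have := lintegral_parabolaConvolution_le hA hgA le_rfl
    simp only [ENNReal.rpow_one, sub_self, neg_zero, ENNReal.rpow_zero, lintegral_const, one_mul,
      Measure.restrict_apply_univ] at this
    exact this.trans_lt (ENNReal.mul_lt_top (lt_top_iff_ne_top.2 hA') (lt_top_iff_ne_top.2 hA'))
  have h1 := hC₁ G hGi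
  have h2 : eLpNorm G (recipExp ρ) ≤ (C₂ : ℝ≥0∞) ^ ρ * volume A ^ (3 * ρ - 1) := by
    rw [eLpNorm_recipExp hρ0]
    have h3 : ∫⁻ w, ‖G w‖ₑ ^ ρ⁻¹ ≤ C₂ * volume A ^ (3 - ρ⁻¹) := by
      refine (lintegral_parabolaConvolution_le hA hgA hr0).trans ?_
      calc _ ≤ ∫⁻ s in A, C₂ * volume A ^ (1 - (ρ⁻¹ - 1)) := by
            refine lintegral_mono fun s => ?_
            exact hC₂ A hA hA' s
        _ = C₂ * (volume A ^ (1 - (ρ⁻¹ - 1)) * volume A ^ (1 : ℝ)) := by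
            rw [setLIntegral_const, ENNReal.rpow_one, mul_assoc]
        _ = _ := by
            rw [← ENNReal.rpow_add_of_nonneg _ _ (by linarith) (by norm_num)]
            congr 2; ring
    calc _ ≤ (C₂ * volume A ^ (3 - ρ⁻¹)) ^ ρ := ENNReal.rpow_le_rpow h3 hρ0.le
      _ = _ := by
        rw [ENNReal.mul_rpow_of_nonneg _ _ hρ0.le, ← ENNReal.rpow_mul]
        congr 2
        field_simp
  have h4 : eLpNorm (extOp g) (recipExp y) =
      eLpNorm (fun z => 2 * kernelOp pairKernel volume G z) (recipExp (1 - ρ)) ^ (1 / 2 : ℝ) := by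
    simp only [hG, ← extOp_sq hgi]
    rw [show 1 - ρ = 2 * y by rw [hρ]; ring, eLpNorm_recipExp hy0, eLpNorm_recipExp (by linarith),
      ← ENNReal.rpow_mul]
    congr 1
    · congr 1
      funext z
      rw [enorm_pow, ← ENNReal.rpow_natCast, ← ENNReal.rpow_mul]
      congr 1
      field_simp
      norm_num
    · ring
  change eLpNorm (extOp g) _ _ ≤ _
  rw [h4]
  have h5 : eLpNorm (fun z => 2 * kernelOp pairKernel volume G z) (recipExp (1 - ρ)) volume ≤
      2 * (C₁ * (C₂ : ℝ≥0∞) ^ ρ) * volume A ^ (3 * ρ - 1) := by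
    have h6 : eLpNorm (fun z => 2 * kernelOp pairKernel volume G z) (recipExp (1 - ρ)) volume =
        2 * eLpNorm (kernelOp pairKernel volume G) (recipExp (1 - ρ)) volume := by
      have := eLpNorm_const_smul (2 : ℂ) (kernelOp pairKernel volume G) (recipExp (1 - ρ)) volume
      have h7 : ‖(2 : ℂ)‖ₑ = 2 := by rw [← ofReal_norm]; simp
      rw [h7] at this
      exact this
    rw [h6]
    calc _ ≤ 2 * (C₁ * ((C₂ : ℝ≥0∞) ^ ρ * volume A ^ (3 * ρ - 1))) := by
          gcongr
          exact h1.trans (by gcongr)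
      _ = _ := by ring
  refine (ENNReal.rpow_le_rpow h5 (by norm_num)).trans (le_of_eq ?_)
  rw [ENNReal.mul_rpow_of_nonneg _ _ (by norm_num), ← ENNReal.rpow_mul]
  congr 2
  rw [hρ]; ring

/-- The Fefferman–Zygmund extension theorem for the parabola. -/
theorem hasStrongType_extOp {y : ℝ} (hy0 : 0 < y) (hy : y < 1 / 4) :
    HasStrongType parabolaKernel volume volume (1 - 3 * y) y := by
  -- Both endpoints lie on x + 3y = 1, halfway from y to 1/4 and halfway from y to 0; θ = 1 - 4y
  -- returns to y.
  have h := HasRestrictedType.interpolate boundedKernel_parabolaKernel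
    (x₀ := 1 - 3 * ((y + 1 / 4) / 2)) (x₁ := 1 - 3 * (y / 2)) (y₀ := (y + 1 / 4) / 2) (y₁ := y / 2)
    (θ := 1 - 4 * y) (by linarith) (by linarith) (by linarith) (by linarith) (by linarith)
    (by linarith) (by linarith) (by intro h; linarith) (by linarith) (by linarith) (by nlinarith)
    (hasRestrictedType_extOp (by linarith) (by linarith))
    (hasRestrictedType_extOp (by linarith) (by linarith))
  have h1 : (1 - (1 - 4 * y)) * ((y + 1 / 4) / 2) + (1 - 4 * y) * (y / 2) = y := by ring
  have h2 : (1 - (1 - 4 * y)) * (1 - 3 * ((y + 1 / 4) / 2)) + (1 - 4 * y) * (1 - 3 * (y / 2)) =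
      1 - 3 * y := by ring
  rwa [h1, h2] at h

end

/-! ### Interpolation in the target; sufficiency in the vertical directions -/

noncomputable section

/-- Hölder's inequality for |f| = |f|^(1-θ) |f|^θ. With the source exponent fixed this suffices to
interpolate, and the restriction y ≤ x of real interpolation does not appear. -/
lemma eLpNorm_interpolate {β : Type*} [MeasurableSpace β] {ν : Measure β} {f : β → ℂ}
    (hf : Measurable f) {y₀ y₁ θ : ℝ} (hy₀ : 0 ≤ y₀) (hy₁ : 0 ≤ y₁) (hθ : 0 ≤ θ) (hθ' : θ ≤ 1) :
    eLpNorm f (recipExp ((1 - θ) * y₀ + θ * y₁)) ν ≤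
      eLpNorm f (recipExp y₀) ν ^ (1 - θ) * eLpNorm f (recipExp y₁) ν ^ θ := by
  rcases hθ.eq_or_lt with rfl | hθ
  · simp
  rcases hθ'.eq_or_lt with rfl | hθ'
  · simp
  have key : ∀ {c y : ℝ}, 0 < c → eLpNorm (fun z => ‖f z‖ ^ c) (recipExp (c * y)) ν =
      eLpNorm f (recipExp y) ν ^ c := by
    intro c y hc
    rw [eLpNorm_norm_rpow f hc]
    congr 2
    rw [recipExp, recipExp, ENNReal.ofReal_mul hc.le, ENNReal.mul_inv (by simp [hc]) (by simp),
      mul_comm, ← mul_assoc, ENNReal.mul_inv_cancel (by simp [hc]) (by simp), one_mul]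
  have hH : ENNReal.HolderTriple (recipExp ((1 - θ) * y₀)) (recipExp (θ * y₁))
      (recipExp ((1 - θ) * y₀ + θ * y₁)) := by
    refine ⟨?_⟩
    simp only [recipExp, inv_inv]
    rw [ENNReal.ofReal_add (mul_nonneg (by linarith) hy₀) (mul_nonneg hθ.le hy₁)]
  have h1 := eLpNorm_smul_le_mul_eLpNorm (μ := ν) (p := recipExp ((1 - θ) * y₀))
    (q := recipExp (θ * y₁)) (r := recipExp ((1 - θ) * y₀ + θ * y₁))
    (φ := fun z => ‖f z‖ ^ (1 - θ)) (f := fun z => ‖f z‖ ^ θ)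
    (hf.norm.pow_const _).aestronglyMeasurable (hf.norm.pow_const _).aestronglyMeasurable
  rw [key (sub_pos.2 hθ'), key hθ] at h1
  refine le_trans (le_of_eq ?_) h1
  refine eLpNorm_congr_norm_ae (Filter.Eventually.of_forall fun z => ?_)
  simp only [Pi.smul_apply', smul_eq_mul]
  rcases eq_or_ne (f z) 0 with h0 | h0
  · simp [h0, Real.zero_rpow hθ.ne']
  · rw [← Real.rpow_add (norm_pos_iff.2 h0)]
    simp

lemma HasStrongType.interpolate_target {α β : Type*} [MeasurableSpace α] [MeasurableSpace β]
    {μ : Measure α} {ν : Measure β} [SFinite μ] {K : β → α → ℂ} (hK : BoundedKernel K)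
    {x y₀ y₁ θ : ℝ} (hy₀ : 0 ≤ y₀) (hy₁ : 0 ≤ y₁) (hθ : 0 ≤ θ) (hθ' : θ ≤ 1)
    (h₀ : HasStrongType K μ ν x y₀) (h₁ : HasStrongType K μ ν x y₁) :
    HasStrongType K μ ν x ((1 - θ) * y₀ + θ * y₁) := by
  obtain ⟨C₀, hC₀⟩ := h₀
  obtain ⟨C₁, hC₁⟩ := h₁
  refine ⟨C₀ ^ (1 - θ) * C₁ ^ θ, fun g hg => ?_⟩
  refine (eLpNorm_interpolate (hK.measurable_kernelOp hg.1) hy₀ hy₁ hθ hθ').trans ?_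
  have h1θ : 0 ≤ 1 - θ := by linarith
  calc _ ≤ (C₀ * eLpNorm g (recipExp x) μ) ^ (1 - θ) * (C₁ * eLpNorm g (recipExp x) μ) ^ θ := by
        gcongr
        · exact hC₀ g hg
        · exact hC₁ g hg
    _ = (C₀ : ℝ≥0∞) ^ (1 - θ) * (C₁ : ℝ≥0∞) ^ θ *
        (eLpNorm g (recipExp x) μ ^ (1 - θ) * eLpNorm g (recipExp x) μ ^ θ) := by
        rw [ENNReal.mul_rpow_of_nonneg _ _ h1θ, ENNReal.mul_rpow_of_nonneg _ _ hθ]; ring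
    _ = _ := by
        rw [← ENNReal.rpow_add_of_nonneg _ _ h1θ hθ, ENNReal.coe_mul,
          ← ENNReal.coe_rpow_of_nonneg _ h1θ, ← ENNReal.coe_rpow_of_nonneg _ hθ]
        simp

lemma HasStrongType.interpolate_target_of_mem_Icc {α β : Type*} [MeasurableSpace α]
    [MeasurableSpace β] {μ : Measure α} {ν : Measure β} [SFinite μ] {K : β → α → ℂ}
    (hK : BoundedKernel K) {x y₀ y₁ y : ℝ} (hy₀ : 0 ≤ y₀) (h0 : y₀ ≤ y) (h1 : y ≤ y₁)
    (h₀ : HasStrongType K μ ν x y₀) (h₁ : HasStrongType K μ ν x y₁) :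
    HasStrongType K μ ν x y := by
  rcases (h0.trans h1).eq_or_lt with h | h
  · have : y = y₀ := le_antisymm (h ▸ h1) h0
    rwa [this]
  have hd : 0 < y₁ - y₀ := by linarith
  have := HasStrongType.interpolate_target hK (θ := (y - y₀) / (y₁ - y₀)) hy₀ (by linarith)
    (div_nonneg (by linarith) hd.le) ((div_le_one hd).2 (by linarith)) h₀ h₁
  have he : (1 - (y - y₀) / (y₁ - y₀)) * y₀ + (y - y₀) / (y₁ - y₀) * y₁ = y := by
    field_simp; ring
  rwa [he] at this

lemma HasStrongType.mono_measure {α β : Type*} [MeasurableSpace α] [MeasurableSpace β]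
    {μ : Measure α} {ν ν' : Measure β} {K : β → α → ℂ} {x y : ℝ} (hν : ν' ≤ ν)
    (h : HasStrongType K μ ν x y) : HasStrongType K μ ν' x y :=
  h.imp fun _ hC g hg => (eLpNorm_mono_measure _ hν).trans (hC g hg)

lemma hasStrongType_horLine_half : HasStrongType parabolaKernel volume horLine (1 / 2) (1 / 2) := by
  obtain ⟨C, hC⟩ := hasStrongType_fourierKernel_half (E := ℝ)
  refine ⟨C, fun g hg => ?_⟩
  change eLpNorm (extOp g) _ _ ≤ _
  rw [horLine, eLpNorm_map_measure (measurable_extOp hg.1).aestronglyMeasurable (by fun_prop)]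
  refine le_trans (le_of_eq ?_) (hC g hg)
  congr 1
  funext a
  simp only [Function.comp, extOp, kernelOp, parabolaKernel, fourierKernel]
  congr 1
  funext s
  simp [mul_comm]

/-- The sufficient condition for the Radon estimate in the vertical directions. -/
theorem hasStrongType_horLine {x : ℝ} (hx : 1 / 2 ≤ x) (hx' : x ≤ 1) :
    HasStrongType parabolaKernel volume horLine x (1 - x) :=
  boundedKernel_parabolaKernel.hausdorffYoung hasStrongType_horLine_half hx hx'

lemma hasStrongType_horStrip_half :
    HasStrongType parabolaKernel volume horStrip (1 / 2) (1 / 2) :=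
  hasStrongType_horLine_half.horStrip_of_horLine (by norm_num)

/-- The sufficient condition for the strip estimate in the vertical directions. -/
theorem hasStrongType_horStrip {x y : ℝ} (hx1 : x ≤ 1) (hy0 : 0 ≤ y) (h1 : x + y ≤ 1)
    (h2 : 1 ≤ x + 3 * y) (h3 : y < x ∨ (x = 1 / 2 ∧ y = 1 / 2)) :
    HasStrongType parabolaKernel volume horStrip x y := by
  have hle : horStrip ≤ volume := Measure.restrict_le_self
  rcases h3 with h3 | ⟨rfl, rfl⟩
  swap
  · exact hasStrongType_horStrip_half
  rcases hx1.eq_or_lt with rfl | hx1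
  · have : y = 0 := by linarith
    rw [this]
    exact boundedKernel_parabolaKernel.hasStrongType_one_zero
  -- For such x the admissible y run from the Fefferman–Zygmund line x + 3y = 1 to the
  -- Hausdorff–Young line x + y = 1, both available at the same x.
  by_cases hx : 1 / 2 ≤ x
  · refine HasStrongType.interpolate_target_of_mem_Icc boundedKernel_parabolaKernel
      (y₀ := (1 - x) / 3) (y₁ := 1 - x) (by linarith) (by linarith) (by linarith) ?_ ?_
    · have := (hasStrongType_extOp (y := (1 - x) / 3) (by linarith) (by linarith)).mono_measure hle
      rwa [show 1 - 3 * ((1 - x) / 3) = x by ring] at this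
    · exact (hasStrongType_horLine hx hx1.le).horStrip_of_horLine (by linarith)
  · push Not at hx
    rcases h2.eq_or_lt with h2 | h2
    · have := (hasStrongType_extOp (y := y) (by linarith) (by linarith)).mono_measure hle
      rwa [show 1 - 3 * y = x by linarith] at this
    -- The line from (1/2, 1/2) through (x, y) is followed to x + 3y = 1. That functional equals 2
    -- at (1/2, 1/2), so θ is the weight of the other endpoint (1 - 3y₁, y₁), and y₁ < 1/4 is
    -- equivalent to y < x.
    set θ := 2 - x - 3 * y with hθ
    have hθ0 : 0 < θ := by rw [hθ]; linarith
    have hθ1 : θ < 1 := by rw [hθ]; linarith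
    set y₁ := (y - (1 - θ) / 2) / θ with hy₁
    have hy₁0 : 0 < y₁ := div_pos (by rw [hθ]; linarith) hθ0
    have hy₁1 : y₁ < 1 / 4 := by
      rw [hy₁, div_lt_iff₀ hθ0, hθ]; linarith
    have hyy : (1 - (1 - θ)) * y₁ + (1 - θ) * (1 / 2) = y := by
      rw [hy₁]; field_simp; ring
    have hxx : (1 - (1 - θ)) * (1 - 3 * y₁) + (1 - θ) * (1 / 2) = x := by
      have : θ * y₁ = y - (1 - θ) / 2 := by rw [hy₁]; field_simp
      have h5 : (1 - (1 - θ)) * (1 - 3 * y₁) = θ - 3 * (θ * y₁) := by ring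
      rw [h5, this, hθ]; ring
    have hx1' : 1 - 3 * y₁ < 1 / 2 := by
      have h6 : (1 - (1 - θ)) * (1 - 3 * y₁) + (1 - θ) * (1 / 2) < 1 / 2 := by rw [hxx]; exact hx
      have h7 : θ * (1 - 3 * y₁) < θ * (1 / 2) := by linarith
      exact lt_of_mul_lt_mul_left h7 hθ0.le
    have := HasRestrictedType.interpolate boundedKernel_parabolaKernel (ν := horStrip)
      (x₀ := 1 - 3 * y₁) (x₁ := 1 / 2) (y₀ := y₁) (y₁ := 1 / 2) (θ := 1 - θ) (by linarith) hx1'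
      (by norm_num) hy₁0.le (by norm_num) (by linarith) (by norm_num) (by intro h; linarith)
      (by linarith) (by linarith) (by rw [hxx, hyy]; exact h3.le)
      (((hasStrongType_extOp hy₁0 hy₁1).mono_measure hle).restricted (by linarith))
      (hasStrongType_horStrip_half.restricted (by norm_num))
    rwa [hxx, hyy] at this

end

/-! ### The vertical axis: substitution u = s² and weighted Hausdorff–Young -/

noncomputable section

/-- The density obtained from `g` on the positive half line by the substitution `u = s²`. -/
def sqDensity (g : ℝ → ℂ) (u : ℝ) : ℂ := g √u / ((2 * √u : ℝ) : ℂ)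

lemma image_sq_Ioi : (fun s : ℝ => s ^ 2) '' Set.Ioi 0 = Set.Ioi 0 := by
  ext u
  constructor
  · rintro ⟨s, hs, rfl⟩
    exact pow_pos (Set.mem_Ioi.1 hs) 2
  · intro hu
    exact ⟨√u, Real.sqrt_pos.2 hu, Real.sq_sqrt (le_of_lt hu)⟩

lemma injOn_sq_Ioi : Set.InjOn (fun s : ℝ => s ^ 2) (Set.Ioi 0) := fun s hs t ht h => by
  have hs' : 0 < s := hs
  have ht' : 0 < t := ht
  simp only at h
  exact (pow_left_inj₀ hs'.le ht'.le two_ne_zero).1 h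

lemma hasDerivWithinAt_sq (s : ℝ) (S : Set ℝ) :
    HasDerivWithinAt (fun s : ℝ => s ^ 2) (2 * s) S s := by
  simpa using (hasDerivAt_pow 2 s).hasDerivWithinAt

lemma sqDensity_eq_zero (g : ℝ → ℂ) {u : ℝ} (hu : u ∉ Set.Ioi 0) : sqDensity g u = 0 := by
  simp [sqDensity, Real.sqrt_eq_zero_of_nonpos (not_lt.1 hu)]

lemma sqDensity_sq (g : ℝ → ℂ) {s : ℝ} (hs : 0 < s) :
    sqDensity g (s ^ 2) = g s / ((2 * s : ℝ) : ℂ) := by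
  rw [sqDensity, Real.sqrt_sq hs.le]

lemma measurable_sqDensity {g : ℝ → ℂ} (hg : Measurable g) : Measurable (sqDensity g) := by
  unfold sqDensity
  exact (hg.comp (by fun_prop)).div (Complex.measurable_ofReal.comp (by fun_prop))

/-- The Jacobian 2s meets the factor (2s)^(-r) of the density; this is the origin of the weight
|s|^(1-r). -/
lemma lintegral_sqDensity_le (g : ℝ → ℂ) (hg : Measurable g) {r : ℝ} (hr : 1 ≤ r) :
    ∫⁻ u, ‖sqDensity g u‖ₑ ^ r ≤ ∫⁻ s in Set.Ioi 0, ‖g s‖ₑ ^ r * ‖s‖ₑ ^ (-(r - 1)) := by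
  have h1 : ∫⁻ u, ‖sqDensity g u‖ₑ ^ r = ∫⁻ u in Set.Ioi 0, ‖sqDensity g u‖ₑ ^ r := by
    rw [← lintegral_indicator measurableSet_Ioi]
    congr 1
    funext u
    by_cases hu : u ∈ Set.Ioi (0 : ℝ)
    · rw [Set.indicator_of_mem hu]
    · rw [Set.indicator_of_notMem hu, sqDensity_eq_zero g hu]
      simp [show (0 : ℝ) < r by linarith]
  rw [h1]
  conv_lhs => rw [← image_sq_Ioi]
  rw [lintegral_image_eq_lintegral_abs_deriv_mul measurableSet_Ioi
    (fun s _ => hasDerivWithinAt_sq s _) injOn_sq_Ioi]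
  refine setLIntegral_mono (by fun_prop) fun s hs => ?_
  have hs' : 0 < s := hs
  have h2s : (0 : ℝ) < 2 * s := by linarith
  have hne : ((2 * s : ℝ) : ℂ) ≠ 0 := by exact_mod_cast h2s.ne'
  rw [abs_of_pos h2s, sqDensity_sq g hs', div_eq_mul_inv, enorm_mul, enorm_inv hne,
    ← div_eq_mul_inv]
  have he : ‖((2 * s : ℝ) : ℂ)‖ₑ = ENNReal.ofReal (2 * s) := by
    rw [← ofReal_norm, Complex.norm_of_nonneg h2s.le]
  rw [he, Real.enorm_eq_ofReal hs'.le, ENNReal.div_rpow_of_nonneg _ _ (by linarith)]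
  set d := ENNReal.ofReal (2 * s) with hd
  have hd0 : d ≠ 0 := by simp only [hd, ne_eq, ENNReal.ofReal_eq_zero, not_le]; exact h2s
  have hdt : d ≠ ∞ := ENNReal.ofReal_ne_top
  have h4 : d * (‖g s‖ₑ ^ r / d ^ r) = ‖g s‖ₑ ^ r * d ^ (-(r - 1)) := by
    rw [div_eq_mul_inv, ← ENNReal.rpow_neg]
    calc _ = ‖g s‖ₑ ^ r * (d ^ (1 : ℝ) * d ^ (-r)) := by
          rw [ENNReal.rpow_one]; ring
      _ = _ := by
          rw [← ENNReal.rpow_add _ _ hd0 hdt]; congr 2; ring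
  rw [h4]
  refine mul_le_mul' le_rfl ?_
  rw [ENNReal.rpow_neg, ENNReal.rpow_neg, ENNReal.inv_le_inv]
  refine ENNReal.rpow_le_rpow ?_ (by linarith)
  exact ENNReal.ofReal_le_ofReal (by linarith)

lemma integral_Ioi_eq_kernelOp_sqDensity (g : ℝ → ℂ) (b : ℝ) :
    ∫ s in Set.Ioi 0, parabolaKernel (0, b) s * g s =
      kernelOp fourierKernel volume (sqDensity g) b := by
  have h1 : kernelOp fourierKernel volume (sqDensity g) b =
      ∫ u in Set.Ioi 0, fourierKernel b u * sqDensity g u := by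
    rw [kernelOp, ← integral_indicator measurableSet_Ioi]
    congr 1
    funext u
    by_cases hu : u ∈ Set.Ioi (0 : ℝ)
    · rw [Set.indicator_of_mem hu]
    · rw [Set.indicator_of_notMem hu, sqDensity_eq_zero g hu, mul_zero]
  rw [h1]
  conv_rhs => rw [← image_sq_Ioi]
  rw [integral_image_eq_integral_abs_deriv_smul measurableSet_Ioi
    (fun s _ => hasDerivWithinAt_sq s _) injOn_sq_Ioi]
  refine setIntegral_congr_fun measurableSet_Ioi fun s hs => ?_
  have hs' : 0 < s := hs
  have h2s : (0 : ℝ) < 2 * s := by linarith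
  have hne : ((2 * s : ℝ) : ℂ) ≠ 0 := by exact_mod_cast h2s.ne'
  rw [abs_of_pos h2s, sqDensity_sq g hs', Complex.real_smul]
  have h3 : fourierKernel b (s ^ 2) = parabolaKernel (0, b) s := by
    simp [fourierKernel, parabolaKernel, mul_comm]
  rw [h3]
  field_simp

/-- On the vertical axis s and -s have the same phase, so each half-line contributes a
one-dimensional Fourier transform in u = s². -/
lemma extOp_zero_eq {g : ℝ → ℂ} (hg : Integrable g) (b : ℝ) :
    extOp g (0, b) = kernelOp fourierKernel volume (sqDensity g) b +
      kernelOp fourierKernel volume (sqDensity fun s => g (-s)) b := by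
  rw [← integral_Ioi_eq_kernelOp_sqDensity, ← integral_Ioi_eq_kernelOp_sqDensity, extOp, kernelOp]
  have hi := integrable_modulate hg (0, b)
  rw [← integral_add_compl measurableSet_Ioi hi]
  congr 1
  rw [Set.compl_Ioi]
  have := integral_comp_neg_Ioi (c := (0 : ℝ)) (fun s => parabolaKernel (0, b) s * g s)
  rw [neg_zero] at this
  rw [← this]
  refine setIntegral_congr_fun measurableSet_Ioi fun s _ => ?_
  simp [parabolaKernel]

/-- A weighted Hausdorff–Young inequality for the extension operator on the vertical axis. -/
lemma eLpNorm_extOp_vertLine_le {ρ : ℝ} (hρ : 1 / 2 ≤ ρ) (hρ' : ρ ≤ 1) :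
    ∃ C : ℝ≥0, ∀ g : ℝ → ℂ, Measurable g → Integrable g →
      eLpNorm (extOp g) (recipExp (1 - ρ)) vertLine ≤
        C * (∫⁻ s, ‖g s‖ₑ ^ ρ⁻¹ * ‖s‖ₑ ^ (-(ρ⁻¹ - 1))) ^ ρ := by
  have hρ0 : 0 < ρ := by linarith
  have hr : 1 ≤ ρ⁻¹ := (one_le_inv₀ hρ0).2 hρ'
  obtain ⟨C, hC⟩ := boundedKernel_fourierKernel.hausdorffYoung
    (hasStrongType_fourierKernel_half (E := ℝ)) hρ hρ'
  have key : ∀ g : ℝ → ℂ, Measurable g → Integrable g →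
      eLpNorm (kernelOp fourierKernel volume (sqDensity g)) (recipExp (1 - ρ)) volume ≤
        C * (∫⁻ s, ‖g s‖ₑ ^ ρ⁻¹ * ‖s‖ₑ ^ (-(ρ⁻¹ - 1))) ^ ρ := by
    intro g hg hgi
    have hdi : Integrable (sqDensity g) := by
      refine ⟨(measurable_sqDensity hg).aestronglyMeasurable, ?_⟩
      have := lintegral_sqDensity_le g hg le_rfl
      simp only [ENNReal.rpow_one, sub_self, neg_zero, ENNReal.rpow_zero, mul_one] at this
      exact (this.trans (setLIntegral_le_lintegral _ _)).trans_lt hgi.2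
    refine (hC _ hdi).trans ?_
    rw [eLpNorm_recipExp hρ0]
    refine mul_le_mul' le_rfl (ENNReal.rpow_le_rpow ?_ hρ0.le)
    exact (lintegral_sqDensity_le g hg hr).trans (setLIntegral_le_lintegral _ _)
  refine ⟨C + C, fun g hg hgi => ?_⟩
  have hneg : Integrable fun s => g (-s) := hgi.comp_neg
  have hnegm : Measurable fun s => g (-s) := hg.comp measurable_neg
  rw [vertLine, eLpNorm_map_measure (measurable_extOp hgi.1).aestronglyMeasurable (by fun_prop)]
  have h1 : extOp g ∘ (fun b => ((0 : ℝ), b)) = kernelOp fourierKernel volume (sqDensity g) +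
      kernelOp fourierKernel volume (sqDensity fun s => g (-s)) := by
    funext b; exact extOp_zero_eq hgi b
  have hm : ∀ g : ℝ → ℂ, Measurable g →
      AEStronglyMeasurable (kernelOp fourierKernel volume (sqDensity g)) volume := fun g hg =>
    (boundedKernel_fourierKernel.measurable_kernelOp
      (measurable_sqDensity hg).aestronglyMeasurable).aestronglyMeasurable
  rw [h1]
  refine (eLpNorm_add_le (hm _ hg) (hm _ hnegm) (one_le_recipExp (by linarith))).trans ?_
  rw [ENNReal.coe_add, add_mul]
  refine add_le_add (key g hg hgi) ((key _ hnegm hneg).trans (le_of_eq ?_))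
  congr 2
  have := (Measure.measurePreserving_neg (volume : Measure ℝ)).lintegral_comp
    (f := fun s => ‖g s‖ₑ ^ ρ⁻¹ * ‖s‖ₑ ^ (-(ρ⁻¹ - 1))) (by fun_prop)
  simpa using this

/-- With ρ = 1 - y and r = 1/ρ < 2, the weight |s|^(1-r) has integral at most a constant times
|A|^(2-r) over A; raising this to the power ρ gives |A|^(2ρ-1) = |A|^(1-2y). -/
lemma hasRestrictedType_vertLine {y : ℝ} (hy0 : 0 < y) (hy : y < 1 / 2) :
    HasRestrictedType parabolaKernel volume vertLine (1 - 2 * y) y := by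
  set ρ := 1 - y with hρ
  have hρ0 : 0 < ρ := by linarith
  have hr1 : ρ⁻¹ < 2 := by
    rw [inv_lt_comm₀ hρ0 (by norm_num)]; linarith
  have hr0 : 1 ≤ ρ⁻¹ := (one_le_inv₀ hρ0).2 (by linarith)
  obtain ⟨C, hC⟩ := eLpNorm_extOp_vertLine_le (ρ := ρ) (by linarith) (by linarith)
  obtain ⟨D, hD⟩ := lintegral_rpow_neg_dist_le (β := ρ⁻¹ - 1) (by linarith) (by linarith)
  refine ⟨C * D ^ ρ, fun A hA hA' g hg hgA => ?_⟩
  have h1 := hC g hg (integrable_of_le_indicator hA hA' hg hgA)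
  rw [show 1 - ρ = y by rw [hρ]; ring] at h1
  refine h1.trans ?_
  have h2 : ∫⁻ s, ‖g s‖ₑ ^ ρ⁻¹ * ‖s‖ₑ ^ (-(ρ⁻¹ - 1)) ≤ D * volume A ^ (1 - (ρ⁻¹ - 1)) := by
    refine le_trans ?_ (hD A hA hA' 0)
    rw [← lintegral_indicator hA]
    refine lintegral_mono fun s => ?_
    have h3 : ‖g s‖ₑ ≤ A.indicator 1 s := by
      rw [← ofReal_norm]
      refine (ENNReal.ofReal_le_ofReal (hgA s)).trans (le_of_eq ?_)
      by_cases hs : s ∈ A <;> simp [hs]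
    by_cases hs : s ∈ A
    · rw [Set.indicator_of_mem hs] at h3 ⊢
      rw [sub_zero]
      refine mul_le_of_le_one_left zero_le ?_
      exact ENNReal.rpow_le_one h3 (by positivity)
    · rw [Set.indicator_of_notMem hs] at h3 ⊢
      rw [nonpos_iff_eq_zero.1 h3, ENNReal.zero_rpow_of_pos (by positivity), zero_mul]
  calc _ ≤ C * (D * volume A ^ (1 - (ρ⁻¹ - 1))) ^ ρ := by gcongr
    _ = _ := by
      rw [ENNReal.mul_rpow_of_nonneg _ _ hρ0.le, ← ENNReal.rpow_mul, ENNReal.coe_mul,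
        ENNReal.coe_rpow_of_nonneg _ hρ0.le, mul_assoc]
      congr 3
      rw [show (1 - (ρ⁻¹ - 1)) * ρ = 2 * ρ - 1 by field_simp; ring, hρ]; ring

/-- The sufficient condition for the Radon estimate in the other directions. -/
theorem hasStrongType_vertLine {y : ℝ} (hy0 : 0 ≤ y) (hy : y ≤ 1 / 3) :
    HasStrongType parabolaKernel volume vertLine (1 - 2 * y) y := by
  rcases hy0.eq_or_lt with rfl | hy0
  · simpa using boundedKernel_parabolaKernel.hasStrongType_one_zero (μ := volume) (ν := vertLine)
  -- Endpoints on x + 2y = 1, halfway from y to 1/2 and to 0. The condition y ≤ 1 - 2y of real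
  -- interpolation is the hypothesis y ≤ 1/3.
  have h := HasRestrictedType.interpolate boundedKernel_parabolaKernel (ν := vertLine)
    (x₀ := 1 - 2 * ((y + 1 / 2) / 2)) (x₁ := 1 - 2 * (y / 2)) (y₀ := (y + 1 / 2) / 2) (y₁ := y / 2)
    (θ := 1 - 2 * y) (by linarith) (by linarith) (by linarith) (by linarith) (by linarith)
    (by linarith) (by linarith) (by intro h; linarith) (by linarith) (by linarith) (by nlinarith)
    (hasRestrictedType_vertLine (by linarith) (by linarith))
    (hasRestrictedType_vertLine (by linarith) (by linarith))
  have h1 : (1 - (1 - 2 * y)) * ((y + 1 / 2) / 2) + (1 - 2 * y) * (y / 2) = y := by ring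
  have h2 : (1 - (1 - 2 * y)) * (1 - 2 * ((y + 1 / 2) / 2)) + (1 - 2 * y) * (1 - 2 * (y / 2)) =
      1 - 2 * y := by ring
  rwa [h1, h2] at h

end

/-! ### Dyadic shells; sufficiency in the other directions -/

noncomputable section

/-- The points of the line with `2 ^ j ≤ |s| < 2 ^ (j + 1)`. -/
def dyadicShell (j : ℤ) : Set ℝ := dyadicLevel (fun s : ℝ => (s : ℂ)) j

lemma measurableSet_dyadicShell (j : ℤ) : MeasurableSet (dyadicShell j) :=
  measurableSet_dyadicLevel (by fun_prop) j

lemma enorm_mem_of_mem_dyadicShell {j : ℤ} {s : ℝ} (hs : s ∈ dyadicShell j) :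
    ‖s‖ₑ ∈ Set.Ico ((2 : ℝ≥0∞) ^ (j : ℝ)) (2 ^ ((j : ℝ) + 1)) := by
  have h1 : ‖(s : ℂ)‖ₑ ∈ Set.Ico ((2 : ℝ≥0∞) ^ j) (2 ^ (j + 1)) := hs
  have h2 : ‖(s : ℂ)‖ₑ = ‖s‖ₑ := by rw [← ofReal_norm, Complex.norm_real, ofReal_norm]
  rw [h2, two_zpow_eq_rpow, two_zpow_eq_rpow] at h1
  simpa using h1

lemma volume_dyadicShell_le (j : ℤ) : volume (dyadicShell j) ≤ 2 ^ ((j : ℝ) + 2) := by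
  have hsub : dyadicShell j ⊆ Set.Icc (-(2 : ℝ) ^ ((j : ℝ) + 1)) (2 ^ ((j : ℝ) + 1)) := by
    intro s hs
    have h1 := (enorm_mem_of_mem_dyadicShell hs).2.le
    rw [← ofReal_norm, Real.norm_eq_abs] at h1
    have h2 : (2 : ℝ≥0∞) ^ ((j : ℝ) + 1) = ENNReal.ofReal ((2 : ℝ) ^ ((j : ℝ) + 1)) := by
      rw [← ENNReal.ofReal_rpow_of_pos (by norm_num)]; simp
    rw [h2, ENNReal.ofReal_le_ofReal_iff (by positivity)] at h1
    exact abs_le.1 h1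
  refine (measure_mono hsub).trans (le_of_eq ?_)
  rw [Real.volume_Icc, sub_neg_eq_add, ← two_mul, ENNReal.ofReal_mul (by norm_num),
    ← ENNReal.ofReal_rpow_of_pos (by norm_num), show (j : ℝ) + 2 = 1 + (j + 1) by ring,
    two_rpow_add 1]
  simp

/-- The strip estimate for functions on a dyadic shell, with a power of its radius. -/
def HasShellType (R x y e : ℝ) : Prop :=
  ∃ C : ℝ≥0, ∀ (j : ℤ) (g : ℝ → ℂ), Measurable g → Integrable g → (∀ s ∉ dyadicShell j, g s = 0) →
    eLpNorm (extOp g) (recipExp y) (vertStrip R) ≤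
      C * 2 ^ ((j : ℝ) * e) * eLpNorm g (recipExp x) volume

/-- Hölder's inequality on a dyadic shell. -/
lemma eLpNorm_le_of_dyadicShell {x x' : ℝ} (hx : 0 ≤ x) (hxx : x ≤ x') {j : ℤ} {g : ℝ → ℂ}
    (hg : Measurable g) (hj : ∀ s ∉ dyadicShell j, g s = 0) :
    eLpNorm g (recipExp x') volume ≤
      2 ^ (2 * (x' - x)) * 2 ^ ((j : ℝ) * (x' - x)) * eLpNorm g (recipExp x) volume := by
  have hr : ∀ q, eLpNorm g q (volume.restrict (dyadicShell j)) = eLpNorm g q volume := fun q =>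
    eLpNorm_restrict_eq_of_support_subset (Function.support_subset_iff'.2 hj)
  have hpq : recipExp x' ≤ recipExp x := by
    rw [recipExp, recipExp, ENNReal.inv_le_inv]
    exact ENNReal.ofReal_le_ofReal hxx
  have hx' : 0 ≤ x' := hx.trans hxx
  have h1 := eLpNorm_le_eLpNorm_mul_rpow_measure_univ (μ := volume.restrict (dyadicShell j)) hpq
    hg.aestronglyMeasurable
  rw [hr, hr, Measure.restrict_apply_univ] at h1
  have h2 : 1 / (recipExp x').toReal - 1 / (recipExp x).toReal = x' - x := by
    simp only [recipExp, ENNReal.toReal_inv, one_div, inv_inv, ENNReal.toReal_ofReal hx,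
      ENNReal.toReal_ofReal hx']
  rw [h2] at h1
  refine h1.trans ?_
  rw [mul_comm]
  refine mul_le_mul' ?_ le_rfl
  refine (ENNReal.rpow_le_rpow (volume_dyadicShell_le j) (by linarith)).trans (le_of_eq ?_)
  rw [← ENNReal.rpow_mul, ← two_rpow_add]
  congr 1; ring

/-- Hölder on a shell of length about 2^j trades the larger x' for x and costs 2^(j(x'-x)), which is
a gain for negative j. -/
lemma HasStrongType.hasShellType {R x x' y : ℝ} (hx : 0 ≤ x) (hxx : x ≤ x')
    (h : HasStrongType parabolaKernel volume (vertStrip R) x' y) :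
    HasShellType R x y (x' - x) := by
  obtain ⟨C, hC⟩ := h
  have hfin := two_rpow_ne_top (2 * (x' - x))
  refine ⟨C * ((2 : ℝ≥0∞) ^ (2 * (x' - x))).toNNReal, fun j g hg hgi hj => ?_⟩
  refine (hC g hgi).trans ?_
  rw [ENNReal.coe_mul, ENNReal.coe_toNNReal hfin]
  refine (mul_le_mul' le_rfl (eLpNorm_le_of_dyadicShell hx hxx hg hj)).trans (le_of_eq ?_)
  ring

/-- For ρ = 1/2 the weight is |s|^(-1), at most 2^(-j) on the shell, so the L² bound carries
2^(-j/2). Hölder from L^p to L² costs 2^(j(1/2-x)), up to a constant, and the product is 2^(-jx), a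
gain for positive j. -/
lemma hasShellType_half {R x : ℝ} (hx : 0 ≤ x) (hx' : x ≤ 1 / 2) :
    HasShellType R x (1 / 2) (-x) := by
  obtain ⟨C, hC⟩ := eLpNorm_extOp_vertLine_le (ρ := 1 / 2) le_rfl (by norm_num)
  set D : ℝ≥0∞ := ENNReal.ofReal (2 * R) ^ (1 / 2 : ℝ) * (C * 2 ^ (2 * (1 / 2 - x))) with hD
  have hfin : D ≠ ∞ := by
    refine ENNReal.mul_ne_top (ENNReal.rpow_ne_top_of_nonneg (by norm_num) ENNReal.ofReal_ne_top) ?_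
    exact ENNReal.mul_ne_top ENNReal.coe_ne_top (two_rpow_ne_top _)
  refine ⟨D.toNNReal, fun j g hg hgi hj => ?_⟩
  rw [ENNReal.coe_toNNReal hfin]
  have h1 : ∀ g : ℝ → ℂ, Measurable g → Integrable g → (∀ s ∉ dyadicShell j, g s = 0) →
      eLpNorm (extOp g) (recipExp (1 / 2)) vertLine ≤
        C * 2 ^ (2 * (1 / 2 - x)) * 2 ^ ((j : ℝ) * (-x)) * eLpNorm g (recipExp x) volume := by
    intro g hg hgi hj
    have h2 := hC g hg hgi
    rw [show (1 : ℝ) - 1 / 2 = 1 / 2 by norm_num] at h2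
    refine h2.trans ?_
    have h3 : ∫⁻ s, ‖g s‖ₑ ^ (1 / 2 : ℝ)⁻¹ * ‖s‖ₑ ^ (-((1 / 2 : ℝ)⁻¹ - 1)) ≤
        2 ^ (-(j : ℝ)) * ∫⁻ s, ‖g s‖ₑ ^ (1 / 2 : ℝ)⁻¹ := by
      rw [← lintegral_const_mul _ (hg.enorm.pow_const _)]
      refine lintegral_mono fun s => ?_
      by_cases hs : s ∈ dyadicShell j
      · simp only
        rw [mul_comm]
        refine mul_le_mul' ?_ le_rfl
        have h4 := (enorm_mem_of_mem_dyadicShell hs).1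
        rw [show -((1 / 2 : ℝ)⁻¹ - 1) = -1 by norm_num, ENNReal.rpow_neg, ENNReal.rpow_neg,
          ENNReal.rpow_one, ENNReal.inv_le_inv]
        exact h4
      · simp only [hj s hs, enorm_zero]
        rw [ENNReal.zero_rpow_of_pos (by norm_num)]
        simp
    calc _ ≤ C * (2 ^ (-(j : ℝ)) * ∫⁻ s, ‖g s‖ₑ ^ (1 / 2 : ℝ)⁻¹) ^ (1 / 2 : ℝ) :=
          mul_le_mul' le_rfl (ENNReal.rpow_le_rpow h3 (by norm_num))
      _ = C * (2 ^ (-(j : ℝ) * (1 / 2)) * eLpNorm g (recipExp (1 / 2)) volume) := by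
          rw [ENNReal.mul_rpow_of_nonneg _ _ (by norm_num), ← ENNReal.rpow_mul,
            eLpNorm_recipExp (by norm_num)]
      _ ≤ C * (2 ^ (-(j : ℝ) * (1 / 2)) * (2 ^ (2 * (1 / 2 - x)) * 2 ^ ((j : ℝ) * (1 / 2 - x)) *
            eLpNorm g (recipExp x) volume)) :=
          mul_le_mul' le_rfl (mul_le_mul' le_rfl (eLpNorm_le_of_dyadicShell hx hx' hg hj))
      _ = _ := by
          rw [show (j : ℝ) * (-x) = -(j : ℝ) * (1 / 2) + (j : ℝ) * (1 / 2 - x) by ring,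
            two_rpow_add (-(j : ℝ) * (1 / 2))]
          ring
  refine (eLpNorm_extOp_vertStrip_le
    (B := C * 2 ^ (2 * (1 / 2 - x)) * 2 ^ ((j : ℝ) * (-x)) * eLpNorm g (recipExp x) volume)
    (by norm_num) R hgi fun a => ?_).trans (le_of_eq ?_)
  · refine (h1 _ ?_ (integrable_modulate hgi _) fun s hs => by rw [hj s hs, mul_zero]).trans ?_
    · exact (contDiff_parabolaKernel _).continuous.measurable.mul hg
    · rw [eLpNorm_modulate]
  · rw [hD]; ring

lemma HasShellType.interpolate {R x y₀ y₁ e₀ e₁ θ : ℝ} (hy₀ : 0 ≤ y₀) (hy₁ : 0 ≤ y₁) (hθ : 0 ≤ θ)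
    (hθ' : θ ≤ 1) (h₀ : HasShellType R x y₀ e₀) (h₁ : HasShellType R x y₁ e₁) :
    HasShellType R x ((1 - θ) * y₀ + θ * y₁) ((1 - θ) * e₀ + θ * e₁) := by
  obtain ⟨C₀, hC₀⟩ := h₀
  obtain ⟨C₁, hC₁⟩ := h₁
  refine ⟨C₀ ^ (1 - θ) * C₁ ^ θ, fun j g hg hgi hj => ?_⟩
  refine (eLpNorm_interpolate (measurable_extOp hgi.1) hy₀ hy₁ hθ hθ').trans ?_
  have h1θ : 0 ≤ 1 - θ := by linarith
  set N := eLpNorm g (recipExp x) volume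
  calc _ ≤ (C₀ * 2 ^ ((j : ℝ) * e₀) * N) ^ (1 - θ) * (C₁ * 2 ^ ((j : ℝ) * e₁) * N) ^ θ :=
        mul_le_mul' (ENNReal.rpow_le_rpow (hC₀ j g hg hgi hj) h1θ)
          (ENNReal.rpow_le_rpow (hC₁ j g hg hgi hj) hθ)
    _ = (C₀ : ℝ≥0∞) ^ (1 - θ) * (C₁ : ℝ≥0∞) ^ θ *
          (2 ^ ((j : ℝ) * e₀ * (1 - θ)) * 2 ^ ((j : ℝ) * e₁ * θ)) * (N ^ (1 - θ) * N ^ θ) := by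
        simp only [ENNReal.mul_rpow_of_nonneg _ _ h1θ, ENNReal.mul_rpow_of_nonneg _ _ hθ,
          ENNReal.rpow_mul]; ring
    _ = _ := by
        rw [← ENNReal.rpow_add_of_nonneg _ _ h1θ hθ, ENNReal.coe_mul,
          ← ENNReal.coe_rpow_of_nonneg _ h1θ, ← ENNReal.coe_rpow_of_nonneg _ hθ, ← two_rpow_add]
        rw [show (j : ℝ) * e₀ * (1 - θ) + j * e₁ * θ = j * ((1 - θ) * e₀ + θ * e₁) by ring]
        simp

/-- The positive exponent is used for j ≤ 0 and the negative one for j ≥ 0, so the contributions of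
the shells form a geometric series. Both exponents must be nonzero, which is why the resulting
region is open on these sides. -/
lemma HasShellType.hasStrongType {R x y e₀ e₁ : ℝ} (hy : y ≤ 1) (he₀ : 0 < e₀)
    (he₁ : e₁ < 0) (h₀ : HasShellType R x y e₀) (h₁ : HasShellType R x y e₁) :
    HasStrongType parabolaKernel volume (vertStrip R) x y := by
  obtain ⟨C₀, hC₀⟩ := h₀
  obtain ⟨C₁, hC₁⟩ := h₁
  set a := min e₀ (-e₁) with ha
  have ha0 : 0 < a := lt_min he₀ (by linarith)
  have hZ := tsum_two_rpow_neg_abs_ne_top ha0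
  set Z := ∑' n : ℤ, (2 : ℝ≥0∞) ^ (-(a * |(n : ℝ)|)) with hZdef
  suffices H : ∀ g : ℝ → ℂ, Measurable g → Integrable g →
      eLpNorm (extOp g) (recipExp y) (vertStrip R) ≤
        (C₀ + C₁ : ℝ≥0∞) * Z * eLpNorm g (recipExp x) volume by
    refine ⟨(C₀ + C₁) * Z.toNNReal, fun g hg => ?_⟩
    have h1 := H (hg.1.mk g) hg.1.measurable_mk (hg.congr hg.1.ae_eq_mk)
    rw [eLpNorm_congr_ae hg.1.ae_eq_mk, kernelOp_congr hg.1.ae_eq_mk, ENNReal.coe_mul,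
      ENNReal.coe_add, ENNReal.coe_toNNReal hZ]
    exact h1
  intro g hg hgi
  have hshell : ∀ j : ℤ, eLpNorm (extOp ((dyadicShell j).indicator g)) (recipExp y) (vertStrip R) ≤
      (C₀ + C₁ : ℝ≥0∞) * 2 ^ (-(a * |(j : ℝ)|)) * eLpNorm g (recipExp x) volume := by
    intro j
    have hgm := hg.indicator (measurableSet_dyadicShell j)
    have hgi' := hgi.indicator (measurableSet_dyadicShell j)
    have hz : ∀ s ∉ dyadicShell j, (dyadicShell j).indicator g s = 0 := fun s hs =>
      Set.indicator_of_notMem hs _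
    have hN : eLpNorm ((dyadicShell j).indicator g) (recipExp x) volume ≤
        eLpNorm g (recipExp x) volume := eLpNorm_indicator_le g
    have h2 : (1 : ℝ≥0∞) ≤ 2 := by norm_num
    rcases le_total 0 j with hj | hj
    · have hj' : (0 : ℝ) ≤ j := by exact_mod_cast hj
      refine (hC₁ j _ hgm hgi' hz).trans (mul_le_mul' (mul_le_mul' le_add_self ?_) hN)
      refine ENNReal.rpow_le_rpow_of_exponent_le h2 ?_
      rw [abs_of_nonneg hj']
      have : a ≤ -e₁ := min_le_right _ _
      nlinarith
    · have hj' : (j : ℝ) ≤ 0 := by exact_mod_cast hj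
      refine (hC₀ j _ hgm hgi' hz).trans (mul_le_mul' (mul_le_mul' le_self_add ?_) hN)
      refine ENNReal.rpow_le_rpow_of_exponent_le h2 ?_
      rw [abs_of_nonpos hj']
      have : a ≤ e₀ := min_le_left _ _
      nlinarith
  -- The shells miss the origin. Setting g to 0 there makes the partial sums converge at every
  -- point, as the Fatou lemma requires.
  have hg0 : g =ᵐ[volume] fun s => if s = 0 then 0 else g s := by
    filter_upwards [compl_mem_ae_iff.2 (measure_singleton (μ := (volume : Measure ℝ)) 0)] with s hs
    rw [if_neg (show s ≠ 0 from hs)]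
  have hgi2 : Integrable fun s => if s = 0 then 0 else g s := hgi.congr hg0
  have hext : extOp g = kernelOp parabolaKernel volume fun s => if s = 0 then 0 else g s :=
    kernelOp_congr hg0
  rw [hext]
  have hz : ∀ j : ℤ, (0 : ℝ) ∉ dyadicShell j := fun j hj => by
    have := (enorm_mem_of_mem_dyadicShell hj).1
    rw [enorm_zero, nonpos_iff_eq_zero] at this
    exact two_rpow_ne_zero _ this
  have huniq : ∀ {s : ℝ} {i j : ℤ}, s ∈ dyadicShell j → i ≠ j → s ∉ dyadicShell i :=
    fun hj hne hi => hne (eq_of_mem_dyadicLevel hi hj)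
  set J : ℕ → Finset ℤ := fun n => Finset.Ioo (-n : ℤ) n
  refine boundedKernel_parabolaKernel.eLpNorm_kernelOp_le_of_tendsto (μ := volume)
    (G := fun n s => ∑ j ∈ J n, (dyadicShell j).indicator g s) hgi2
    (fun n => ?_) (fun n s => ?_) (fun s => ?_) fun n => ?_
  · exact (Finset.measurable_sum _ fun j _ =>
      hg.indicator (measurableSet_dyadicShell j)).aestronglyMeasurable
  · by_cases h : ∃ j ∈ J n, s ∈ dyadicShell j
    · obtain ⟨j, hj, hs⟩ := h
      rw [Finset.sum_eq_single j (fun i _ hi => Set.indicator_of_notMem (huniq hs hi) _)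
        (fun h => absurd hj h), Set.indicator_of_mem hs, if_neg]
      rintro rfl
      exact hz j hs
    · push Not at h
      rw [Finset.sum_eq_zero fun j hj => Set.indicator_of_notMem (h j hj) _]
      simp
  · by_cases hs : s = 0
    · subst hs
      simp [hz]
    · obtain ⟨j, hj⟩ := exists_mem_dyadicLevel (g := fun s : ℝ => (s : ℂ)) (s := s)
        (by simpa using hs)
      rw [if_neg hs]
      refine tendsto_const_nhds.congr' ?_
      filter_upwards [Filter.eventually_gt_atTop j.natAbs] with n hn
      have hj' : j ∈ J n := by simp only [J, Finset.mem_Ioo]; omega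
      rw [Finset.sum_eq_single j (fun i _ hi => Set.indicator_of_notMem (huniq hj hi) _)
        (fun h => absurd hj' h), Set.indicator_of_mem (show s ∈ dyadicShell j from hj)]
  · rw [boundedKernel_parabolaKernel.kernelOp_sum _ fun j _ =>
      hgi.indicator (measurableSet_dyadicShell j)]
    refine (eLpNorm_sum_le (fun j _ => (measurable_extOp
      (hgi.indicator (measurableSet_dyadicShell j)).1).aestronglyMeasurable)
      (one_le_recipExp hy)).trans ?_
    refine (Finset.sum_le_sum fun j _ => hshell j).trans ?_
    rw [← Finset.sum_mul, ← Finset.mul_sum]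
    exact mul_le_mul' (mul_le_mul' le_rfl (ENNReal.sum_le_tsum _)) le_rfl

lemma HasShellType.of_mem_Icc {R x y₀ y₁ y e₀ e₁ : ℝ} (hy₀ : 0 ≤ y₀) (h0 : y₀ ≤ y) (h1 : y ≤ y₁)
    (h : y₀ < y₁) (h₀ : HasShellType R x y₀ e₀) (h₁ : HasShellType R x y₁ e₁) :
    HasShellType R x y (((y₁ - y) * e₀ + (y - y₀) * e₁) / (y₁ - y₀)) := by
  have hd : 0 < y₁ - y₀ := by linarith
  have := HasShellType.interpolate (θ := (y - y₀) / (y₁ - y₀)) hy₀ (by linarith)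
    (div_nonneg (by linarith) hd.le) ((div_le_one hd).2 (by linarith)) h₀ h₁
  have he : (1 - (y - y₀) / (y₁ - y₀)) * y₀ + (y - y₀) / (y₁ - y₀) * y₁ = y := by
    field_simp; ring
  have he' : (1 - (y - y₀) / (y₁ - y₀)) * e₀ + (y - y₀) / (y₁ - y₀) * e₁ =
      ((y₁ - y) * e₀ + (y - y₀) * e₁) / (y₁ - y₀) := by
    field_simp; ring
  rwa [he, he'] at this

/-- At fixed x, the shell exponent interpolated between y = 0 (exponent 1 - x) and y = 1/2 (exponent
-x) is positive exactly when x + 2y < 1. Interpolating between the Fefferman–Zygmund value y₁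
(exponent 1 - 3y₁ - x) and 1/2 gives a negative exponent exactly under `he`. -/
lemma hasStrongType_vertStrip_of_lt {R x y y₁ : ℝ} (hx : 0 < x) (hx' : x < 1 / 3) (hy0 : 0 ≤ y)
    (hxy : x + 2 * y < 1) (hy₁ : 0 < y₁) (hy₁' : y₁ < 1 / 4) (hy₁y : y₁ ≤ y)
    (hxy₁ : x ≤ 1 - 3 * y₁)
    (he : (1 / 2 - y) * (1 - 3 * y₁ - x) < (y - y₁) * x) :
    HasStrongType parabolaKernel volume (vertStrip R) x y := by
  have hle : vertStrip R ≤ volume := Measure.restrict_le_self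
  refine HasShellType.hasStrongType (by linarith) ?_ ?_
    (HasShellType.of_mem_Icc (y₀ := 0) (y₁ := 1 / 2) le_rfl hy0 (by linarith) (by norm_num)
      (HasStrongType.hasShellType hx.le (by linarith : x ≤ 1)
        boundedKernel_parabolaKernel.hasStrongType_one_zero)
      (hasShellType_half hx.le (by linarith)))
    (HasShellType.of_mem_Icc (y₀ := y₁) (y₁ := 1 / 2) hy₁.le hy₁y (by linarith) (by linarith)
      (HasStrongType.hasShellType hx.le hxy₁ ((hasStrongType_extOp hy₁ hy₁').mono_measure hle))
      (hasShellType_half hx.le (by linarith)))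
  · refine div_pos ?_ (by norm_num)
    nlinarith
  · refine div_neg_of_neg_of_pos ?_ (by linarith)
    linarith

/-- The sufficient condition for the strip estimate in the other directions. -/
theorem hasStrongType_vertStrip (R : ℝ) {x y : ℝ} (hx1 : x ≤ 1) (hy0 : 0 ≤ y)
    (h : (y ≤ x ∧ 1 ≤ x + 3 * y ∧ x + 2 * y ≤ 1 ∧ ¬(x = 1 / 4 ∧ y = 1 / 4)) ∨
      (x < y ∧ 1 / 2 < x + y ∧ x + 2 * y < 1)) :
    HasStrongType parabolaKernel volume (vertStrip R) x y := by
  have hle : vertStrip R ≤ volume := Measure.restrict_le_self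
  -- Here the line estimate on x + 2y = 1 is available, since y ≤ x there, and interpolation in y
  -- with Fefferman–Zygmund suffices.
  by_cases hx3 : 1 / 3 ≤ x
  · have h1 : 1 ≤ x + 3 * y ∧ x + 2 * y ≤ 1 := by
      rcases h with h | h
      · exact ⟨h.2.1, h.2.2.1⟩
      · constructor <;> linarith [h.1, h.2.1, h.2.2]
    rcases hx1.eq_or_lt with rfl | hx1
    · have : y = 0 := by linarith [h1.2]
      rw [this]
      exact boundedKernel_parabolaKernel.hasStrongType_one_zero
    refine HasStrongType.interpolate_target_of_mem_Icc boundedKernel_parabolaKernel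
      (y₀ := (1 - x) / 3) (y₁ := (1 - x) / 2) (by linarith) (by linarith) (by linarith) ?_ ?_
    · have := (hasStrongType_extOp (y := (1 - x) / 3) (by linarith) (by linarith)).mono_measure hle
      rwa [show 1 - 3 * ((1 - x) / 3) = x by ring] at this
    · have := (hasStrongType_vertLine (y := (1 - x) / 2) (by linarith)
        (by linarith)).vertStrip_of_vertLine (by linarith) R
      rwa [show 1 - 2 * ((1 - x) / 2) = x by ring] at this
  push Not at hx3
  by_cases hx4 : 1 / 4 < x
  · have h1 : 1 ≤ x + 3 * y ∧ x + 2 * y < 1 := by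
      rcases h with h | h
      · exact ⟨h.2.1, by linarith [h.1]⟩
      · constructor <;> linarith [h.1, h.2.1, h.2.2]
    rcases h1.1.eq_or_lt with h2 | h2
    · have := (hasStrongType_extOp (y := y) (by linarith) (by linarith)).mono_measure hle
      rwa [show 1 - 3 * y = x by linarith] at this
    -- With this y₁ the Fefferman–Zygmund exponent 1 - 3y₁ - x vanishes, and any y > y₁ gives a
    -- strictly negative exponent.
    · refine hasStrongType_vertStrip_of_lt (y₁ := (1 - x) / 3) (by linarith) hx3 hy0 h1.2
        (by linarith) (by linarith) (by linarith) (by linarith) ?_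
      nlinarith
  · push Not at hx4
    have h1 : x < y ∧ 1 / 2 < x + y ∧ x + 2 * y < 1 := by
      rcases h with h | h
      · exfalso
        refine h.2.2.2 ⟨?_, ?_⟩ <;> linarith [h.1, h.2.1]
      · exact h
    obtain ⟨h1, h2, h3⟩ := h1
    have hx0 : 0 < x := by linarith
    -- For x ≤ 1/4 no Fefferman–Zygmund point has the same x, so one near the excluded (1/4, 1/4) is
    -- taken. At y₁ = 1/4 the required inequality reads x + y > 1/2; δ is small enough to keep it.
    set δ := min (1 / 8) (x - (1 / 2 - y)) / 4 with hδ
    have hδ0 : 0 < δ := div_pos (lt_min (by norm_num) (by linarith)) (by norm_num)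
    have hδ1 : δ ≤ 1 / 32 := by rw [hδ]; linarith [min_le_left (1 / 8) (x - (1 / 2 - y))]
    have hδ2 : 4 * δ ≤ x - (1 / 2 - y) := by
      rw [hδ]; linarith [min_le_right (1 / 8) (x - (1 / 2 - y))]
    refine hasStrongType_vertStrip_of_lt (y₁ := 1 / 4 - δ) hx0 hx3 hy0 h3
      (by linarith) (by linarith) (by linarith) (by linarith) ?_
    nlinarith

end

/-! ### Gaussian test functions -/

noncomputable section

/-- The Gaussian `exp (-π l s²)`. -/
def gaussianFn (l s : ℝ) : ℂ := Complex.exp (-(Real.pi * l : ℝ) * (s : ℂ) ^ 2)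

lemma contDiff_gaussianFn (l : ℝ) : ContDiff ℝ (⊤ : ℕ∞) (gaussianFn l) := by
  unfold gaussianFn
  exact ((contDiff_const).mul (Complex.ofRealCLM.contDiff.pow 2)).cexp

lemma norm_gaussianFn (l s : ℝ) : ‖gaussianFn l s‖ = Real.exp (-(Real.pi * l) * s ^ 2) := by
  rw [gaussianFn, Complex.norm_exp]
  congr 1
  rw [← Complex.ofReal_neg, ← Complex.ofReal_pow, ← Complex.ofReal_mul, Complex.ofReal_re]

lemma integrable_gaussianFn {l : ℝ} (hl : 0 < l) : Integrable (gaussianFn l) := by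
  refine (integrable_norm_iff (contDiff_gaussianFn l).continuous.aestronglyMeasurable).1 ?_
  simp only [norm_gaussianFn]
  exact integrable_exp_neg_mul_sq (by positivity)

lemma eLpNorm_gaussianFn_le {l x : ℝ} (hl : 0 < l) (hx : 0 ≤ x) (hx' : x ≤ 1) :
    eLpNorm (gaussianFn l) (recipExp x) volume ≤ ENNReal.ofReal (l ^ (-x / 2)) := by
  have h1 := eLpNorm_interpolate (ν := volume) (contDiff_gaussianFn l).continuous.measurable
    (y₀ := 0) (y₁ := 1) le_rfl zero_le_one hx hx'
  rw [mul_zero, mul_one, zero_add] at h1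
  refine h1.trans ?_
  have h2 : eLpNorm (gaussianFn l) (recipExp 0) volume ≤ 1 := by
    rw [recipExp_zero, eLpNorm_exponent_top]
    refine eLpNormEssSup_le_of_ae_enorm_bound (Filter.Eventually.of_forall fun s => ?_)
    rw [← ofReal_norm, norm_gaussianFn, ENNReal.ofReal_le_one, Real.exp_le_one_iff]
    have := Real.pi_pos
    have : 0 ≤ Real.pi * l * s ^ 2 := by positivity
    linarith
  have h3 : eLpNorm (gaussianFn l) (recipExp 1) volume = ENNReal.ofReal (l ^ (-1 / 2 : ℝ)) := by
    rw [recipExp_one, eLpNorm_one_eq_lintegral_enorm,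
      ← ofReal_integral_norm_eq_lintegral_enorm (integrable_gaussianFn hl)]
    simp only [norm_gaussianFn]
    rw [integral_gaussian, Real.sqrt_eq_rpow]
    congr 1
    rw [show Real.pi / (Real.pi * l) = l⁻¹ by have := Real.pi_pos; field_simp,
      Real.inv_rpow hl.le, ← Real.rpow_neg hl.le]
    norm_num
  calc _ ≤ (1 : ℝ≥0∞) ^ (1 - x) * ENNReal.ofReal (l ^ (-1 / 2 : ℝ)) ^ x := by
        rw [h3]
        exact mul_le_mul' (ENNReal.rpow_le_rpow h2 (by linarith)) le_rfl
    _ = _ := by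
        rw [ENNReal.one_rpow, one_mul, ENNReal.ofReal_rpow_of_pos (by positivity),
          ← Real.rpow_mul hl.le]
        congr 2; ring

/-- The quadratic phase combines with the Gaussian into one of complex parameter l - 2iz₂, whose
Fourier transform is explicit. -/
lemma norm_extOp_gaussianFn {l : ℝ} (hl : 0 < l) (z : ℝ × ℝ) :
    ‖extOp (gaussianFn l) z‖ = (l ^ 2 + 4 * z.2 ^ 2) ^ (-1 / 4 : ℝ) *
      Real.exp (-Real.pi * (l * z.1 ^ 2 / (l ^ 2 + 4 * z.2 ^ 2))) := by
  have hpi := Real.pi_pos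
  set c : ℂ := ⟨l, -2 * z.2⟩ with hc
  have hcre : c.re = l := rfl
  have hcim : c.im = -2 * z.2 := rfl
  have hc0 : c ≠ 0 := by
    intro h
    rw [h] at hcre
    simp at hcre
    exact hl.ne hcre
  have hpi0 : (Real.pi : ℂ) ≠ 0 := by exact_mod_cast hpi.ne'
  have hns : Complex.normSq c = l ^ 2 + 4 * z.2 ^ 2 := by
    rw [Complex.normSq_apply, hcre, hcim]; ring
  have hD : 0 < l ^ 2 + 4 * z.2 ^ 2 := by positivity
  have h1 : extOp (gaussianFn l) z = (1 / c) ^ (1 / 2 : ℂ) *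
      Complex.exp (-Real.pi * z.1 ^ 2 / c) := by
    have h2 := integral_cexp_quadratic (b := -(Real.pi * c)) (by simp [hcre]; positivity)
      (2 * Real.pi * Complex.I * z.1) 0
    rw [neg_neg] at h2
    rw [show (1 / c) = Real.pi / (Real.pi * c) by field_simp,
      show (-Real.pi * (z.1 : ℂ) ^ 2 / c) =
        0 - (2 * Real.pi * Complex.I * z.1) ^ 2 / (4 * -(Real.pi * c)) by
          field_simp; rw [Complex.I_sq]; ring, ← h2]
    rw [extOp, kernelOp]
    congr 1
    funext s
    rw [parabolaKernel, gaussianFn, ← Complex.exp_add]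
    congr 1
    have : c = l - 2 * z.2 * Complex.I := by
      apply Complex.ext <;> simp [hc]
    rw [this]
    push_cast
    ring
  rw [h1, norm_mul, Complex.norm_exp]
  congr 1
  · rw [show (1 / 2 : ℂ) = ((1 / 2 : ℝ) : ℂ) by norm_num, Complex.norm_cpow_real, norm_div, norm_one,
      Complex.norm_def, hns, Real.sqrt_eq_rpow, one_div, ← Real.rpow_neg hD.le,
      ← Real.rpow_mul hD.le]
    norm_num
  · congr 1
    rw [show -(Real.pi : ℂ) * (z.1 : ℂ) ^ 2 / c = ((-Real.pi * z.1 ^ 2 : ℝ) : ℂ) * c⁻¹ by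
      push_cast; rw [div_eq_mul_inv], Complex.re_ofReal_mul, Complex.inv_re, hns, hcre]
    ring

lemma le_eLpNorm_of_le {β : Type*} [MeasurableSpace β] {ν : Measure β} {f : β → ℂ}
    {y : ℝ} (hy : 0 ≤ y) {S : Set β} (hS : MeasurableSet S) {m : ℝ≥0∞} (hm : ∀ z ∈ S, m ≤ ‖f z‖ₑ)
    (hν : ν S ≠ 0) : m * ν S ^ y ≤ eLpNorm f (recipExp y) ν := by
  rcases hy.eq_or_lt with rfl | hy
  · rw [ENNReal.rpow_zero, mul_one, eLpNorm_recipExp_zero]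
    by_contra hlt
    push Not at hlt
    refine hν (measure_mono_null (fun z hz => ?_)
      (ae_lt_of_essSup_lt hlt : ∀ᵐ z ∂ν, ‖f z‖ₑ < m))
    simpa using hm z hz
  · rw [eLpNorm_recipExp hy]
    calc m * ν S ^ y = (m ^ y⁻¹ * ν S) ^ y := by
          rw [ENNReal.mul_rpow_of_nonneg _ _ hy.le, ENNReal.rpow_inv_rpow hy.ne']
      _ = (∫⁻ _ in S, m ^ y⁻¹ ∂ν) ^ y := by rw [setLIntegral_const]
      _ ≤ (∫⁻ z in S, ‖f z‖ₑ ^ y⁻¹ ∂ν) ^ y := by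
          refine ENNReal.rpow_le_rpow (setLIntegral_mono' hS fun z hz => ?_) hy.le
          exact ENNReal.rpow_le_rpow (hm z hz) (by positivity)
      _ ≤ _ := ENNReal.rpow_le_rpow (setLIntegral_le_lintegral _ _) hy.le

/-- Testing an estimate on modulated Gaussians. -/
lemma HasSmoothType.gaussian_test {ν : Measure (ℝ × ℝ)} {x y : ℝ} (hx : 0 ≤ x) (hx' : x ≤ 1)
    (hy : 0 ≤ y) (h : HasSmoothType ν x y) :
    ∃ C : ℝ, ∀ (l T M V : ℝ) (S : Set (ℝ × ℝ)), 0 < l → 0 < V → MeasurableSet S →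
      ENNReal.ofReal V ≤ ν S →
      (∀ z ∈ S, l * z.1 ^ 2 ≤ l ^ 2 + 4 * (z.2 + T) ^ 2 ∧ l ^ 2 + 4 * (z.2 + T) ^ 2 ≤ M) →
      M ^ (-1 / 4 : ℝ) * V ^ y ≤ C * l ^ (-x / 2) := by
  obtain ⟨C, hC⟩ := h
  refine ⟨Real.exp Real.pi * C, fun l T M V S hl hV hS hVS hz => ?_⟩
  have hν : ν S ≠ 0 := fun h0 => by
    rw [h0, nonpos_iff_eq_zero, ENNReal.ofReal_eq_zero] at hVS
    linarith
  have hne : S.Nonempty := nonempty_of_measure_ne_zero hν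
  have hM : 0 < M := by
    obtain ⟨z, hzS⟩ := hne
    have := (hz z hzS).2
    have : 0 < l ^ 2 + 4 * (z.2 + T) ^ 2 := by positivity
    linarith
  -- The modulation moves the focus from height 0 to height -T. On S the exponential factor is at
  -- least exp (-π) and the amplitude at least M^(-1/4).
  set g : ℝ → ℂ := fun s => parabolaKernel (0, T) s * gaussianFn l s with hg
  have h1 := hC g ((contDiff_parabolaKernel _).mul (contDiff_gaussianFn l))
    (integrable_modulate (integrable_gaussianFn hl) _)
  rw [hg, eLpNorm_modulate] at h1
  have hpt : ∀ z ∈ S, ENNReal.ofReal (M ^ (-1 / 4 : ℝ) * Real.exp (-Real.pi)) ≤ ‖extOp g z‖ₑ := by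
    intro z hzS
    obtain ⟨h3, h4⟩ := hz z hzS
    have h0 : 0 < l ^ 2 + 4 * (z.2 + T) ^ 2 := by positivity
    rw [hg, extOp_modulate, ← ofReal_norm, norm_extOp_gaussianFn hl]
    refine ENNReal.ofReal_le_ofReal ?_
    simp only [Prod.fst_add, Prod.snd_add, add_zero]
    refine mul_le_mul (Real.rpow_le_rpow_of_nonpos h0 h4 (by norm_num)) (Real.exp_le_exp.2 ?_)
      (Real.exp_pos _).le (by positivity)
    have h5 : l * z.1 ^ 2 / (l ^ 2 + 4 * (z.2 + T) ^ 2) ≤ 1 := (div_le_one h0).2 h3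
    nlinarith [Real.pi_pos]
  have h2 := (le_eLpNorm_of_le hy hS hpt hν).trans h1
  have h6 : ENNReal.ofReal (M ^ (-1 / 4 : ℝ) * Real.exp (-Real.pi) * V ^ y) ≤
      ENNReal.ofReal (C * l ^ (-x / 2)) := by
    rw [ENNReal.ofReal_mul (by positivity), ← ENNReal.ofReal_rpow_of_pos hV,
      ENNReal.ofReal_mul (NNReal.coe_nonneg C), ENNReal.ofReal_coe_nnreal]
    calc _ ≤ _ := mul_le_mul' le_rfl (ENNReal.rpow_le_rpow hVS hy)
      _ ≤ _ := h2
      _ ≤ _ := mul_le_mul' le_rfl (eLpNorm_gaussianFn_le hl hx hx')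
  rw [ENNReal.ofReal_le_ofReal_iff (by positivity)] at h6
  have h7 : Real.exp Real.pi * Real.exp (-Real.pi) = 1 := by rw [← Real.exp_add]; simp
  calc M ^ (-1 / 4 : ℝ) * V ^ y
      = Real.exp Real.pi * (M ^ (-1 / 4 : ℝ) * Real.exp (-Real.pi) * V ^ y) := by
        linear_combination (-(M ^ (-1 / 4 : ℝ) * V ^ y)) * h7
    _ ≤ Real.exp Real.pi * (C * l ^ (-x / 2)) := by gcongr
    _ = _ := by ring

lemma exponent_le_of_rpow_le {C α β L : ℝ} (h : ∀ l, L ≤ l → 0 < l → l ^ α ≤ C * l ^ β) : α ≤ β := by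
  by_contra hlt
  push Not at hlt
  have h1 := tendsto_rpow_atTop (sub_pos.2 hlt)
  obtain ⟨l, hl1, hl2, hl3⟩ := ((h1.eventually_gt_atTop C).and
    ((Filter.eventually_ge_atTop L).and (Filter.eventually_gt_atTop 0))).exists
  have h2 := h l hl2 hl3
  rw [Real.rpow_sub hl3, lt_div_iff₀ (Real.rpow_pos_of_pos hl3 _)] at hl1
  linarith

/-- Reads off the condition on exponents when, in the Gaussian test, M scales like l^k and V like
l^s as l → ∞. -/
lemma exponent_le_of_scaling_atTop {C m v k s y e L : ℝ} (hm : 0 < m) (hv : 0 < v)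
    (h : ∀ l, L ≤ l → 0 < l → (m * l ^ k) ^ (-1 / 4 : ℝ) * (v * l ^ s) ^ y ≤ C * l ^ e) :
    -k / 4 + s * y ≤ e := by
  have hmv : 0 < m ^ (-1 / 4 : ℝ) * v ^ y := by positivity
  refine exponent_le_of_rpow_le (C := C / (m ^ (-1 / 4 : ℝ) * v ^ y)) (L := L) fun l hl hl0 => ?_
  have h1 := h l hl hl0
  rw [Real.mul_rpow hm.le (by positivity), Real.mul_rpow hv.le (by positivity),
    ← Real.rpow_mul hl0.le, ← Real.rpow_mul hl0.le] at h1
  rw [div_mul_eq_mul_div, le_div_iff₀ hmv, Real.rpow_add hl0, show -k / 4 = k * (-1 / 4) by ring]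
  linarith

lemma exponent_le_of_scaling_zero {C m v k s y e L : ℝ} (hm : 0 < m) (hv : 0 < v) (hL : 0 < L)
    (h : ∀ l, 0 < l → l ≤ L → (m * l ^ k) ^ (-1 / 4 : ℝ) * (v * l ^ s) ^ y ≤ C * l ^ e) :
    e ≤ -k / 4 + s * y := by
  have := exponent_le_of_scaling_atTop (C := C) (k := -k) (s := -s) (e := -e) (y := y) (L := L⁻¹)
    hm hv fun l hl hl0 => ?_
  · linarith
  · have h1 := h l⁻¹ (inv_pos.2 hl0) (inv_le_of_inv_le₀ hL hl)
    simp only [Real.rpow_neg hl0.le]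
    simpa only [Real.inv_rpow hl0.le] using h1

end

/-! ### Linear necessary conditions -/

noncomputable section

lemma ofReal_le_vertStrip_box {R a c d V : ℝ} (ha : 0 ≤ a) (haR : a ≤ R)
    (hV : V ≤ 2 * a * (d - c)) :
    ENNReal.ofReal V ≤ vertStrip R (Set.Icc (-a) a ×ˢ Set.Icc c d) := by
  have hsub : Set.Icc (-a) a ×ˢ Set.Icc c d ⊆ {z : ℝ × ℝ | |z.1| ≤ R} := fun z hz =>
    (abs_le.2 hz.1).trans haR
  rw [vertStrip, Measure.restrict_eq_self _ hsub, Measure.volume_eq_prod, Measure.prod_prod,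
    Real.volume_Icc, Real.volume_Icc, ← ENNReal.ofReal_mul (by linarith)]
  exact ENNReal.ofReal_le_ofReal (by linarith)

lemma ofReal_le_horStrip_box {a c d V : ℝ} (ha : 0 ≤ a) (hc : -(1 / 2) ≤ c) (hd : d ≤ 1 / 2)
    (hV : V ≤ 2 * a * (d - c)) :
    ENNReal.ofReal V ≤ horStrip (Set.Icc (-a) a ×ˢ Set.Icc c d) := by
  have hsub : Set.Icc (-a) a ×ˢ Set.Icc c d ⊆ {z : ℝ × ℝ | |z.2| ≤ 1 / 2} := fun z hz =>
    abs_le.2 ⟨hc.trans hz.2.1, hz.2.2.trans hd⟩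
  rw [horStrip, Measure.restrict_eq_self _ hsub, Measure.volume_eq_prod, Measure.prod_prod,
    Real.volume_Icc, Real.volume_Icc, ← ENNReal.ofReal_mul (by linarith)]
  exact ENNReal.ofReal_le_ofReal (by linarith)

lemma measurableSet_box (a c d : ℝ) : MeasurableSet (Set.Icc (-a) a ×ˢ Set.Icc c d) :=
  measurableSet_Icc.prod measurableSet_Icc

lemma sq_le_of_mem_box {a c d : ℝ} {z : ℝ × ℝ} (hz : z ∈ Set.Icc (-a) a ×ˢ Set.Icc c d) :
    z.1 ^ 2 ≤ a ^ 2 := sq_le_sq' hz.1.1 hz.1.2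

lemma rpow_half_sq {l : ℝ} (hl : 0 < l) : (l ^ (1 / 2 : ℝ)) ^ 2 = l := by
  rw [← Real.rpow_natCast, ← Real.rpow_mul hl.le]; norm_num

/-- As l → 0 the extension has size l^(-1/2) on a box of dimensions l^(1/2) × l around its focus. -/
lemma HasSmoothType.horStrip_one_le {x y : ℝ} (hx : 0 ≤ x) (hx' : x ≤ 1) (hy : 0 ≤ y)
    (h : HasSmoothType horStrip x y) : 1 ≤ x + 3 * y := by
  obtain ⟨C, hC⟩ := h.gaussian_test hx hx' hy
  have := exponent_le_of_scaling_zero (C := C) (m := 5) (v := 4) (k := 2) (s := 3 / 2) (y := y)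
    (e := -x / 2) (L := 1 / 2) (by norm_num) (by norm_num) (by norm_num) fun l hl hl' => ?_
  · linarith
  refine hC l 0 _ _ (Set.Icc (-l ^ (1 / 2 : ℝ)) (l ^ (1 / 2 : ℝ)) ×ˢ Set.Icc (-l) l) hl
    (by positivity) (measurableSet_box _ _ _)
    (ofReal_le_horStrip_box (by positivity) (by linarith) hl' ?_) fun z hz => ?_
  · rw [show (3 / 2 : ℝ) = 1 / 2 + 1 by norm_num, Real.rpow_add hl, Real.rpow_one]
    exact le_of_eq (by ring)
  · have h1 := sq_le_of_mem_box hz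
    rw [rpow_half_sq hl] at h1
    have h2 : z.2 ^ 2 ≤ l ^ 2 := sq_le_sq' hz.2.1 hz.2.2
    rw [Real.rpow_ofNat, add_zero]
    constructor <;> nlinarith [sq_nonneg z.2]

/-- As l → ∞ the extension has size l^(-1/2) across the full height of the strip, on a width
l^(1/2). -/
lemma HasSmoothType.horStrip_le_one {x y : ℝ} (hx : 0 ≤ x) (hx' : x ≤ 1) (hy : 0 ≤ y)
    (h : HasSmoothType horStrip x y) : x + y ≤ 1 := by
  obtain ⟨C, hC⟩ := h.gaussian_test hx hx' hy
  have := exponent_le_of_scaling_atTop (C := C) (m := 2) (v := 2) (k := 2) (s := 1 / 2) (y := y)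
    (e := -x / 2) (L := 1) (by norm_num) (by norm_num) fun l hl hl0 => ?_
  · linarith
  refine hC l 0 _ _ (Set.Icc (-l ^ (1 / 2 : ℝ)) (l ^ (1 / 2 : ℝ)) ×ˢ Set.Icc (-(1 / 2)) (1 / 2)) hl0
    (by positivity) (measurableSet_box _ _ _)
    (ofReal_le_horStrip_box (by positivity) le_rfl le_rfl (le_of_eq (by ring))) fun z hz => ?_
  have h1 := sq_le_of_mem_box hz
  rw [rpow_half_sq hl0] at h1
  have h2 : z.2 ^ 2 ≤ (1 / 2) ^ 2 := sq_le_sq' hz.2.1 hz.2.2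
  rw [Real.rpow_ofNat, add_zero]
  constructor <;> nlinarith [sq_nonneg z.2]

/-- Gaussians focused at a height `T` outside of the strip. -/
lemma HasSmoothType.horStrip_focus {x y : ℝ} (hx : 0 ≤ x) (hx' : x ≤ 1) (hy : 0 ≤ y)
    (h : HasSmoothType horStrip x y) : ∃ C : ℝ, ∀ l T : ℝ, 0 < l → l ≤ 1 → 1 ≤ T →
      (10 * T ^ 2) ^ (-1 / 4 : ℝ) * (2 * (l ^ (-1 / 2 : ℝ) * T)) ^ y ≤ C * l ^ (-x / 2) := by
  obtain ⟨C, hC⟩ := h.gaussian_test hx hx' hy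
  refine ⟨C, fun l T hl hl' hT => ?_⟩
  have hT0 : 0 < T := by linarith
  -- Since |z₂| ≤ 1/2 ≤ T/2, the height z₂ + T lies between T/2 and 3T/2. This gives l z₁² ≤ T² ≤
  -- 4(z₂ + T)² and l² + 4(z₂ + T)² ≤ 1 + 9T² ≤ 10T².
  refine hC l T _ _ (Set.Icc (-(l ^ (-1 / 2 : ℝ) * T)) (l ^ (-1 / 2 : ℝ) * T) ×ˢ
    Set.Icc (-(1 / 2)) (1 / 2)) hl
    (by positivity) (measurableSet_box _ _ _)
    (ofReal_le_horStrip_box (by positivity) le_rfl le_rfl (le_of_eq (by ring))) fun z hz => ?_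
  have h1 := sq_le_of_mem_box hz
  have h3 : l * (l ^ (-1 / 2 : ℝ) * T) ^ 2 = T ^ 2 := by
    have : (l ^ (-1 / 2 : ℝ)) ^ 2 = l⁻¹ := by
      rw [← Real.rpow_natCast, ← Real.rpow_mul hl.le, ← Real.rpow_neg_one]; norm_num
    rw [mul_pow, this]
    field_simp
  have h4 : l * z.1 ^ 2 ≤ T ^ 2 := by
    rw [← h3]; gcongr
  have h5 := hz.2.1
  have h6 := hz.2.2
  constructor
  · nlinarith
  · nlinarith

/-- Dispersion: for l = 1 and focus at distance T → ∞, the extension has size T^(-1/2) on a width T.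
-/
lemma HasSmoothType.horStrip_le_half {x y : ℝ} (hx : 0 ≤ x) (hx' : x ≤ 1) (hy : 0 ≤ y)
    (h : HasSmoothType horStrip x y) : y ≤ 1 / 2 := by
  obtain ⟨C, hC⟩ := h.horStrip_focus hx hx' hy
  have := exponent_le_of_scaling_atTop (C := C) (m := 10) (v := 2) (k := 2) (s := 1) (y := y)
    (e := 0) (L := 1) (by norm_num) (by norm_num) fun l hl hl0 => ?_
  · linarith
  · simpa using hC 1 l one_pos le_rfl hl

/-- With T = 1 fixed and l → 0, the extension has size about 1 on a width l^(-1/2), the width of the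
Gaussian itself. -/
lemma HasSmoothType.horStrip_le {x y : ℝ} (hx : 0 ≤ x) (hx' : x ≤ 1) (hy : 0 ≤ y)
    (h : HasSmoothType horStrip x y) : y ≤ x := by
  obtain ⟨C, hC⟩ := h.horStrip_focus hx hx' hy
  have := exponent_le_of_scaling_zero (C := C) (m := 10) (v := 2) (k := 0) (s := -1 / 2) (y := y)
    (e := -x / 2) (L := 1) (by norm_num) (by norm_num) one_pos fun l hl hl0 => ?_
  · linarith
  · simpa using hC l 1 hl hl0 le_rfl

lemma HasSmoothType.horLine_one_le {x y : ℝ} (hx : 0 ≤ x) (hx' : x ≤ 1) (hy : 0 ≤ y)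
    (h : HasSmoothType horLine x y) : 1 ≤ x + y := by
  obtain ⟨C, hC⟩ := h.gaussian_test hx hx' hy
  have := exponent_le_of_scaling_zero (C := C) (m := 1) (v := 2) (k := 2) (s := 1 / 2) (y := y)
    (e := -x / 2) (L := 1) (by norm_num) (by norm_num) (by norm_num) fun l hl hl' => ?_
  · linarith
  refine hC l 0 _ _ (Set.Icc (-l ^ (1 / 2 : ℝ)) (l ^ (1 / 2 : ℝ)) ×ˢ Set.Icc 0 0) hl
    (by positivity) (measurableSet_box _ _ _) ?_ fun z hz => ?_
  · rw [horLine, Measure.map_apply (by fun_prop) (measurableSet_box _ _ _)]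
    have : (fun a : ℝ => (a, (0 : ℝ))) ⁻¹'
        (Set.Icc (-l ^ (1 / 2 : ℝ)) (l ^ (1 / 2 : ℝ)) ×ˢ Set.Icc 0 0) =
        Set.Icc (-l ^ (1 / 2 : ℝ)) (l ^ (1 / 2 : ℝ)) := by ext a; simp
    rw [this, Real.volume_Icc]
    exact ENNReal.ofReal_le_ofReal (by linarith)
  · have h1 := sq_le_of_mem_box hz
    rw [rpow_half_sq hl] at h1
    have h2 : z.2 = 0 := le_antisymm hz.2.2 hz.2.1
    rw [Real.rpow_ofNat, add_zero, h2]
    constructor <;> nlinarith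

lemma HasSmoothType.vertLine_one_le {x y : ℝ} (hx : 0 ≤ x) (hx' : x ≤ 1) (hy : 0 ≤ y)
    (h : HasSmoothType _root_.vertLine x y) : 1 ≤ x + 2 * y := by
  obtain ⟨C, hC⟩ := h.gaussian_test hx hx' hy
  have := exponent_le_of_scaling_zero (C := C) (m := 5) (v := 2) (k := 2) (s := 1) (y := y)
    (e := -x / 2) (L := 1) (by norm_num) (by norm_num) (by norm_num) fun l hl hl' => ?_
  · linarith
  refine hC l 0 _ _ (Set.Icc (-0) 0 ×ˢ Set.Icc (-l) l) hl
    (by positivity) (measurableSet_box _ _ _) ?_ fun z hz => ?_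
  · rw [_root_.vertLine, Measure.map_apply (by fun_prop) (measurableSet_box _ _ _)]
    have : (fun b : ℝ => ((0 : ℝ), b)) ⁻¹' (Set.Icc (-0) 0 ×ˢ Set.Icc (-l) l) =
        Set.Icc (-l) l := by ext a; simp
    rw [this, Real.volume_Icc, Real.rpow_one]
    exact ENNReal.ofReal_le_ofReal (by linarith)
  · have h1 := sq_le_of_mem_box hz
    have h2 : z.2 ^ 2 ≤ l ^ 2 := sq_le_sq' hz.2.1 hz.2.2
    rw [Real.rpow_ofNat, add_zero]
    constructor <;> nlinarith [sq_nonneg z.2]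

lemma HasSmoothType.vertStrip_one_le {x y : ℝ} (hx : 0 ≤ x) (hx' : x ≤ 1) (hy : 0 ≤ y)
    {R : ℝ} (hR : 0 < R) (h : HasSmoothType (_root_.vertStrip R) x y) : 1 ≤ x + 3 * y := by
  obtain ⟨C, hC⟩ := h.gaussian_test hx hx' hy
  have := exponent_le_of_scaling_zero (C := C) (m := 5) (v := 4) (k := 2) (s := 3 / 2) (y := y)
    (e := -x / 2) (L := R ^ 2) (by norm_num) (by norm_num) (by positivity) fun l hl hl' => ?_
  · linarith
  refine hC l 0 _ _ (Set.Icc (-l ^ (1 / 2 : ℝ)) (l ^ (1 / 2 : ℝ)) ×ˢ Set.Icc (-l) l) hl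
    (by positivity) (measurableSet_box _ _ _)
    (ofReal_le_vertStrip_box (by positivity) ?_ ?_) fun z hz => ?_
  · exact le_of_sq_le_sq (by rwa [rpow_half_sq hl]) hR.le
  · rw [show (3 / 2 : ℝ) = 1 / 2 + 1 by norm_num, Real.rpow_add hl, Real.rpow_one]
    exact le_of_eq (by ring)
  · have h1 := sq_le_of_mem_box hz
    rw [rpow_half_sq hl] at h1
    have h2 : z.2 ^ 2 ≤ l ^ 2 := sq_le_sq' hz.2.1 hz.2.2
    rw [Real.rpow_ofNat, add_zero]
    constructor <;> nlinarith [sq_nonneg z.2]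

lemma HasSmoothType.vertStrip_le_one {x y : ℝ} (hx : 0 ≤ x) (hx' : x ≤ 1) (hy : 0 ≤ y)
    {R : ℝ} (hR : 0 < R) (h : HasSmoothType (_root_.vertStrip R) x y) : x + 2 * y ≤ 1 := by
  obtain ⟨C, hC⟩ := h.gaussian_test hx hx' hy
  have := exponent_le_of_scaling_atTop (C := C) (m := 5) (v := 4 * R) (k := 2) (s := 1) (y := y)
    (e := -x / 2) (L := R ^ 2) (by norm_num) (by positivity) fun l hl hl0 => ?_
  · linarith
  refine hC l 0 _ _ (Set.Icc (-R) R ×ˢ Set.Icc (-l) l) hl0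
    (by positivity) (measurableSet_box _ _ _)
    (ofReal_le_vertStrip_box hR.le le_rfl ?_) fun z hz => ?_
  · rw [Real.rpow_one]
    exact le_of_eq (by ring)
  · have h1 := sq_le_of_mem_box hz
    have h2 : z.2 ^ 2 ≤ l ^ 2 := sq_le_sq' hz.2.1 hz.2.2
    rw [Real.rpow_ofNat, add_zero]
    constructor <;> nlinarith [sq_nonneg z.2]

/-- As l → 0, at heights of order l^(1/2) above the focus the Gaussian has just spread over the
width of the strip, and its size there is l^(-1/4). -/
lemma HasSmoothType.vertStrip_half_le {x y : ℝ} (hx : 0 ≤ x) (hx' : x ≤ 1) (hy : 0 ≤ y)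
    {R : ℝ} (hR : 0 < R) (h : HasSmoothType (_root_.vertStrip R) x y) : 1 / 2 ≤ x + y := by
  obtain ⟨C, hC⟩ := h.gaussian_test hx hx' hy
  have := exponent_le_of_scaling_zero (C := C) (m := 1 + 16 * R ^ 2) (v := 2 * R ^ 2) (k := 1)
    (s := 1 / 2) (y := y)
    (e := -x / 2) (L := 1) (by positivity) (by positivity) one_pos fun l hl hl' => ?_
  · linarith
  set r := l ^ (1 / 2 : ℝ) with hr
  have hr0 : 0 < r := by positivity
  have hr2 : r ^ 2 = l := rpow_half_sq hl
  refine hC l 0 _ _ (Set.Icc (-R) R ×ˢ Set.Icc (R * r) (2 * (R * r))) hl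
    (by positivity) (measurableSet_box _ _ _)
    (ofReal_le_vertStrip_box hR.le le_rfl (le_of_eq (by ring))) fun z hz => ?_
  have h1 := sq_le_of_mem_box hz
  have h2 : (R * r) ^ 2 ≤ z.2 ^ 2 := pow_le_pow_left₀ (by positivity) hz.2.1 2
  have h3 : z.2 ^ 2 ≤ (2 * (R * r)) ^ 2 :=
    pow_le_pow_left₀ ((by positivity : 0 ≤ R * r).trans hz.2.1) hz.2.2 2
  rw [mul_pow, hr2] at h2
  rw [mul_pow, mul_pow, hr2] at h3
  rw [Real.rpow_one, add_zero]
  constructor <;> nlinarith [sq_nonneg z.2]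

end

/-! ### Logarithmic failure at (1/4, 1/4) for vertical strips -/

noncomputable section

lemma sum_mul_measure_le_lintegral {β ι : Type*} [MeasurableSpace β] {ν : Measure β}
    {f : β → ℝ≥0∞} (K : Finset ι) (S : ι → Set β) (m : ι → ℝ≥0∞)
    (hS : ∀ k ∈ K, MeasurableSet (S k)) (hd : (K : Set ι).PairwiseDisjoint S)
    (hm : ∀ k ∈ K, ∀ z ∈ S k, m k ≤ f z) : ∑ k ∈ K, m k * ν (S k) ≤ ∫⁻ z, f z ∂ν := by
  calc ∑ k ∈ K, m k * ν (S k) ≤ ∑ k ∈ K, ∫⁻ z in S k, f z ∂ν := by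
        refine Finset.sum_le_sum fun k hk => ?_
        rw [← setLIntegral_const]
        exact setLIntegral_mono' (hS k hk) (hm k hk)
    _ = ∫⁻ z in ⋃ k ∈ K, S k, f z ∂ν := (lintegral_biUnion_finset hd hS f).symm
    _ ≤ _ := setLIntegral_le_lintegral _ _

/-- For l = u² with u = 2^(-n), the box of width 2^(-k) and heights about u·2^(-k) has area of order
u·4^(-k), and |Eg|⁴ is of order (u·2^(-k))^(-2) on it. Each of the n disjoint boxes contributes
about 1/u to the integral of |Eg|⁴, whereas the estimate allows only C⁴ l^(-1/2) = C⁴/u in total. -/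
lemma not_hasSmoothType_vertStrip_quarter {R : ℝ} (hR : 0 < R) :
    ¬HasSmoothType (vertStrip R) (1 / 4) (1 / 4) := by
  rintro ⟨C, hC⟩
  set r := min R 1 with hr
  have hr0 : 0 < r := lt_min hR one_pos
  have hr1 : r ≤ 1 := min_le_right _ _
  have hrR : r ≤ R := min_le_left _ _
  set c := Real.exp (-4 * Real.pi) * (2 * r) / 17 with hc
  have hc0 : 0 < c := by positivity
  have key : ∀ n : ℕ, n * c ≤ (C : ℝ) ^ 4 := by
    intro n
    set u : ℝ := (1 / 2) ^ n with hu
    have hu0 : 0 < u := by positivity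
    set l := u ^ 2 with hl
    have hl0 : 0 < l := by positivity
    have h1 := (hC _ (contDiff_gaussianFn l) (integrable_gaussianFn hl0)).trans
      (mul_le_mul' le_rfl (eLpNorm_gaussianFn_le hl0 (by norm_num : (0 : ℝ) ≤ 1 / 4) (by norm_num)))
    rw [eLpNorm_recipExp (by norm_num), ← ENNReal.le_rpow_inv_iff (by norm_num)] at h1
    set S : ℕ → Set (ℝ × ℝ) := fun k => Set.Icc (-(r * (1 / 2) ^ k)) (r * (1 / 2) ^ k) ×ˢ
      Set.Ico (u * (1 / 2) ^ k) (2 * (u * (1 / 2) ^ k)) with hS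
    have hvol : ∀ k, vertStrip R (S k) = ENNReal.ofReal (2 * r * u * ((1 / 2) ^ k) ^ 2) := by
      intro k
      have hw : ((1 / 2 : ℝ)) ^ k ≤ 1 := pow_le_one₀ (by norm_num) (by norm_num)
      have hsub : S k ⊆ {z : ℝ × ℝ | |z.1| ≤ R} := fun z hz =>
        (abs_le.2 hz.1).trans (by nlinarith)
      rw [vertStrip, Measure.restrict_eq_self _ hsub, Measure.volume_eq_prod, hS,
        Measure.prod_prod, Real.volume_Icc, Real.volume_Ico, ← ENNReal.ofReal_mul]
      · congr 1; ring
      · have : 0 < r * (1 / 2) ^ k := by positivity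
        linarith
    have hdisj : ((Finset.range n : Finset ℕ) : Set ℕ).PairwiseDisjoint S := by
      have key : ∀ {i j : ℕ}, i < j → Disjoint (S i) (S j) := by
        intro i j hij
        rw [Set.disjoint_left]
        intro z hzi hzj
        have h2 := hzi.2.1
        have h3 := hzj.2.2
        have h4 : ((1 / 2 : ℝ)) ^ j ≤ (1 / 2) ^ (i + 1) :=
          pow_le_pow_of_le_one (by norm_num) (by norm_num) hij
        rw [pow_succ] at h4
        nlinarith
      intro i _ j _ hij
      rcases lt_or_gt_of_ne hij with h | h
      · exact key h
      · exact (key h).symm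
    have h2 := (sum_mul_measure_le_lintegral (ν := vertStrip R)
      (f := fun z => ‖extOp (gaussianFn l) z‖ₑ ^ (1 / 4 : ℝ)⁻¹) (Finset.range n) S
      (fun k => ENNReal.ofReal (Real.exp (-4 * Real.pi) / (17 * (u * (1 / 2) ^ k) ^ 2)))
      (fun k _ => measurableSet_Icc.prod measurableSet_Ico) hdisj ?_).trans h1
    · have h3 : ∀ k, ENNReal.ofReal (Real.exp (-4 * Real.pi) / (17 * (u * (1 / 2) ^ k) ^ 2)) *
          vertStrip R (S k) = ENNReal.ofReal (c / u) := by
        intro k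
        rw [hvol, ← ENNReal.ofReal_mul (by positivity), hc]
        congr 1
        have : (0 : ℝ) < (1 / 2) ^ k := by positivity
        field_simp
      have h4 : ((C : ℝ≥0∞) * ENNReal.ofReal (l ^ (-(1 / 4) / 2 : ℝ))) ^ (1 / 4 : ℝ)⁻¹ =
          ENNReal.ofReal ((C : ℝ) ^ 4 / u) := by
        rw [show (1 / 4 : ℝ)⁻¹ = ((4 : ℕ) : ℝ) by norm_num, ENNReal.rpow_natCast,
          ← ENNReal.ofReal_coe_nnreal, ← ENNReal.ofReal_mul (by positivity),
          ← ENNReal.ofReal_pow (by positivity), mul_pow, ← Real.rpow_natCast (l ^ _),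
          ← Real.rpow_mul hl0.le, hl, ← Real.rpow_natCast u, ← Real.rpow_mul hu0.le]
        congr 1
        norm_num
        rw [Real.rpow_neg_one, div_eq_mul_inv]
      rw [h4, Finset.sum_congr rfl fun k _ => h3 k, Finset.sum_const, Finset.card_range,
        nsmul_eq_mul, ← ENNReal.ofReal_natCast, ← ENNReal.ofReal_mul (by positivity),
        ENNReal.ofReal_le_ofReal_iff (by positivity), ← mul_div_assoc,
        div_le_div_iff_of_pos_right hu0] at h2
      exact h2
    · intro k hk z hz
      have hkn : k < n := Finset.mem_range.1 hk
      set w : ℝ := (1 / 2) ^ k with hw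
      have hw0 : 0 < w := by positivity
      have hw1 : w ≤ 1 := pow_le_one₀ (by norm_num) (by norm_num)
      -- The restriction k < n enters here: it gives l = u² ≤ uw, so that the height, not l,
      -- determines the amplitude.
      have huw : u ≤ w := pow_le_pow_of_le_one (by norm_num) (by norm_num) hkn.le
      have hz1 : z.1 ^ 2 ≤ (r * w) ^ 2 := sq_le_sq' hz.1.1 hz.1.2
      have hz2 : (u * w) ^ 2 ≤ z.2 ^ 2 := pow_le_pow_left₀ (by positivity) hz.2.1 2
      have hz3 : z.2 ^ 2 ≤ (2 * (u * w)) ^ 2 :=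
        pow_le_pow_left₀ ((by positivity : 0 ≤ u * w).trans hz.2.1) hz.2.2.le 2
      have hD : 0 < l ^ 2 + 4 * z.2 ^ 2 := by positivity
      have h5 : l ^ 2 + 4 * z.2 ^ 2 ≤ 17 * (u * w) ^ 2 := by
        have h6 : l ≤ u * w := by rw [hl]; nlinarith
        have h7 : l ^ 2 ≤ (u * w) ^ 2 := pow_le_pow_left₀ hl0.le h6 2
        nlinarith
      have h8 : l * z.1 ^ 2 / (l ^ 2 + 4 * z.2 ^ 2) ≤ 1 := by
        rw [div_le_one hD]
        have h9 : (r * w) ^ 2 ≤ w ^ 2 := pow_le_pow_left₀ (by positivity) (by nlinarith) 2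
        have h10 : l * z.1 ^ 2 ≤ l * w ^ 2 :=
          mul_le_mul_of_nonneg_left (hz1.trans h9) hl0.le
        rw [hl] at h10 ⊢
        nlinarith [sq_nonneg z.2, sq_nonneg (u ^ 2)]
      rw [show (1 / 4 : ℝ)⁻¹ = ((4 : ℕ) : ℝ) by norm_num, ENNReal.rpow_natCast, ← ofReal_norm,
        norm_extOp_gaussianFn hl0, ← ENNReal.ofReal_pow (by positivity)]
      refine ENNReal.ofReal_le_ofReal ?_
      have h11 : ((l ^ 2 + 4 * z.2 ^ 2) ^ (-1 / 4 : ℝ)) ^ 4 = (l ^ 2 + 4 * z.2 ^ 2)⁻¹ := by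
        rw [← Real.rpow_natCast, ← Real.rpow_mul hD.le, ← Real.rpow_neg_one]; norm_num
      rw [mul_pow _ (Real.exp _), h11, ← Real.exp_nat_mul, div_eq_inv_mul]
      refine mul_le_mul ?_ (Real.exp_le_exp.2 ?_) (Real.exp_pos _).le (by positivity)
      · rw [inv_le_inv₀ (by positivity) hD]; exact h5
      · push_cast
        nlinarith [Real.pi_pos]
  obtain ⟨n, hn⟩ := exists_nat_gt ((C : ℝ) ^ 4 / c)
  rw [div_lt_iff₀ hc0] at hn
  linarith [key n]

end

/-! ### Random signs, square functions, and the unit bump -/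

noncomputable section

/-- The sign attached to a truth value. -/
def boolSign (b : Bool) : ℂ := if b then 1 else -1

lemma norm_boolSign (b : Bool) : ‖boolSign b‖ = 1 := by cases b <;> simp [boolSign]

lemma boolSign_not (b : Bool) : boolSign (!b) = -boolSign b := by cases b <;> simp [boolSign]

lemma conj_boolSign (b : Bool) : (starRingEnd ℂ) (boolSign b) = boolSign b := by
  cases b <;> simp [boolSign]

lemma boolSign_mul_self (b : Bool) : boolSign b * boolSign b = 1 := by cases b <;> simp [boolSign]

section Signs

variable {ι : Type*} [Fintype ι] [DecidableEq ι]

/-- For k ≠ l, flipping the k-th sign permutes the sign patterns and negates every term. -/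
lemma sum_boolSign_mul_boolSign (k l : ι) :
    ∑ ε : ι → Bool, boolSign (ε k) * boolSign (ε l) =
      if k = l then (Fintype.card (ι → Bool) : ℂ) else 0 := by
  split_ifs with h
  · subst h
    simp [boolSign_mul_self]
  · let σ : Equiv.Perm (ι → Bool) := Function.Involutive.toPerm
      (fun ε => Function.update ε k (!ε k)) fun ε => by simp
    have h1 := Equiv.sum_comp σ fun ε : ι → Bool => boolSign (ε k) * boolSign (ε l)
    have h2 : ∀ ε : ι → Bool, boolSign (σ ε k) * boolSign (σ ε l) =
        -(boolSign (ε k) * boolSign (ε l)) := by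
      intro ε
      have h3 : σ ε = Function.update ε k (!ε k) := rfl
      rw [h3, Function.update_self, Function.update_of_ne (Ne.symm h), boolSign_not, neg_mul]
    rw [Finset.sum_congr rfl fun ε _ => h2 ε, Finset.sum_neg_distrib] at h1
    exact self_eq_neg.1 h1.symm

lemma sum_norm_sq_boolSign (w : ι → ℂ) :
    ∑ ε : ι → Bool, ‖∑ k, boolSign (ε k) * w k‖ ^ 2 =
      Fintype.card (ι → Bool) * ∑ k, ‖w k‖ ^ 2 := by
  have h1 : ∀ v : ℂ, ((‖v‖ ^ 2 : ℝ) : ℂ) = v * (starRingEnd ℂ) v := fun v => by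
    rw [Complex.mul_conj, Complex.normSq_eq_norm_sq]
  rw [← Complex.ofReal_inj]
  push_cast
  have h2 : ∀ v : ℂ, ((‖v‖ : ℂ)) ^ 2 = v * (starRingEnd ℂ) v := fun v => by
    rw [← h1]; push_cast; rfl
  simp only [h2, map_sum, map_mul, conj_boolSign, Finset.sum_mul_sum]
  rw [Finset.sum_comm, Finset.mul_sum]
  refine Finset.sum_congr rfl fun k _ => ?_
  rw [Finset.sum_comm]
  have h3 : ∀ l, ∑ ε : ι → Bool, boolSign (ε k) * w k * (boolSign (ε l) * (starRingEnd ℂ) (w l)) =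
      (if k = l then (Fintype.card (ι → Bool) : ℂ) else 0) * (w k * (starRingEnd ℂ) (w l)) := by
    intro l
    rw [← sum_boolSign_mul_boolSign, Finset.sum_mul]
    exact Finset.sum_congr rfl fun ε _ => by ring
  rw [Finset.sum_congr rfl fun l _ => h3 l, Finset.sum_eq_single k]
  · simp
  · intro l _ hl
    rw [if_neg (Ne.symm hl), zero_mul]
  · simp

/-- The lower half of Khintchine's inequality for exponents at least two. -/
lemma card_mul_rpow_sum_le (w : ι → ℂ) {r : ℝ} (hr : 1 ≤ r) :
    (Fintype.card (ι → Bool) : ℝ≥0∞) * (∑ k, ‖w k‖ₑ ^ 2) ^ r ≤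
      ∑ ε : ι → Bool, ‖∑ k, boolSign (ε k) * w k‖ₑ ^ (2 * r) := by
  set N : ℝ≥0∞ := (Fintype.card (ι → Bool) : ℝ≥0∞) with hN
  have hN0 : N ≠ 0 := by rw [hN]; exact_mod_cast Fintype.card_ne_zero
  have hNt : N ≠ ∞ := ENNReal.natCast_ne_top _
  have h1 : ∑ ε : ι → Bool, ‖∑ k, boolSign (ε k) * w k‖ₑ ^ 2 = N * ∑ k, ‖w k‖ₑ ^ 2 := by
    have h2 := congrArg ENNReal.ofReal (sum_norm_sq_boolSign w)
    rw [ENNReal.ofReal_sum_of_nonneg fun _ _ => by positivity,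
      ENNReal.ofReal_mul (by positivity), ENNReal.ofReal_sum_of_nonneg fun _ _ => by positivity,
      ENNReal.ofReal_natCast] at h2
    simpa only [ENNReal.ofReal_pow (norm_nonneg _), ofReal_norm] using h2
  have h3 := ENNReal.rpow_sum_le_const_mul_sum_rpow (Finset.univ : Finset (ι → Bool))
    (fun ε => ‖∑ k, boolSign (ε k) * w k‖ₑ ^ 2) hr
  rw [h1, Finset.card_univ, ← hN, ENNReal.mul_rpow_of_nonneg _ _ (by linarith)] at h3
  have h4 : N ^ r = N ^ (r - 1) * N := by
    conv_rhs => rw [← ENNReal.rpow_one N, ← ENNReal.rpow_mul, one_mul, ← ENNReal.rpow_add _ _ hN0 hNt]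
    congr 1; ring
  rw [h4, mul_assoc] at h3
  have h5 : N ^ (r - 1) ≠ 0 := (ENNReal.rpow_pos (pos_iff_ne_zero.2 hN0) hNt).ne'
  have h6 : N ^ (r - 1) ≠ ∞ := ENNReal.rpow_ne_top_of_nonneg (by linarith) hNt
  have h7 := (ENNReal.mul_le_mul_iff_right h5 h6).1 h3
  refine h7.trans (le_of_eq (Finset.sum_congr rfl fun ε _ => ?_))
  rw [ENNReal.rpow_mul]
  congr 1
  exact (ENNReal.rpow_ofNat _ 2).symm

/-- Randomization: an estimate for the extension operator controls square functions. -/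
lemma lintegral_square_function_le {ν : Measure (ℝ × ℝ)} {x y : ℝ} {C : ℝ≥0} (hy : 0 < y)
    (hy' : y ≤ 1 / 2)
    (hC : ∀ g : ℝ → ℂ, ContDiff ℝ (⊤ : ℕ∞) g → Integrable g →
      eLpNorm (extOp g) (recipExp y) ν ≤ C * eLpNorm g (recipExp x))
    (g : ι → ℝ → ℂ) (hg : ∀ k, ContDiff ℝ (⊤ : ℕ∞) (g k)) (hgi : ∀ k, Integrable (g k))
    (hd : ∀ s k l, k ≠ l → g k s = 0 ∨ g l s = 0) :
    ∫⁻ z, (∑ k, ‖extOp (g k) z‖ₑ ^ 2) ^ (y⁻¹ / 2) ∂ν ≤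
      (C * eLpNorm (fun s => ∑ k, g k s) (recipExp x)) ^ y⁻¹ := by
  set N : ℝ≥0∞ := (Fintype.card (ι → Bool) : ℝ≥0∞) with hN
  have hN0 : N ≠ 0 := by rw [hN]; exact_mod_cast Fintype.card_ne_zero
  have hNt : N ≠ ∞ := ENNReal.natCast_ne_top _
  have hr : 1 ≤ y⁻¹ / 2 := by
    rw [le_div_iff₀ (by norm_num), one_mul, le_inv_comm₀ (by norm_num) hy]
    linarith
  have hm : ∀ k, Measurable (extOp (g k)) := fun k => measurable_extOp (hgi k).1
  have hsum : ∀ (ε : ι → Bool) z, extOp (fun s => ∑ k, boolSign (ε k) * g k s) z =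
      ∑ k, boolSign (ε k) * extOp (g k) z := by
    intro ε z
    have h1 := boundedKernel_parabolaKernel.kernelOp_sum (μ := volume) Finset.univ
      (g := fun k s => boolSign (ε k) * g k s) fun k _ => (hgi k).const_mul _
    rw [extOp, h1, Finset.sum_apply]
    exact Finset.sum_congr rfl fun k _ => by rw [kernelOp_const_mul]; rfl
  -- The pieces never overlap, so signs do not affect the modulus of their sum.
  have hnorm : ∀ ε : ι → Bool, eLpNorm (fun s => ∑ k, boolSign (ε k) * g k s) (recipExp x) volume =
      eLpNorm (fun s => ∑ k, g k s) (recipExp x) volume := by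
    intro ε
    refine eLpNorm_congr_norm_ae (Filter.Eventually.of_forall fun s => ?_)
    by_cases h : ∃ k, g k s ≠ 0
    · obtain ⟨k, hk⟩ := h
      have h0 : ∀ l, l ≠ k → g l s = 0 := fun l hl => (hd s l k hl).resolve_right hk
      rw [Finset.sum_eq_single k (fun l _ hl => by rw [h0 l hl, mul_zero]) (by simp),
        Finset.sum_eq_single k (fun l _ hl => h0 l hl) (by simp), norm_mul, norm_boolSign, one_mul]
    · push Not at h
      simp [h]
  set B : ℝ≥0∞ := (C * eLpNorm (fun s => ∑ k, g k s) (recipExp x)) ^ y⁻¹ with hB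
  have h1 : ∀ ε : ι → Bool, ∫⁻ z, ‖∑ k, boolSign (ε k) * extOp (g k) z‖ₑ ^ y⁻¹ ∂ν ≤
      B := by
    intro ε
    have h2 := hC (fun s => ∑ k, boolSign (ε k) * g k s)
      (ContDiff.sum fun k _ => contDiff_const.mul (hg k))
      (integrable_finsetSum _ fun k _ => (hgi k).const_mul _)
    rw [hnorm, eLpNorm_recipExp hy, ← ENNReal.le_rpow_inv_iff hy] at h2
    simp only [hsum] at h2
    exact h2
  have h3 : N * ∫⁻ z, (∑ k, ‖extOp (g k) z‖ₑ ^ 2) ^ (y⁻¹ / 2) ∂ν ≤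
      N * B := by
    calc _ = ∫⁻ z, N * (∑ k, ‖extOp (g k) z‖ₑ ^ 2) ^ (y⁻¹ / 2) ∂ν := by
          rw [lintegral_const_mul]
          exact (Finset.measurable_sum _ fun k _ => (hm k).enorm.pow_const 2).pow_const _
      _ ≤ ∫⁻ z, ∑ ε : ι → Bool, ‖∑ k, boolSign (ε k) * extOp (g k) z‖ₑ ^ y⁻¹ ∂ν := by
          refine lintegral_mono fun z => ?_
          have := card_mul_rpow_sum_le (fun k => extOp (g k) z) hr
          rwa [show 2 * (y⁻¹ / 2) = y⁻¹ by ring] at this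
      _ = ∑ ε : ι → Bool, ∫⁻ z, ‖∑ k, boolSign (ε k) * extOp (g k) z‖ₑ ^ y⁻¹ ∂ν := by
          rw [lintegral_finsetSum]
          intro ε _
          exact (Finset.measurable_sum _ fun k _ => (hm k).const_mul _).enorm.pow_const _
      _ ≤ ∑ _ε : ι → Bool, B :=
          Finset.sum_le_sum (f := fun ε : ι → Bool =>
            ∫⁻ z, ‖∑ k, boolSign (ε k) * extOp (g k) z‖ₑ ^ y⁻¹ ∂ν) fun ε _ => h1 ε
      _ = N * B := by
          rw [Finset.sum_const, Finset.card_univ, nsmul_eq_mul]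
  exact (ENNReal.mul_le_mul_iff_right hN0 hNt).1 h3

end Signs

/-- A smooth bump with values in `[0, 1]`, supported in the open unit interval. -/
def unitBump (s : ℝ) : ℂ :=
  (((⟨1 / 4, 1 / 2, by norm_num, by norm_num⟩ : ContDiffBump (1 / 2 : ℝ)) s : ℝ) : ℂ)

lemma contDiff_unitBump : ContDiff ℝ (⊤ : ℕ∞) unitBump :=
  Complex.ofRealCLM.contDiff.comp (ContDiffBump.contDiff _)

lemma unitBump_eq_zero {s : ℝ} (hs : s ∉ Set.Ioo (0 : ℝ) 1) : unitBump s = 0 := by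
  have h1 : s ∉ Metric.ball (1 / 2 : ℝ) (1 / 2) := by
    rw [Real.ball_eq_Ioo]; norm_num; simpa using hs
  rw [unitBump, Complex.ofReal_eq_zero, ← Function.notMem_support, ContDiffBump.support_eq]
  exact h1

lemma norm_unitBump_le (s : ℝ) : ‖unitBump s‖ ≤ 1 := by
  rw [unitBump, Complex.norm_of_nonneg (ContDiffBump.nonneg _)]
  exact ContDiffBump.le_one _

lemma integrable_unitBump : Integrable unitBump :=
  contDiff_unitBump.continuous.integrable_of_hasCompactSupport
    ((ContDiffBump.hasCompactSupport _).comp_left (g := fun r : ℝ => (r : ℂ)) rfl)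

lemma continuous_extOp {g : ℝ → ℂ} (hg : Integrable g) : Continuous (extOp g) := by
  refine continuous_of_dominated (bound := fun s => ‖g s‖)
    (fun z => (integrable_modulate hg z).1) (fun z => Filter.Eventually.of_forall fun s => ?_)
    hg.norm (Filter.Eventually.of_forall fun s => ?_)
  · rw [norm_mul, norm_parabolaKernel, one_mul]
  · unfold parabolaKernel
    fun_prop

/-- At the origin the extension equals the positive integral of the bump, and it is continuous. The
bound δ ≤ 1/2 keeps the Kakeya tubes inside the horizontal strip. -/
lemma exists_le_norm_extOp_unitBump : ∃ c δ : ℝ, 0 < c ∧ 0 < δ ∧ δ ≤ 1 / 2 ∧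
    ∀ z : ℝ × ℝ, |z.1| ≤ δ → |z.2| ≤ δ → c ≤ ‖extOp unitBump z‖ := by
  have h0 : extOp unitBump 0 ≠ 0 := by
    have h1 : extOp unitBump 0 = ((∫ s, (⟨1 / 4, 1 / 2, by norm_num, by norm_num⟩ :
        ContDiffBump (1 / 2 : ℝ)) s : ℝ) : ℂ) := by
      rw [extOp, kernelOp, ← integral_complex_ofReal]
      congr 1
      funext s
      simp [parabolaKernel, unitBump]
    rw [h1]
    exact_mod_cast (ContDiffBump.integral_pos _).ne'
  have h2 := (continuous_extOp integrable_unitBump).norm.continuousAt (x := 0)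
  have h3 := norm_pos_iff.2 h0
  have h4 := h2.eventually (lt_mem_nhds (half_lt_self h3))
  obtain ⟨δ, hδ, hball⟩ := Metric.eventually_nhds_iff.1 h4
  refine ⟨‖extOp unitBump 0‖ / 2, min (δ / 2) (1 / 2), by positivity, by positivity,
    min_le_right _ _, fun z hz1 hz2 => (hball ?_).le⟩
  rw [dist_zero_right, Prod.norm_def, max_lt_iff]
  have := min_le_left (δ / 2) (1 / 2)
  simp only [Real.norm_eq_abs]
  constructor <;> linarith

end

/-! ### Randomized dilates: p ≤ q on the line x + 2y = 1 for vertical strips -/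

noncomputable section

lemma extOp_comp_mul (g : ℝ → ℂ) {t : ℝ} (ht : 0 < t) (z : ℝ × ℝ) :
    extOp (fun s => g (t * s)) z = (t : ℂ)⁻¹ * extOp g (z.1 / t, z.2 / t ^ 2) := by
  have h1 := Measure.integral_comp_mul_left
    (fun s => parabolaKernel (z.1 / t, z.2 / t ^ 2) s * g s) t
  rw [extOp, kernelOp, extOp, kernelOp]
  rw [abs_of_pos (inv_pos.2 ht), Complex.real_smul] at h1
  push_cast at h1
  rw [← h1]
  congr 1
  funext s
  congr 1
  rw [parabolaKernel, parabolaKernel]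
  congr 3
  simp only
  field_simp

lemma norm_extOp_comp_sub (g : ℝ → ℂ) (k : ℝ) (z : ℝ × ℝ) :
    ‖extOp (fun s => g (s - k)) z‖ = ‖extOp g (z.1 + 2 * k * z.2, z.2)‖ := by
  rw [← norm_extOp_shift g (-k)]
  simp only [sub_eq_add_neg]
  congr 2
  ext <;> simp

lemma exponent_le_of_natCast_rpow_le {C α β : ℝ}
    (h : ∀ n : ℕ, 0 < n → (n : ℝ) ^ α ≤ C * (n : ℝ) ^ β) : α ≤ β := by
  by_contra hlt
  push Not at hlt
  have h1 := (tendsto_rpow_atTop (sub_pos.2 hlt)).comp (tendsto_natCast_atTop_atTop (R := ℝ))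
  obtain ⟨n, hn1, hn2⟩ := ((h1.eventually_gt_atTop C).and (Filter.eventually_gt_atTop 0)).exists
  have h2 := h n hn2
  have hn3 : (0 : ℝ) < n := by exact_mod_cast hn2
  simp only [Function.comp] at hn1
  rw [Real.rpow_sub hn3, lt_div_iff₀ (Real.rpow_pos_of_pos hn3 _)] at hn1
  linarith

/-- The normalized dilates of a bump on `[1, 2]`. -/
def dilatedBump (x : ℝ) (j : ℕ) (s : ℝ) : ℂ :=
  (((2 : ℝ) ^ j) ^ x : ℝ) * unitBump (2 ^ j * s - 1)

lemma contDiff_dilatedBump (x : ℝ) (j : ℕ) : ContDiff ℝ (⊤ : ℕ∞) (dilatedBump x j) :=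
  contDiff_const.mul (contDiff_unitBump.comp (by fun_prop))

lemma integrable_dilatedBump (x : ℝ) (j : ℕ) : Integrable (dilatedBump x j) := by
  have h1 := (integrable_unitBump.comp_sub_right 1).comp_mul_left' (R := (2 : ℝ) ^ j) (by positivity)
  exact h1.const_mul _

lemma mem_Ioo_of_dilatedBump_ne_zero {x : ℝ} {j : ℕ} {s : ℝ} (h : dilatedBump x j s ≠ 0) :
    2 ^ j * s ∈ Set.Ioo (1 : ℝ) 2 := by
  by_contra hs
  refine h ?_
  rw [dilatedBump, unitBump_eq_zero, mul_zero]
  intro h1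
  refine hs ⟨?_, ?_⟩ <;> linarith [h1.1, h1.2]

lemma dilatedBump_eq_zero_or {x : ℝ} (s : ℝ) {j k : ℕ} (hjk : j ≠ k) :
    dilatedBump x j s = 0 ∨ dilatedBump x k s = 0 := by
  by_contra! h
  have key : ∀ {j k : ℕ}, j < k → dilatedBump x j s ≠ 0 → dilatedBump x k s ≠ 0 → False := by
    intro j k hjk hj hk
    have h1 := mem_Ioo_of_dilatedBump_ne_zero hj
    have h2 := mem_Ioo_of_dilatedBump_ne_zero hk
    have h3 : (2 : ℝ) ^ (j + 1) ≤ 2 ^ k := pow_le_pow_right₀ (by norm_num) hjk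
    rw [pow_succ] at h3
    have hs : 0 < s := by
      have h4 : (0 : ℝ) < 2 ^ j := by positivity
      by_contra! hs
      nlinarith [h1.1]
    nlinarith [h1.1, h2.2]
  rcases lt_or_gt_of_ne hjk with h1 | h1
  · exact key h1 h.1 h.2
  · exact key h1 h.2 h.1

lemma norm_dilatedBump_le (x : ℝ) (j : ℕ) (s : ℝ) : ‖dilatedBump x j s‖ ≤ ((2 : ℝ) ^ j) ^ x := by
  rw [dilatedBump, norm_mul, Complex.norm_of_nonneg (by positivity)]
  exact mul_le_of_le_one_right (by positivity) (norm_unitBump_le _)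

/-- The J dilates have disjoint supports and L^p norm at most one each. -/
lemma eLpNorm_sum_dilatedBump_le {x : ℝ} (hx : 0 ≤ x) (J : ℕ) :
    eLpNorm (fun s => ∑ j : Fin J, dilatedBump x j s) (recipExp x) volume ≤ (J : ℝ≥0∞) ^ x := by
  have hpt : ∀ s, (∑ j : Fin J, dilatedBump x j s) = 0 ∨ ∃ j : Fin J,
      (∑ j : Fin J, dilatedBump x j s) = dilatedBump x j s ∧ dilatedBump x j s ≠ 0 := by
    intro s
    by_cases h : ∃ j : Fin J, dilatedBump x j s ≠ 0
    · obtain ⟨j, hj⟩ := h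
      refine Or.inr ⟨j, Finset.sum_eq_single j (fun k _ hk => ?_) (by simp), hj⟩
      exact (dilatedBump_eq_zero_or s (fun h => hk (Fin.ext h))).resolve_right hj
    · push Not at h
      exact Or.inl (Finset.sum_eq_zero fun j _ => h j)
  rcases hx.eq_or_lt with rfl | hx
  · rw [recipExp_zero, eLpNorm_exponent_top, ENNReal.rpow_zero]
    refine eLpNormEssSup_le_of_ae_enorm_bound (Filter.Eventually.of_forall fun s => ?_)
    rcases hpt s with h | ⟨j, h, -⟩
    · rw [h]; simp
    · rw [h, ← ofReal_norm, ENNReal.ofReal_le_one]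
      simpa using norm_dilatedBump_le 0 j s
  · rw [eLpNorm_recipExp hx]
    refine ENNReal.rpow_le_rpow ?_ hx.le
    calc ∫⁻ s, ‖∑ j : Fin J, dilatedBump x j s‖ₑ ^ x⁻¹
        ≤ ∫⁻ s, ∑ j : Fin J, (Set.Icc (((2 : ℝ) ^ (j : ℕ))⁻¹) (2 * ((2 : ℝ) ^ (j : ℕ))⁻¹)).indicator
            (fun _ => ENNReal.ofReal (2 ^ (j : ℕ))) s := by
          refine lintegral_mono fun s => ?_
          rcases hpt s with h | ⟨j, h, h0⟩
          · rw [h, enorm_zero, ENNReal.zero_rpow_of_pos (by positivity)]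
            exact zero_le
          · rw [h]
            refine le_trans ?_ (Finset.single_le_sum (fun _ _ => zero_le) (Finset.mem_univ j))
            have h1 := mem_Ioo_of_dilatedBump_ne_zero h0
            have h2 : (0 : ℝ) < 2 ^ (j : ℕ) := by positivity
            rw [Set.indicator_of_mem]
            · rw [← ofReal_norm, ENNReal.ofReal_rpow_of_nonneg (norm_nonneg _) (by positivity)]
              refine ENNReal.ofReal_le_ofReal ?_
              refine (Real.rpow_le_rpow (norm_nonneg _) (norm_dilatedBump_le x j s)
                (by positivity)).trans (le_of_eq ?_)
              rw [← Real.rpow_mul h2.le, mul_inv_cancel₀ hx.ne', Real.rpow_one]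
            · constructor
              · rw [inv_le_iff_one_le_mul₀' h2]; exact h1.1.le
              · rw [← div_eq_mul_inv, le_div_iff₀ h2]; linarith [h1.2]
      _ = ∑ _j : Fin J, (1 : ℝ≥0∞) := by
          rw [lintegral_finsetSum _ fun j _ => measurable_const.indicator measurableSet_Icc]
          refine Finset.sum_congr rfl fun j _ => ?_
          have h2 : (0 : ℝ) < 2 ^ (j : ℕ) := by positivity
          rw [lintegral_indicator_const measurableSet_Icc, Real.volume_Icc,
            ← ENNReal.ofReal_mul h2.le, two_mul, add_sub_cancel_right, mul_inv_cancel₀ h2.ne',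
            ENNReal.ofReal_one]
      _ = J := by simp

/-- On the critical line, the strip estimate in the other directions forces `p ≤ q`. -/
lemma HasSmoothType.vertStrip_le_of_eq {R x y : ℝ} (hR : 0 < R) (hx : 0 ≤ x)
    (hxy : x + 2 * y = 1) (h : HasSmoothType (_root_.vertStrip R) x y) : y ≤ x := by
  by_contra! hlt
  have hy : 0 < y := by linarith
  obtain ⟨C, hC⟩ := h
  obtain ⟨c, δ, hc, hδ, -, hcδ⟩ := exists_le_norm_extOp_unitBump
  set ρ := min R (δ / 2) with hρ
  have hρ0 : 0 < ρ := lt_min hR (by linarith)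
  set κ := c ^ y⁻¹ * (2 * ρ * (3 / 16 * δ)) with hκ
  have hκ0 : 0 < κ := by positivity
  -- Parabolic scaling: with t = 2^j the j-th extension has size at least c t^(x-1) = c t^(-2y) up
  -- to heights of order t², uniformly in the width δ/2.
  have hlow : ∀ (j : ℕ) (z : ℝ × ℝ), |z.1| ≤ δ / 2 → |z.2| ≤ δ / 4 * (2 ^ j) ^ 2 →
      c * ((2 : ℝ) ^ j) ^ (-(2 * y)) ≤ ‖extOp (dilatedBump x j) z‖ := by
    intro j z hz1 hz2
    set t : ℝ := 2 ^ j with ht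
    have ht0 : 0 < t := by positivity
    have ht1 : 1 ≤ t := one_le_pow₀ (by norm_num)
    have h1 : extOp (dilatedBump x j) z = ((t ^ x : ℝ) : ℂ) *
        ((t : ℂ)⁻¹ * extOp (fun s => unitBump (s - 1)) (z.1 / t, z.2 / t ^ 2)) := by
      rw [← extOp_comp_mul _ ht0]
      exact congrFun (kernelOp_const_mul (K := parabolaKernel) (μ := volume) ((t ^ x : ℝ) : ℂ)
        (fun s => unitBump (t * s - 1))) z
    have hb : |z.2 / t ^ 2| ≤ δ / 4 := by
      rw [abs_div, abs_of_pos (by positivity : 0 < t ^ 2), div_le_iff₀ (by positivity)]; exact hz2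
    have ha : |z.1 / t| ≤ δ / 2 := by
      rw [abs_div, abs_of_pos ht0, div_le_iff₀ ht0]; nlinarith
    have h2 : c ≤ ‖extOp (fun s => unitBump (s - 1)) (z.1 / t, z.2 / t ^ 2)‖ := by
      rw [norm_extOp_comp_sub]
      refine hcδ _ ?_ (by simp only; linarith)
      simp only
      refine (abs_add_le _ _).trans ?_
      rw [abs_mul, mul_one, abs_two]
      linarith
    rw [h1, norm_mul, norm_mul, Complex.norm_of_nonneg (by positivity), norm_inv,
      Complex.norm_of_nonneg ht0.le]
    calc c * t ^ (-(2 * y)) = t ^ x * (t⁻¹ * c) := by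
          rw [show -(2 * y) = x - 1 by linarith, Real.rpow_sub ht0, Real.rpow_one]; ring
      _ ≤ _ := by gcongr
  have key : ∀ J : ℕ, 0 < J → (J : ℝ) ^ y ≤ (C / κ ^ y) * (J : ℝ) ^ x := by
    intro J hJ
    have h1 := lintegral_square_function_le hy (by linarith) hC
      (fun j : Fin J => dilatedBump x j) (fun j => contDiff_dilatedBump x j)
      (fun j => integrable_dilatedBump x j)
      (fun s k l hkl => dilatedBump_eq_zero_or s fun h => hkl (Fin.ext h))
    -- Disjoint boxes at heights about 4^j. There |E|^q is at least a multiple of 4^(-j), so each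
    -- box contributes the same amount `κ`; together they give J^y ≤ C' J^x.
    set S : Fin J → Set (ℝ × ℝ) := fun j => Set.Icc (-ρ) ρ ×ˢ
      Set.Ioc (δ / 16 * (2 ^ (j : ℕ)) ^ 2) (δ / 4 * (2 ^ (j : ℕ)) ^ 2) with hS
    have hvol : ∀ j, _root_.vertStrip R (S j) =
        ENNReal.ofReal (2 * ρ * (3 / 16 * δ) * (2 ^ (j : ℕ)) ^ 2) := by
      intro j
      have hsub : S j ⊆ {z : ℝ × ℝ | |z.1| ≤ R} := fun z hz =>
        (abs_le.2 hz.1).trans (min_le_left _ _)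
      rw [_root_.vertStrip, Measure.restrict_eq_self _ hsub, Measure.volume_eq_prod, hS,
        Measure.prod_prod, Real.volume_Icc, Real.volume_Ioc, ← ENNReal.ofReal_mul (by linarith)]
      congr 1; ring
    have hdisj : ((Finset.univ : Finset (Fin J)) : Set (Fin J)).PairwiseDisjoint S := by
      have key : ∀ {i j : Fin J}, i < j → Disjoint (S i) (S j) := by
        intro i j hij
        rw [Set.disjoint_left]
        intro z hzi hzj
        have h2 := hzi.2.2
        have h3 := hzj.2.1
        have h4 : (2 : ℝ) ^ ((i : ℕ) + 1) ≤ 2 ^ (j : ℕ) := pow_le_pow_right₀ (by norm_num) hij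
        rw [pow_succ] at h4
        have h5 : ((2 : ℝ) ^ (i : ℕ) * 2) ^ 2 ≤ (2 ^ (j : ℕ)) ^ 2 :=
          pow_le_pow_left₀ (by positivity) h4 2
        nlinarith
      intro i _ j _ hij
      rcases lt_or_gt_of_ne hij with h | h
      · exact key h
      · exact (key h).symm
    have h2 := (sum_mul_measure_le_lintegral (ν := _root_.vertStrip R)
      (f := fun z => (∑ j : Fin J, ‖extOp (dilatedBump x j) z‖ₑ ^ 2) ^ (y⁻¹ / 2)) Finset.univ S
      (fun j => ENNReal.ofReal (c ^ y⁻¹ * ((2 ^ (j : ℕ)) ^ 2)⁻¹))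
      (fun j _ => measurableSet_Icc.prod measurableSet_Ioc) hdisj ?_).trans h1
    · have h3 : ∀ j : Fin J, ENNReal.ofReal (c ^ y⁻¹ * (((2 : ℝ) ^ (j : ℕ)) ^ 2)⁻¹) *
          _root_.vertStrip R (S j) = ENNReal.ofReal κ := by
        intro j
        rw [hvol, ← ENNReal.ofReal_mul (by positivity), hκ]
        congr 1
        field_simp
      rw [Finset.sum_congr rfl fun j _ => h3 j, Finset.sum_const, Finset.card_univ,
        Fintype.card_fin, nsmul_eq_mul, ENNReal.le_rpow_inv_iff hy] at h2
      have h4 := h2.trans (mul_le_mul' le_rfl (eLpNorm_sum_dilatedBump_le hx J))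
      have hJ' : (0 : ℝ) < J := by exact_mod_cast hJ
      rw [← ENNReal.ofReal_natCast, ← ENNReal.ofReal_mul hJ'.le,
        ENNReal.ofReal_rpow_of_pos (by positivity), ENNReal.ofReal_rpow_of_pos hJ',
        ← ENNReal.ofReal_coe_nnreal, ← ENNReal.ofReal_mul (NNReal.coe_nonneg C),
        ENNReal.ofReal_le_ofReal_iff (by positivity), Real.mul_rpow hJ'.le hκ0.le] at h4
      rw [div_mul_eq_mul_div, le_div_iff₀ (by positivity)]
      exact h4
    · intro j _ z hz
      have ht0 : (0 : ℝ) < 2 ^ (j : ℕ) := by positivity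
      have h5 := hlow j z ((abs_le.2 hz.1).trans (min_le_right _ _)) (by
        rw [abs_of_pos ((by positivity : 0 < δ / 16 * ((2 : ℝ) ^ (j : ℕ)) ^ 2).trans hz.2.1)]
        exact hz.2.2)
      calc ENNReal.ofReal (c ^ y⁻¹ * (((2 : ℝ) ^ (j : ℕ)) ^ 2)⁻¹)
          = ENNReal.ofReal (c * ((2 : ℝ) ^ (j : ℕ)) ^ (-(2 * y))) ^ y⁻¹ := by
            rw [ENNReal.ofReal_rpow_of_pos (by positivity), Real.mul_rpow hc.le (by positivity),
              ← Real.rpow_mul ht0.le, show -(2 * y) * y⁻¹ = -2 by field_simp, Real.rpow_neg ht0.le,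
              Real.rpow_ofNat]
        _ ≤ ‖extOp (dilatedBump x j) z‖ₑ ^ y⁻¹ := by
            rw [← ofReal_norm]
            exact ENNReal.rpow_le_rpow (ENNReal.ofReal_le_ofReal h5) (by positivity)
        _ = (‖extOp (dilatedBump x j) z‖ₑ ^ 2) ^ (y⁻¹ / 2) := by
            conv_lhs => rw [show y⁻¹ = 2 * (y⁻¹ / 2) by ring, ENNReal.rpow_mul]
            congr 1
            exact ENNReal.rpow_ofNat _ 2
        _ ≤ _ := by
            refine ENNReal.rpow_le_rpow ?_ (by positivity)
            exact Finset.single_le_sum (f := fun j : Fin J => ‖extOp (dilatedBump x j) z‖ₑ ^ 2)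
              (fun _ _ => zero_le) (Finset.mem_univ j)
  exact absurd (exponent_le_of_natCast_rpow_le key) (not_le.2 hlt)

end

/-! ### A Kakeya arrangement of tubes -/

noncomputable section

/-- The integer with binary digits `ε`. -/
def digitSum {n : ℕ} (ε : Fin n → Fin 2) : ℕ := (finFunctionFinEquiv ε : ℕ)

lemma digitSum_eq {n : ℕ} (ε : Fin n → Fin 2) :
    (digitSum ε : ℝ) = ∑ i, ((ε i : ℕ) : ℝ) * 2 ^ (i : ℕ) := by
  rw [digitSum, finFunctionFinEquiv_apply]
  push_cast
  rfl

lemma digitSum_lt {n : ℕ} (ε : Fin n → Fin 2) : digitSum ε < 2 ^ n := (finFunctionFinEquiv ε).2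

lemma digitSum_injective (n : ℕ) : Function.Injective (digitSum (n := n)) := fun _ _ h =>
  finFunctionFinEquiv.injective (Fin.ext h)

/-- The offset of the tube with direction `digitSum ε` in the Kakeya arrangement. -/
def tubeOffset {n : ℕ} (δ : ℝ) (ε : Fin n → Fin 2) : ℝ :=
  -∑ i, ((ε i : ℕ) : ℝ) * 2 ^ (i : ℕ) * (2 * (δ * i / n))

/-- The tubes of the Kakeya arrangement. -/
def kakeyaTube {n : ℕ} (δ : ℝ) (ε : Fin n → Fin 2) : Set (ℝ × ℝ) :=
  {z | |z.1 + tubeOffset δ ε + 2 * digitSum ε * z.2| ≤ δ ∧ z.2 ∈ Set.Ico 0 δ}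

lemma measurableSet_kakeyaTube {n : ℕ} (δ : ℝ) (ε : Fin n → Fin 2) :
    MeasurableSet (kakeyaTube δ ε) := by
  refine MeasurableSet.inter (measurableSet_le
    (f := fun z : ℝ × ℝ => |z.1 + tubeOffset δ ε + 2 * digitSum ε * z.2|) (by fun_prop)
    measurable_const) ?_
  exact measurable_snd measurableSet_Ico

/-- The i-th binary digit of the direction has no influence on the position at height δi/n: each
digit is focused at a height of its own. -/
lemma tubeOffset_add {n : ℕ} (δ : ℝ) (ε : Fin n → Fin 2) (b : ℝ) :
    tubeOffset δ ε + 2 * digitSum ε * b =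
      ∑ i, ((ε i : ℕ) : ℝ) * 2 ^ (i : ℕ) * (2 * (b - δ * i / n)) := by
  rw [tubeOffset, digitSum_eq, Finset.mul_sum, Finset.sum_mul, ← Finset.sum_neg_distrib,
    ← Finset.sum_add_distrib]
  exact Finset.sum_congr rfl fun i _ => by ring

lemma volume_eq_lintegral_slice {T : Set (ℝ × ℝ)} (hT : MeasurableSet T) :
    volume T = ∫⁻ b, volume ((fun a : ℝ => (a, b)) ⁻¹' T) := by
  rw [Measure.volume_eq_prod, Measure.prod_apply_symm hT]

lemma volume_kakeyaTube {n : ℕ} {δ : ℝ} (hδ : 0 < δ) (ε : Fin n → Fin 2) :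
    volume (kakeyaTube δ ε) = ENNReal.ofReal (2 * δ ^ 2) := by
  rw [volume_eq_lintegral_slice (measurableSet_kakeyaTube δ ε)]
  have h1 : ∀ b, volume ((fun a : ℝ => (a, b)) ⁻¹' kakeyaTube δ ε) =
      (Set.Ico 0 δ).indicator (fun _ => ENNReal.ofReal (2 * δ)) b := by
    intro b
    by_cases hb : b ∈ Set.Ico 0 δ
    · rw [Set.indicator_of_mem hb]
      have : (fun a : ℝ => (a, b)) ⁻¹' kakeyaTube δ ε =
          Set.Icc (-(tubeOffset δ ε + 2 * digitSum ε * b) - δ)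
            (-(tubeOffset δ ε + 2 * digitSum ε * b) + δ) := by
        ext a
        simp only [kakeyaTube, Set.mem_preimage, Set.mem_ofPred_eq, hb, and_true, abs_le,
          Set.mem_Icc]
        constructor <;> rintro ⟨h2, h3⟩ <;> constructor <;> linarith
      rw [this, Real.volume_Icc]
      congr 1; ring
    · rw [Set.indicator_of_notMem hb]
      have : (fun a : ℝ => (a, b)) ⁻¹' kakeyaTube δ ε = ∅ := by
        ext a
        simp only [kakeyaTube, Set.mem_preimage, Set.mem_ofPred_eq, hb, and_false,
          Set.mem_empty_iff_false]
      rw [this, measure_empty]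
  simp only [h1]
  rw [lintegral_indicator_const measurableSet_Ico, Real.volume_Ico,
    ← ENNReal.ofReal_mul (by linarith)]
  congr 1; ring

lemma sum_two_pow_mul (j : ℕ) :
    ∑ i ∈ Finset.range (j + 1), (2 : ℝ) ^ i * (j + 1 - i) = 2 ^ (j + 2) - j - 3 := by
  induction j with
  | zero => norm_num
  | succ j ih =>
    have h1 : ∑ i ∈ Finset.range (j + 1), (2 : ℝ) ^ i * ((j + 1 : ℕ) + 1 - i) =
        ∑ i ∈ Finset.range (j + 1), (2 : ℝ) ^ i * (j + 1 - i) +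
          ∑ i ∈ Finset.range (j + 1), (2 : ℝ) ^ i := by
      rw [← Finset.sum_add_distrib]
      exact Finset.sum_congr rfl fun i _ => by push_cast; ring
    rw [Finset.sum_range_succ, h1, ih, geom_sum_eq (by norm_num)]
    push_cast
    ring

/-- The low digits move the tubes only a little while the heights are close to their focus. -/
lemma sum_low_digits_mem {n : ℕ} (hn : 0 < n) {δ : ℝ} (hδ : 0 < δ) (ε : Fin n → Fin 2) (j : Fin n)
    {b : ℝ} (hb : b ∈ Set.Ico (δ * j / n) (δ * (j + 1) / n)) :
    ∑ i with i ≤ j, ((ε i : ℕ) : ℝ) * 2 ^ (i : ℕ) * (2 * (b - δ * i / n)) ∈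
      Set.Icc 0 (8 * δ * 2 ^ (j : ℕ) / n) := by
  have hn' : (0 : ℝ) < n := by exact_mod_cast hn
  have hε : ∀ i, ((ε i : ℕ) : ℝ) ≤ 1 := fun i => by
    exact_mod_cast Nat.lt_succ_iff.1 (ε i).2
  have hlow : ∀ i : Fin n, i ≤ j → 0 ≤ b - δ * i / n := by
    intro i hij
    have h1 : ((i : ℕ) : ℝ) ≤ (j : ℕ) := by exact_mod_cast hij
    have h2 : δ * i / n ≤ δ * j / n := by gcongr
    linarith [hb.1]
  constructor
  · refine Finset.sum_nonneg fun i hi => ?_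
    have := hlow i (Finset.mem_filter.1 hi).2
    positivity
  · calc _ ≤ ∑ i : Fin n with i ≤ j, (2 * δ / n) * (2 ^ (i : ℕ) * ((j : ℕ) + 1 - (i : ℕ) : ℝ)) := by
          refine Finset.sum_le_sum fun i hi => ?_
          have h0 := hlow i (Finset.mem_filter.1 hi).2
          have h3 : b - δ * i / n ≤ δ / n * ((j : ℕ) + 1 - (i : ℕ)) := by
            have h4 := hb.2.le
            have : δ / n * ((j : ℕ) + 1 - (i : ℕ) : ℝ) = δ * (j + 1) / n - δ * i / n := by ring
            linarith
          calc _ ≤ 1 * 2 ^ (i : ℕ) * (2 * (δ / n * ((j : ℕ) + 1 - (i : ℕ)))) := by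
                gcongr
                exact hε i
            _ = _ := by ring
      _ = (2 * δ / n) * ∑ i ∈ Finset.range ((j : ℕ) + 1), (2 : ℝ) ^ i * ((j : ℕ) + 1 - i) := by
          rw [← Finset.mul_sum]
          congr 1
          refine Finset.sum_bij (fun i _ => (i : ℕ)) ?_ ?_ ?_ ?_
          · intro i hi
            have : i ≤ j := (Finset.mem_filter.1 hi).2
            exact Finset.mem_range.2 (Nat.lt_succ_of_le this)
          · intro i _ k _ h
            exact Fin.ext h
          · intro i hi
            have h5 : i ≤ (j : ℕ) := Nat.lt_succ_iff.1 (Finset.mem_range.1 hi)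
            exact ⟨⟨i, h5.trans_lt j.2⟩, Finset.mem_filter.2 ⟨Finset.mem_univ _, h5⟩, rfl⟩
          · intro i _; rfl
      _ ≤ (2 * δ / n) * (4 * 2 ^ (j : ℕ)) := by
          rw [sum_two_pow_mul]
          gcongr
          rw [pow_add]
          have : (0 : ℝ) ≤ (j : ℕ) := by positivity
          linarith
      _ = _ := by ring

lemma card_high_digits {n : ℕ} (j : Fin n) :
    Fintype.card ({i : Fin n // ¬i ≤ j} → Fin 2) = 2 ^ (n - 1 - (j : ℕ)) := by
  rw [Fintype.card_fun, Fintype.card_fin]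
  congr 1
  rw [Fintype.card_subtype, ← Fin.card_Ioi]
  congr 1
  ext i
  simp

/-- In the j-th layer the digits up to j shift a tube by at most w = 8δ2^j/n, so the slice is
covered by one interval of length w + 2δ for each of the 2^(n-1-j) choices of the higher digits. -/
lemma volume_kakeya_slice_le {n : ℕ} (hn : 0 < n) {δ : ℝ} (hδ : 0 < δ) (j : Fin n)
    {b : ℝ} (hb : b ∈ Set.Ico (δ * j / n) (δ * (j + 1) / n)) :
    volume ((fun a : ℝ => (a, b)) ⁻¹' ⋃ ε : Fin n → Fin 2, kakeyaTube δ ε) ≤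
      ENNReal.ofReal (4 * δ * 2 ^ n / n + δ * 2 ^ (n - (j : ℕ))) := by
  have hn' : (0 : ℝ) < n := by exact_mod_cast hn
  set v : ({i : Fin n // ¬i ≤ j} → Fin 2) → ℝ := fun η =>
    ∑ i, ((η i : ℕ) : ℝ) * 2 ^ (i : ℕ) * (2 * (b - δ * (i : ℕ) / n)) with hv
  set w := 8 * δ * 2 ^ (j : ℕ) / n with hw
  have hsub : ((fun a : ℝ => (a, b)) ⁻¹' ⋃ ε : Fin n → Fin 2, kakeyaTube δ ε) ⊆
      ⋃ η, Set.Icc (-v η - w - δ) (-v η + δ) := by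
    intro a ha
    obtain ⟨ε, hε⟩ := Set.mem_iUnion.1 (Set.mem_preimage.1 ha)
    have h1 : |a + tubeOffset δ ε + 2 * digitSum ε * b| ≤ δ := hε.1
    rw [add_assoc, tubeOffset_add, ← Finset.sum_filter_add_sum_filter_not _ (fun i => i ≤ j)] at h1
    have h2 := sum_low_digits_mem hn hδ ε j hb
    have h3 : ∑ i with ¬i ≤ j, ((ε i : ℕ) : ℝ) * 2 ^ (i : ℕ) * (2 * (b - δ * i / n)) =
        v fun i => ε i := by
      rw [hv]
      exact Finset.sum_subtype _ (by simp) _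
    rw [h3] at h1
    refine Set.mem_iUnion.2 ⟨fun i => ε i, ?_⟩
    have h4 := abs_le.1 h1
    constructor <;> linarith [h4.1, h4.2, h2.1, h2.2]
  refine (measure_mono hsub).trans ((measure_iUnion_fintype_le _ _).trans ?_)
  have h5 : ∀ η, volume (Set.Icc (-v η - w - δ) (-v η + δ)) = ENNReal.ofReal (w + 2 * δ) := by
    intro η
    rw [Real.volume_Icc]; congr 1; ring
  rw [Finset.sum_congr rfl fun η _ => h5 η, Finset.sum_const, Finset.card_univ, card_high_digits,
    nsmul_eq_mul, ← ENNReal.ofReal_natCast, ← ENNReal.ofReal_mul (by positivity)]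
  refine ENNReal.ofReal_le_ofReal (le_of_eq ?_)
  have h6 : n = (n - 1 - (j : ℕ)) + j + 1 := by have := j.2; omega
  have h7 : n - (j : ℕ) = (n - 1 - (j : ℕ)) + 1 := by have := j.2; omega
  have h8 : (2 : ℝ) ^ n = 2 ^ (n - 1 - (j : ℕ)) * 2 ^ (j : ℕ) * 2 := by
    conv_lhs => rw [h6, pow_add, pow_add, pow_one]
  rw [h7, h8, hw, pow_succ]
  push_cast
  ring

/-- Summing over n layers of thickness δ/n, the first term of the slice bound gives 4δ²2^n/n and the
second is geometric. The 2^n tubes have total area 2δ²2^n, so the union is smaller by a factor of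
order n. -/
lemma volume_iUnion_kakeyaTube_le {n : ℕ} (hn : 0 < n) {δ : ℝ} (hδ : 0 < δ) :
    volume (⋃ ε : Fin n → Fin 2, kakeyaTube δ ε) ≤ ENNReal.ofReal (6 * δ ^ 2 * 2 ^ n / n) := by
  have hn' : (0 : ℝ) < n := by exact_mod_cast hn
  rw [volume_eq_lintegral_slice (MeasurableSet.iUnion fun ε => measurableSet_kakeyaTube δ ε)]
  calc _ ≤ ∫⁻ b, ∑ j : Fin n, (Set.Ico (δ * j / n) (δ * (j + 1) / n)).indicator
        (fun _ => ENNReal.ofReal (4 * δ * 2 ^ n / n + δ * 2 ^ (n - (j : ℕ)))) b := by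
        refine lintegral_mono fun b => ?_
        by_cases hb : b ∈ Set.Ico 0 δ
        · have h0 : 0 ≤ b * n / δ := div_nonneg (mul_nonneg hb.1 hn'.le) hδ.le
          have hj : ⌊b * n / δ⌋₊ < n := by
            rw [Nat.floor_lt h0, div_lt_iff₀ hδ]
            nlinarith [hb.2]
          set j : Fin n := ⟨⌊b * n / δ⌋₊, hj⟩ with hjdef
          have hmem : b ∈ Set.Ico (δ * (j : ℕ) / n) (δ * ((j : ℕ) + 1) / n) := by
            constructor
            · have := Nat.floor_le h0
              rw [le_div_iff₀ hδ] at this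
              rw [div_le_iff₀ hn']
              simp only [hjdef]
              linarith
            · have := Nat.lt_floor_add_one (b * n / δ)
              rw [div_lt_iff₀ hδ] at this
              rw [lt_div_iff₀ hn']
              simp only [hjdef]
              linarith
          refine (volume_kakeya_slice_le hn hδ j hmem).trans ?_
          refine le_trans (le_of_eq ?_)
            (Finset.single_le_sum (fun _ _ => zero_le) (Finset.mem_univ j))
          rw [Set.indicator_of_mem hmem]
        · have : (fun a : ℝ => (a, b)) ⁻¹' (⋃ ε : Fin n → Fin 2, kakeyaTube δ ε) = ∅ := by
            ext a
            simp only [kakeyaTube, Set.mem_preimage, Set.mem_iUnion, Set.mem_ofPred_eq, hb,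
              and_false, exists_false, Set.mem_empty_iff_false]
          rw [this, measure_empty]
          exact zero_le
    _ = ∑ j : Fin n, ENNReal.ofReal ((4 * δ * 2 ^ n / n + δ * 2 ^ (n - (j : ℕ))) * (δ / n)) := by
        rw [lintegral_finsetSum _ fun j _ => measurable_const.indicator measurableSet_Ico]
        refine Finset.sum_congr rfl fun j _ => ?_
        rw [lintegral_indicator_const measurableSet_Ico, Real.volume_Ico,
          ← ENNReal.ofReal_mul (by positivity)]
        congr 2; ring
    _ = ENNReal.ofReal (∑ j : Fin n, (4 * δ * 2 ^ n / n + δ * 2 ^ (n - (j : ℕ))) * (δ / n)) := by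
        rw [ENNReal.ofReal_sum_of_nonneg fun j _ => by positivity]
    _ ≤ _ := by
        refine ENNReal.ofReal_le_ofReal ?_
        have h1 : ∑ j : Fin n, (2 : ℝ) ^ (n - (j : ℕ)) ≤ 2 * 2 ^ n := by
          rw [Fin.sum_univ_eq_sum_range (fun j => (2 : ℝ) ^ (n - j)) n]
          have h2 : ∑ j ∈ Finset.range n, (2 : ℝ) ^ (n - j) =
              ∑ j ∈ Finset.range n, (2 : ℝ) ^ (j + 1) := by
            rw [← Finset.sum_range_reflect]
            refine Finset.sum_congr rfl fun j hj => ?_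
            have := Finset.mem_range.1 hj
            congr 1; omega
          rw [h2]
          simp only [pow_succ]
          rw [← Finset.sum_mul, geom_sum_eq (by norm_num)]
          linarith
        rw [← Finset.sum_mul, Finset.sum_add_distrib, ← Finset.mul_sum, Finset.sum_const,
          Finset.card_univ, Fintype.card_fin, nsmul_eq_mul]
        have h3 : (n : ℝ) * (4 * δ * 2 ^ n / n) = 4 * δ * 2 ^ n := by field_simp
        rw [h3]
        calc _ ≤ (4 * δ * 2 ^ n + δ * (2 * 2 ^ n)) * (δ / n) := by gcongr
          _ = _ := by ring

end

/-! ### Wave packets on the Kakeya tubes: failure on the diagonal for horizontal strips -/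

noncomputable section

/-- The wave packet focused on a tube of the Kakeya arrangement. -/
def wavePacket {n : ℕ} (δ : ℝ) (ε : Fin n → Fin 2) (s : ℝ) : ℂ :=
  parabolaKernel (tubeOffset δ ε, 0) s * unitBump (s - digitSum ε)

lemma contDiff_wavePacket {n : ℕ} (δ : ℝ) (ε : Fin n → Fin 2) :
    ContDiff ℝ (⊤ : ℕ∞) (wavePacket δ ε) :=
  (contDiff_parabolaKernel _).mul (contDiff_unitBump.comp (by fun_prop))

lemma integrable_wavePacket {n : ℕ} (δ : ℝ) (ε : Fin n → Fin 2) : Integrable (wavePacket δ ε) :=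
  integrable_modulate (integrable_unitBump.comp_sub_right _) _

/-- The frequency shift by `digitSum ε` sets the direction of the tube and the modulation sets its
offset; on the tube the bump is evaluated near the origin. -/
lemma norm_extOp_wavePacket {n : ℕ} (δ : ℝ) (ε : Fin n → Fin 2) (z : ℝ × ℝ) :
    ‖extOp (wavePacket δ ε) z‖ =
      ‖extOp unitBump (z.1 + tubeOffset δ ε + 2 * digitSum ε * z.2, z.2)‖ := by
  have h1 : extOp (wavePacket δ ε) z =
      extOp (fun s => unitBump (s - digitSum ε)) (z + (tubeOffset δ ε, 0)) := extOp_modulate _ _ _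
  rw [h1, norm_extOp_comp_sub]
  simp

lemma mem_Ioo_of_wavePacket_ne_zero {n : ℕ} {δ : ℝ} {ε : Fin n → Fin 2} {s : ℝ}
    (h : wavePacket δ ε s ≠ 0) : s ∈ Set.Ioo (digitSum ε : ℝ) (digitSum ε + 1) := by
  by_contra hs
  refine h ?_
  rw [wavePacket, unitBump_eq_zero, mul_zero]
  intro h1
  refine hs ⟨?_, ?_⟩ <;> linarith [h1.1, h1.2]

lemma wavePacket_eq_zero_or {n : ℕ} (δ : ℝ) (s : ℝ) {ε η : Fin n → Fin 2} (h : ε ≠ η) :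
    wavePacket δ ε s = 0 ∨ wavePacket δ η s = 0 := by
  by_contra! h0
  have h1 := mem_Ioo_of_wavePacket_ne_zero h0.1
  have h2 := mem_Ioo_of_wavePacket_ne_zero h0.2
  refine h (digitSum_injective n (le_antisymm ?_ ?_)) <;> rw [← Nat.lt_add_one_iff]
  · have : (digitSum ε : ℝ) < digitSum η + 1 := h1.1.trans h2.2
    exact_mod_cast this
  · have : (digitSum η : ℝ) < digitSum ε + 1 := h2.1.trans h1.2
    exact_mod_cast this

lemma norm_wavePacket_le {n : ℕ} (δ : ℝ) (ε : Fin n → Fin 2) (s : ℝ) : ‖wavePacket δ ε s‖ ≤ 1 := by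
  rw [wavePacket, norm_mul, norm_parabolaKernel, one_mul]
  exact norm_unitBump_le _

lemma eLpNorm_sum_wavePacket_le (n : ℕ) (δ : ℝ) {x : ℝ} (hx : 0 ≤ x) :
    eLpNorm (fun s => ∑ ε : Fin n → Fin 2, wavePacket δ ε s) (recipExp x) volume ≤
      ENNReal.ofReal (2 ^ n) ^ x := by
  have h1 : ∀ s, ‖∑ ε : Fin n → Fin 2, wavePacket δ ε s‖ ≤
      (Set.Icc (0 : ℝ) (2 ^ n)).indicator 1 s := by
    intro s
    by_cases h : ∃ ε : Fin n → Fin 2, wavePacket δ ε s ≠ 0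
    · obtain ⟨ε, hε⟩ := h
      rw [Finset.sum_eq_single ε (fun η _ hη => (wavePacket_eq_zero_or δ s hη).resolve_right hε)
        (by simp), Set.indicator_of_mem]
      · exact norm_wavePacket_le δ ε s
      · have h2 := mem_Ioo_of_wavePacket_ne_zero hε
        have h3 : (digitSum ε : ℝ) + 1 ≤ 2 ^ n := by exact_mod_cast digitSum_lt ε
        exact ⟨(Nat.cast_nonneg _).trans h2.1.le, h2.2.le.trans h3⟩
    · push Not at h
      rw [Finset.sum_eq_zero fun ε _ => h ε, norm_zero]
      exact Set.indicator_nonneg (fun _ _ => zero_le_one) _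
  refine (eLpNorm_le_rpow_of_le_indicator h1 hx).trans (le_of_eq ?_)
  rw [Real.volume_Icc, sub_zero]

lemma setLIntegral_le_rpow_mul {β : Type*} [MeasurableSpace β] {ν : Measure β} {G : β → ℝ≥0∞}
    (hG : Measurable G) (U : Set β) {a : ℝ} (ha : 0 < a) (ha' : a < 1) :
    ∫⁻ z in U, G z ∂ν ≤ (∫⁻ z, G z ^ a⁻¹ ∂ν) ^ a * ν U ^ (1 - a) := by
  have h1 := ENNReal.lintegral_mul_le_Lp_mul_Lq (ν.restrict U)
    (Real.HolderConjugate.inv_one_sub_inv ha ha') (f := G) (g := fun _ => 1) hG.aemeasurable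
    aemeasurable_const
  simp only [Pi.mul_apply, mul_one, one_div, inv_inv, ENNReal.one_rpow, lintegral_const,
    Measure.restrict_apply_univ, one_mul] at h1
  exact h1.trans (mul_le_mul' (ENNReal.rpow_le_rpow (setLIntegral_le_lintegral _ _) ha.le) le_rfl)

/-- The strip estimate in the vertical directions fails for `2 < p = q < ∞`, by Kakeya
compression. -/
theorem not_hasSmoothType_horStrip_diag {y : ℝ} (hy : 0 < y) (hy' : y < 1 / 2) :
    ¬HasSmoothType horStrip y y := by
  rintro ⟨C, hC⟩
  obtain ⟨c, δ, hc, hδ, hδ', hcδ⟩ := exists_le_norm_extOp_unitBump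
  -- The square function has integral at least N c² · 2δ² over the union U of the tubes, N = 2^n. By
  -- Hölder it is at most C² N^(2y) |U|^(1-2y), and |U| ≤ 6δ²N/n. The powers of N cancel and
  -- n^(-(1-2y)) remains, which tends to 0 as y < 1/2.
  have key : ∀ n : ℕ, 0 < n →
      c ^ 2 * (2 * δ ^ 2) ≤ (C : ℝ) ^ 2 * ((6 * δ ^ 2) ^ (1 - 2 * y) * (n : ℝ) ^ (-(1 - 2 * y))) := by
    intro n hn
    have hn' : (0 : ℝ) < n := by exact_mod_cast hn
    set N : ℝ := 2 ^ n with hN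
    have hN0 : 0 < N := by positivity
    set U := ⋃ ε : Fin n → Fin 2, kakeyaTube δ ε with hU
    set G : ℝ × ℝ → ℝ≥0∞ := fun z => ∑ ε : Fin n → Fin 2, ‖extOp (wavePacket δ ε) z‖ₑ ^ 2 with hGdef
    have hm : ∀ ε : Fin n → Fin 2, Measurable fun z => ‖extOp (wavePacket δ ε) z‖ₑ ^ 2 := fun ε =>
      (measurable_extOp (integrable_wavePacket δ ε).1).enorm.pow_const 2
    have hG : Measurable G := Finset.measurable_sum _ fun ε _ => hm ε
    have htube : ∀ ε : Fin n → Fin 2, horStrip (kakeyaTube δ ε) = ENNReal.ofReal (2 * δ ^ 2) := by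
      intro ε
      have hsub : kakeyaTube δ ε ⊆ {z : ℝ × ℝ | |z.2| ≤ 1 / 2} := fun z hz => by
        have h1 : z.2 ∈ Set.Ico 0 δ := hz.2
        rw [Set.mem_ofPred_eq, abs_of_nonneg h1.1]
        linarith [h1.2]
      rw [horStrip, Measure.restrict_eq_self _ hsub, volume_kakeyaTube hδ]
    have hlower : ENNReal.ofReal (N * (c ^ 2 * (2 * δ ^ 2))) ≤ ∫⁻ z in U, G z ∂horStrip := by
      have h1 : ∀ ε : Fin n → Fin 2, ENNReal.ofReal (c ^ 2 * (2 * δ ^ 2)) ≤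
          ∫⁻ z in U, ‖extOp (wavePacket δ ε) z‖ₑ ^ 2 ∂horStrip := by
        intro ε
        calc ENNReal.ofReal (c ^ 2 * (2 * δ ^ 2))
            = ∫⁻ _ in kakeyaTube δ ε, ENNReal.ofReal (c ^ 2) ∂horStrip := by
              rw [setLIntegral_const, htube, ENNReal.ofReal_mul (by positivity)]
          _ ≤ ∫⁻ z in kakeyaTube δ ε, ‖extOp (wavePacket δ ε) z‖ₑ ^ 2 ∂horStrip := by
              refine setLIntegral_mono' (measurableSet_kakeyaTube δ ε) fun z hz => ?_
              have h2 : z.2 ∈ Set.Ico 0 δ := hz.2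
              rw [← ofReal_norm, norm_extOp_wavePacket, ← ENNReal.ofReal_pow (norm_nonneg _)]
              refine ENNReal.ofReal_le_ofReal (pow_le_pow_left₀ hc.le (hcδ _ hz.1 ?_) 2)
              simp only
              rw [abs_of_nonneg h2.1]
              exact h2.2.le
          _ ≤ _ := lintegral_mono_set (Set.subset_iUnion _ ε)
      calc _ = ∑ _ε : Fin n → Fin 2, ENNReal.ofReal (c ^ 2 * (2 * δ ^ 2)) := by
            rw [Finset.sum_const, Finset.card_univ, nsmul_eq_mul, Fintype.card_fun,
              Fintype.card_fin, Fintype.card_fin, ENNReal.ofReal_mul hN0.le,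
              ← ENNReal.ofReal_natCast]
            push_cast
            rfl
        _ ≤ ∑ ε : Fin n → Fin 2, ∫⁻ z in U, ‖extOp (wavePacket δ ε) z‖ₑ ^ 2 ∂horStrip :=
            Finset.sum_le_sum fun ε _ => h1 ε
        _ = _ := (lintegral_finsetSum _ fun ε _ => hm ε).symm
    have hupper : ∫⁻ z in U, G z ∂horStrip ≤
        (C * ENNReal.ofReal N ^ y) ^ (2 : ℝ) *
          ENNReal.ofReal (6 * δ ^ 2 * N / n) ^ (1 - 2 * y) := by
      refine (setLIntegral_le_rpow_mul hG U (a := 2 * y) (by linarith) (by linarith)).trans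
        (mul_le_mul' ?_ (ENNReal.rpow_le_rpow ?_ (by linarith)))
      · have h1 := lintegral_square_function_le hy hy'.le hC (fun ε => wavePacket δ ε)
          (fun ε : Fin n → Fin 2 => contDiff_wavePacket δ ε) (fun ε => integrable_wavePacket δ ε)
          (fun s k l hkl => wavePacket_eq_zero_or δ s hkl)
        rw [show (2 * y)⁻¹ = y⁻¹ / 2 by rw [mul_inv]; ring]
        refine (ENNReal.rpow_le_rpow h1 (by linarith)).trans ?_
        rw [← ENNReal.rpow_mul, show y⁻¹ * (2 * y) = 2 by field_simp]
        exact ENNReal.rpow_le_rpow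
          (mul_le_mul' le_rfl (eLpNorm_sum_wavePacket_le n δ hy.le)) (by norm_num)
      · exact (Measure.restrict_le_self _).trans (volume_iUnion_kakeyaTube_le hn hδ)
    have h2 := hlower.trans hupper
    rw [ENNReal.ofReal_rpow_of_pos hN0, ← ENNReal.ofReal_coe_nnreal,
      ← ENNReal.ofReal_mul (NNReal.coe_nonneg C),
      ENNReal.ofReal_rpow_of_nonneg (by positivity) (by norm_num),
      ENNReal.ofReal_rpow_of_pos (by positivity), ← ENNReal.ofReal_mul (by positivity),
      ENNReal.ofReal_le_ofReal_iff (by positivity)] at h2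
    have h3 : ((C : ℝ) * N ^ y) ^ (2 : ℝ) * (6 * δ ^ 2 * N / n) ^ (1 - 2 * y) =
        N * ((C : ℝ) ^ 2 * ((6 * δ ^ 2) ^ (1 - 2 * y) * (n : ℝ) ^ (-(1 - 2 * y)))) := by
      rw [Real.rpow_ofNat, mul_pow, ← Real.rpow_natCast (N ^ y), ← Real.rpow_mul hN0.le,
        Real.div_rpow (by positivity) hn'.le, Real.mul_rpow (by positivity) hN0.le,
        Real.rpow_neg hn'.le]
      have h4 : N ^ (y * (2 : ℕ)) * N ^ (1 - 2 * y) = N := by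
        rw [← Real.rpow_add hN0]
        convert Real.rpow_one N using 2
        push_cast; ring
      linear_combination ((C : ℝ) ^ 2 * (6 * δ ^ 2) ^ (1 - 2 * y) / (n : ℝ) ^ (1 - 2 * y)) * h4
    rw [h3] at h2
    exact le_of_mul_le_mul_left h2 hN0
  have h1 := (tendsto_rpow_neg_atTop (by linarith : 0 < 1 - 2 * y)).comp
    (tendsto_natCast_atTop_atTop (R := ℝ))
  have h2 := (h1.const_mul ((6 * δ ^ 2) ^ (1 - 2 * y))).const_mul ((C : ℝ) ^ 2)
  rw [mul_zero, mul_zero] at h2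
  have h3 : c ^ 2 * (2 * δ ^ 2) ≤ 0 := ge_of_tendsto h2 (by
    filter_upwards [Filter.eventually_gt_atTop 0] with n hn
    exact key n hn)
  have : 0 < c ^ 2 * (2 * δ ^ 2) := by positivity
  linarith

end

/-! ### Translation of exponents and assembly -/

noncomputable section

lemma exists_eq_recipExp {p : ℝ≥0∞} (hp : 1 ≤ p) : ∃ x : ℝ, 0 ≤ x ∧ x ≤ 1 ∧ p = recipExp x := by
  have h1 : p⁻¹ ≤ 1 := ENNReal.inv_le_one.2 hp
  refine ⟨p⁻¹.toReal, ENNReal.toReal_nonneg, ?_, ?_⟩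
  · exact ENNReal.toReal_le_of_le_ofReal zero_le_one (by simpa using h1)
  · rw [recipExp, ENNReal.ofReal_toReal (ne_top_of_le_ne_top ENNReal.one_ne_top h1), inv_inv]

lemma one_div_recipExp (x : ℝ) : 1 / recipExp x = ENNReal.ofReal x := by simp [recipExp]

lemma ofNat_div_recipExp (m : ℕ) [m.AtLeastTwo] (x : ℝ) :
    (ofNat(m) : ℝ≥0∞) / recipExp x = ENNReal.ofReal (ofNat(m) * x) := by
  rw [recipExp, div_eq_mul_inv, inv_inv, ENNReal.ofReal_mul (Nat.ofNat_nonneg m),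
    ENNReal.ofReal_ofNat]

lemma recipExp_le_recipExp_iff {x y : ℝ} (hx : 0 ≤ x) : recipExp x ≤ recipExp y ↔ y ≤ x := by
  rw [recipExp, recipExp, ENNReal.inv_le_inv, ENNReal.ofReal_le_ofReal_iff hx]

lemma recipExp_lt_recipExp_iff {x y : ℝ} (hy : 0 ≤ y) : recipExp x < recipExp y ↔ y < x := by
  rw [← not_le, recipExp_le_recipExp_iff hy, not_le]

lemma recipExp_inj {x y : ℝ} (hx : 0 ≤ x) (hy : 0 ≤ y) : recipExp x = recipExp y ↔ x = y := by
  rw [recipExp, recipExp, inv_inj, ENNReal.ofReal_eq_ofReal_iff hx hy]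

lemma recipExp_quarter : recipExp (1 / 4) = 4 := by
  rw [recipExp, one_div, ENNReal.ofReal_inv_of_pos (by norm_num), inv_inv]; simp

lemma ofReal_half : ENNReal.ofReal (1 / 2) = 1 / 2 := by
  rw [ENNReal.ofReal_div_of_pos (by norm_num)]; simp

section Exponents

variable {x y : ℝ}

lemma recipExp_line_eq_iff (hx : 0 ≤ x) (hy : 0 ≤ y) :
    (1 / recipExp x + 1 / recipExp y = 1 ↔ x + y = 1) ∧
    (1 / recipExp x + 2 / recipExp y = 1 ↔ x + 2 * y = 1) ∧
    (1 / recipExp x + 1 / recipExp y = 1 / 2 ↔ x + y = 1 / 2) := by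
  simp only [one_div_recipExp, ofNat_div_recipExp]
  rw [← ENNReal.ofReal_add hx hy, ← ENNReal.ofReal_add hx (by positivity), ← ofReal_half,
    ← ENNReal.ofReal_one, ENNReal.ofReal_eq_ofReal_iff (by positivity) (by positivity),
    ENNReal.ofReal_eq_ofReal_iff (by positivity) (by positivity),
    ENNReal.ofReal_eq_ofReal_iff (by positivity) (by positivity)]
  exact ⟨Iff.rfl, Iff.rfl, Iff.rfl⟩

lemma recipExp_halfPlane_iff (hx : 0 ≤ x) (hy : 0 ≤ y) :
    (1 / recipExp x + 1 / recipExp y ≤ 1 ↔ x + y ≤ 1) ∧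
    (1 ≤ 1 / recipExp x + 3 / recipExp y ↔ 1 ≤ x + 3 * y) ∧
    (1 / recipExp x + 2 / recipExp y ≤ 1 ↔ x + 2 * y ≤ 1) ∧
    (1 / recipExp x + 2 / recipExp y < 1 ↔ x + 2 * y < 1) ∧
    (1 / 2 < 1 / recipExp x + 1 / recipExp y ↔ 1 / 2 < x + y) := by
  simp only [one_div_recipExp, ofNat_div_recipExp]
  rw [← ENNReal.ofReal_add hx hy, ← ENNReal.ofReal_add hx (by positivity),
    ← ENNReal.ofReal_add hx (by positivity), ← ofReal_half, ← ENNReal.ofReal_one,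
    ENNReal.ofReal_le_ofReal_iff (by positivity), ENNReal.ofReal_le_ofReal_iff (by positivity),
    ENNReal.ofReal_le_ofReal_iff (by positivity), ENNReal.ofReal_lt_ofReal_iff (by positivity),
    ENNReal.ofReal_lt_ofReal_iff_of_nonneg (by norm_num)]
  exact ⟨Iff.rfl, Iff.rfl, Iff.rfl, Iff.rfl, Iff.rfl⟩

lemma nonTransversalRegion_recipExp_iff (hx : 0 ≤ x) (hy : 0 ≤ y) :
    NonTransversalRegion (recipExp x) (recipExp y) ↔
      (y ≤ x ∧ 1 ≤ x + 3 * y ∧ x + 2 * y ≤ 1 ∧ ¬(x = 1 / 4 ∧ y = 1 / 4)) ∨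
        (x < y ∧ 1 / 2 < x + y ∧ x + 2 * y < 1) := by
  obtain ⟨-, h2, h3, h4, h5⟩ := recipExp_halfPlane_iff hx hy
  rw [NonTransversalRegion, h2, h3, h4, h5, recipExp_le_recipExp_iff hx,
    recipExp_lt_recipExp_iff hx, ← recipExp_quarter, recipExp_inj hx (by norm_num),
    recipExp_inj hy (by norm_num)]

lemma openSegmentBD_recipExp_iff (hx : 0 ≤ x) (hy : 0 ≤ y) :
    OpenSegmentBD (recipExp x) (recipExp y) ↔ x + y = 1 / 2 ∧ x < 1 / 4 ∧ 0 < x := by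
  rw [OpenSegmentBD, (recipExp_line_eq_iff hx hy).2.2, ← recipExp_quarter, ← recipExp_zero,
    recipExp_lt_recipExp_iff hx, recipExp_lt_recipExp_iff le_rfl]

end Exponents

lemma apply_zero_ne_zero {ω : Plane} (hω : ‖ω‖ = 1) (h : ¬(ω = !₂[0, 1] ∨ ω = !₂[0, -1])) :
    ω 0 ≠ 0 := by
  intro h0
  have h1 := sq_add_sq_of_norm_eq_one hω
  rw [h0, mul_zero, zero_add] at h1
  rcases mul_self_eq_one_iff.1 h1 with h2 | h2
  · refine h (Or.inl ?_)
    ext i; fin_cases i <;> simp [h0, h2]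
  · refine h (Or.inr ?_)
    ext i; fin_cases i <;> simp [h0, h2]

lemma radonEstimate_vertical_iff {ω : Plane} (hω : ω = !₂[0, 1] ∨ ω = !₂[0, -1]) {x y : ℝ}
    (hx : 0 ≤ x) (hx' : x ≤ 1) (hy : 0 ≤ y) (hy' : y ≤ 1) :
    RadonEstimate parabolaMeasure ω (recipExp x) (recipExp y) ↔ x + y = 1 ∧ y ≤ x := by
  constructor
  · intro h
    have h1 := hasSmoothType_of_radonEstimate hy' h
    rw [coordLine_of_vertical hω] at h1
    -- The line estimate implies the strip estimate, whose necessary conditions supply x + y ≤ 1 and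
    -- y ≤ x; the reverse inequality 1 ≤ x + y comes from the line itself.
    have h2 := h1.horStrip_of_horLine hy
    exact ⟨le_antisymm (h2.horStrip_le_one hx hx' hy) (h1.horLine_one_le hx hx' hy),
      h2.horStrip_le hx hx' hy⟩
  · rintro ⟨h1, h2⟩
    refine HasStrongType.radonEstimate hy' ?_
    rw [coordLine_of_vertical hω, show y = 1 - x by linarith]
    exact hasStrongType_horLine (by linarith) hx'

lemma stripEstimate_vertical_iff {ω : Plane} (hn : ‖ω‖ = 1) (hω : ω = !₂[0, 1] ∨ ω = !₂[0, -1])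
    {x y : ℝ} (hx : 0 ≤ x) (hx' : x ≤ 1) (hy : 0 ≤ y) :
    StripEstimate parabolaMeasure ω (recipExp x) (recipExp y) ↔
      x + y ≤ 1 ∧ 1 ≤ x + 3 * y ∧ (y < x ∨ (x = 1 / 2 ∧ y = 1 / 2)) := by
  constructor
  · intro h
    have h1 := hasSmoothType_of_stripEstimate hn h
    rw [coordStrip_of_vertical hω] at h1
    have h2 := h1.horStrip_one_le hx hx' hy
    refine ⟨h1.horStrip_le_one hx hx' hy, h2, ?_⟩
    rcases (h1.horStrip_le hx hx' hy).eq_or_lt with rfl | h3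
    · rcases (h1.horStrip_le_half hx hx' hy).eq_or_lt with rfl | h4
      · exact Or.inr ⟨rfl, rfl⟩
      · exact absurd h1 (not_hasSmoothType_horStrip_diag (by linarith) h4)
    · exact Or.inl h3
  · rintro ⟨h1, h2, h3⟩
    refine HasStrongType.stripEstimate hn ?_
    rw [coordStrip_of_vertical hω]
    exact hasStrongType_horStrip hx' hy h1 h2 h3

lemma radonEstimate_nonvertical_iff {ω : Plane} (hω : ω 0 ≠ 0) {x y : ℝ}
    (hx : 0 ≤ x) (hx' : x ≤ 1) (hy : 0 ≤ y) (hy' : y ≤ 1) :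
    RadonEstimate parabolaMeasure ω (recipExp x) (recipExp y) ↔ x + 2 * y = 1 ∧ y ≤ x := by
  constructor
  · intro h
    have h1 := (hasSmoothType_of_radonEstimate hy' h).vertLine hω
    have h2 := h1.vertStrip_of_vertLine hy 1
    have h3 : x + 2 * y = 1 :=
      le_antisymm (h2.vertStrip_le_one hx hx' hy one_pos) (h1.vertLine_one_le hx hx' hy)
    exact ⟨h3, h2.vertStrip_le_of_eq one_pos hx h3⟩
  · rintro ⟨h1, h2⟩
    refine HasStrongType.radonEstimate hy' (HasStrongType.coordLine hω ?_)
    rw [show x = 1 - 2 * y by linarith]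
    exact hasStrongType_vertLine hy (by linarith)

lemma StripEstimate.region_of_nonvertical {ω : Plane} (hn : ‖ω‖ = 1) (hω : ω 0 ≠ 0) {x y : ℝ}
    (hx : 0 ≤ x) (hx' : x ≤ 1) (hy : 0 ≤ y)
    (h : StripEstimate parabolaMeasure ω (recipExp x) (recipExp y)) :
    ((y ≤ x ∧ 1 ≤ x + 3 * y ∧ x + 2 * y ≤ 1 ∧ ¬(x = 1 / 4 ∧ y = 1 / 4)) ∨
      (x < y ∧ 1 / 2 < x + y ∧ x + 2 * y < 1)) ∨ (x + y = 1 / 2 ∧ x < 1 / 4 ∧ 0 < x) := by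
  have hR : 0 < 1 / (2 * |ω 0|) := by positivity
  have h1 := (hasSmoothType_of_stripEstimate hn h).vertStrip hω
  have h2 := h1.vertStrip_one_le hx hx' hy hR
  have h3 := h1.vertStrip_le_one hx hx' hy hR
  have h4 := h1.vertStrip_half_le hx hx' hy hR
  rcases le_or_gt y x with hyx | hyx
  · refine Or.inl (Or.inl ⟨hyx, h2, h3, ?_⟩)
    rintro ⟨rfl, rfl⟩
    exact not_hasSmoothType_vertStrip_quarter hR h1
  -- For y > x equality is excluded by the randomized dilates.
  · have h5 : x + 2 * y < 1 := h3.lt_of_ne fun h5 =>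
      absurd (h1.vertStrip_le_of_eq hR hx h5) (not_le.2 hyx)
    rcases h4.eq_or_lt with h6 | h6
    · refine Or.inr ⟨h6.symm, by linarith, by linarith⟩
    · exact Or.inl (Or.inr ⟨hyx, h6, h5⟩)

end

theorem theorem2 (ω : Plane) (hω : ‖ω‖ = 1) (p q : ℝ≥0∞) (hp : 1 ≤ p) (hq : 1 ≤ q) :
    ((ω = !₂[0, 1] ∨ ω = !₂[0, -1]) →
      (RadonEstimate parabolaMeasure ω p q ↔ 1 / p + 1 / q = 1 ∧ p ≤ q) ∧
      (StripEstimate parabolaMeasure ω p q ↔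
        1 / p + 1 / q ≤ 1 ∧ 1 ≤ 1 / p + 3 / q ∧ (p < q ∨ (p = 2 ∧ q = 2)))) ∧
    (¬(ω = !₂[0, 1] ∨ ω = !₂[0, -1]) →
      (RadonEstimate parabolaMeasure ω p q ↔ 1 / p + 2 / q = 1 ∧ p ≤ q) ∧
      (NonTransversalRegion p q → StripEstimate parabolaMeasure ω p q) ∧
      (¬NonTransversalRegion p q → ¬OpenSegmentBD p q →
        ¬StripEstimate parabolaMeasure ω p q)) := by
  obtain ⟨x, hx, hx', rfl⟩ := exists_eq_recipExp hp
  obtain ⟨y, hy, hy', rfl⟩ := exists_eq_recipExp hq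
  obtain ⟨hL1, hL2, -⟩ := recipExp_line_eq_iff hx hy
  obtain ⟨hP1, hP2, -⟩ := recipExp_halfPlane_iff hx hy
  refine ⟨fun h => ⟨?_, ?_⟩, fun h => ?_⟩
  · rw [hL1, recipExp_le_recipExp_iff hx]
    exact radonEstimate_vertical_iff h hx hx' hy hy'
  · rw [hP1, hP2, recipExp_lt_recipExp_iff hy, ← recipExp_half, recipExp_inj hx (by norm_num),
      recipExp_inj hy (by norm_num)]
    exact stripEstimate_vertical_iff hω h hx hx' hy
  · have h0 := apply_zero_ne_zero hω h
    rw [hL2, recipExp_le_recipExp_iff hx, nonTransversalRegion_recipExp_iff hx hy,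
      openSegmentBD_recipExp_iff hx hy]
    refine ⟨radonEstimate_nonvertical_iff h0 hx hx' hy hy', fun hreg => ?_, fun h1 h2 h3 => ?_⟩
    · exact HasStrongType.stripEstimate hω
        (HasStrongType.coordStrip h0 (hasStrongType_vertStrip _ hx' hy hreg))
    · exact (h3.region_of_nonvertical hω h0 hx hx' hy).elim h1 h2
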